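/- Let $d\ge 2$ and let $\theta=(\theta_{kj})$ be a real skew-symmetric $d\times d$ matrix. Let $\mathbb T^d_\theta$ be the quantum torus, i.e. the von Neumann algebra generated, in the GNS representation of the canonical trace $\tau$, by unitaries $U_1,\dots,U_d$ with $U_kU_j=e^{2\pi i\theta_{kj}}U_jU_k$, where $\tau\big(\sum_m\alpha_mU^m\big)=\alpha_0$ on polynomials, $U^m=U_1^{m_1}\cdots U_d^{m_d}$ for $m\in\mathbb Z^d$. For $1\le p<\infty$ let $L_p(\mathbb T^d_\theta)$ be the completion of $\mathbb T^d_\theta$ for $\|x\|_p=\tau(|x|^p)^{1/p}$, and $L_\infty(\mathbb T^d_\theta)=\mathbb T^d_\theta$ with the operator norm. Let $\mathcal S(\mathbb T^d_\theta)$ be the space of the elements $\sum_m a_mU^m$ with $(a_m)$ rapidly decreasing, with the topology given by the norms $\sup_{|\alpha|_1\le N}\|D^\alpha x\|_\infty$ ($N\ge0$), where $D^\alpha=\partial_1^{\alpha_1}\cdots\partial_d^{\alpha_d}$ and $\partial_j(U^m)=2\pi i\,m_jU^m$; distributions are the elements of the dual $\mathcal S'(\mathbb T^d_\theta)$. The space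 $L_p(\mathbb T^d_\theta)$ embeds into $\mathcal S'(\mathbb T^d_\theta)$ by $\langle y,x\rangle=\tau(yx)$, the derivations $D^\alpha$ extend to $\mathcal S'(\mathbb T^d_\theta)$ by duality, and $\widehat x(m)=\langle x,(U^m)^*\rangle$. For an integer $k\ge1$ let $W^k_p(\mathbb T^d_\theta)=\{x\in\mathcal S'(\mathbb T^d_\theta): D^\alpha x\in L_p(\mathbb T^d_\theta)\text{ for all }|\alpha|_1\le k\}$, with the norm $\|x\|_{W^k_p}=\big(\sum_{|\alpha|_1\le k}\|D^\alpha x\|_p^p\big)^{1/p}$ (the maximum if $p=\infty$). For $u\in\mathbb R^d$ let $\Delta_u$ be the Fourier multiplier with symbol $m\mapsto e^{2\pi i u\cdot m}-1$, and let $\omega^k_p(x,\varepsilon)=\sup_{0<|u|\le\varepsilon}\|\Delta_u^kx\|_p$. For a couple of Banach spaces $(X_0,X_1)$, $x\in X_0+X_1$ and $t>0$ let $K(x,t;X_0,X_1)=\inf\{\|x_0\|_{X_0}+t\|x_1\|_{X_1}: x=x_0+x_1,\ x_0\in X_0,\ x_1\in X_1\}$, and for $0<\eta<1$, $1\le q\le\infty$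 let $(X_0,X_1)_{\eta,q}$ be the space of all $x\in X_0+X_1$ with $\|x\|_{\eta,q}=\big(\int_0^\infty(t^{-\eta}K(x,t;X_0,X_1))^q\frac{dt}t\big)^{1/q}<\infty$ (a supremum over $t>0$ if $q=\infty$). Let $\varphi$ be a real-valued Schwartz function on $\mathbb R^d$ with support in $\{\frac12\le|\xi|\le2\}$, $\varphi>0$ on $\{\frac12<|\xi|<2\}$ and $\sum_{j\in\mathbb Z}\varphi(2^{-j}\xi)=1$ for $\xi\ne0$, and let $\widetilde\varphi_j*x$ be the image of $x$ under the Fourier multiplier with symbol $\varphi(2^{-j}\cdot)$. For $\alpha\in\mathbb R$ the Besov space $B^\alpha_{p,q}(\mathbb T^d_\theta)$ consists of all $x\in\mathcal S'(\mathbb T^d_\theta)$ with $\|x\|_{B^\alpha_{p,q}}=\big(|\widehat x(0)|^q+\sum_{j\ge0}2^{qj\alpha}\|\widetilde\varphi_j*x\|_p^q\big)^{1/q}<\infty$ (a supremum if $q=\infty$). **Theorem.** Let $d\ge2$ and let $k\ge1$ be an integer. (1) There is a constant $C>0$ that depends only on $d$ and $k$ such that, for every real skew-symmetric $d\times d$ matrix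 $\theta$, every $1\le p\le\infty$, every $x\in L_p(\mathbb T^d_\theta)$ and every $0<\varepsilon\le1$, $$C^{-1}\big(\varepsilon^k|\widehat x(0)|+\omega^k_p(x,\varepsilon)\big)\le K\big(x,\varepsilon^k;L_p(\mathbb T^d_\theta),W^k_p(\mathbb T^d_\theta)\big)\le C\big(\varepsilon^k|\widehat x(0)|+\omega^k_p(x,\varepsilon)\big).$$ (2) For every real skew-symmetric $d\times d$ matrix $\theta$, all $1\le p,q\le\infty$ and all $0<\eta<1$, $$\big(L_p(\mathbb T^d_\theta),W^k_p(\mathbb T^d_\theta)\big)_{\eta,q}=B^{\eta k}_{p,q}(\mathbb T^d_\theta)$$ with equivalent norms. -/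

import Mathlib

open MeasureTheory Set Filter Topology
open scoped ENNReal NNReal SchwartzMap

noncomputable section

namespace QTorus

/-! ### The quantum torus, acting on the GNS space of its trace -/

/-- The lattice `ℤ^d`. -/
abbrev Lattice (d : ℕ) : Type := Fin d → ℤ

/-- The GNS space of the canonical trace, with its orthonormal basis `(U^m)`, `m ∈ ℤ^d`. -/
abbrev GNS (d : ℕ) : Type := lp (fun _ : Lattice d => ℂ) 2

variable {d : ℕ}

/-- The phase `σ(m, n) = exp(2πi ∑_{l < j} θ_{jl} m_j n_l)`, for which `U^m U^n = σ(m, n) U^{m+n}`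
holds for the ordered monomials `U^m = U_1^{m_1} ⋯ U_d^{m_d}`. -/
def phase (θ : Matrix (Fin d) (Fin d) ℝ) (m n : Lattice d) : ℂ :=
  Complex.exp (((2 * Real.pi *
    ∑ j, ∑ l ∈ Finset.univ.filter (fun l => l < j), θ j l * (m j : ℝ) * (n l : ℝ) : ℝ) : ℂ)
      * Complex.I)

theorem norm_phase (θ : Matrix (Fin d) (Fin d) ℝ) (m n : Lattice d) : ‖phase θ m n‖ = 1 := by
  unfold phase
  exact Complex.norm_exp_ofReal_mul_I _

theorem summable_shift (θ : Matrix (Fin d) (Fin d) ℝ) (m : Lattice d) (f : GNS d) :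
    Summable fun n => ‖phase θ m (n - m) * f (n - m)‖ ^ (2 : ℝ≥0∞).toReal := by
  have h := (lp.memℓp f).summable (by norm_num)
  simp only [norm_mul, norm_phase, one_mul]
  exact (Equiv.subRight m).summable_iff.2 h

/-- Left multiplication by the monomial `U^m = U_1^{m_1} ⋯ U_d^{m_d}`:
it maps the basis vector `U^n` to `σ(m, n) U^{m+n}`. -/
def mon (θ : Matrix (Fin d) (Fin d) ℝ) (m : Lattice d) : GNS d →L[ℂ] GNS d :=
  LinearMap.mkContinuous
    { toFun := fun f => ⟨fun n => phase θ m (n - m) * f (n - m),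
        (memℓp_gen_iff (by norm_num)).2 (summable_shift θ m f)⟩
      map_add' := fun f g => by
        ext n
        exact mul_add _ _ _
      map_smul' := fun c f => by
        ext n
        exact mul_left_comm _ _ _ } 1 (fun f => by
      rw [one_mul, ← Real.rpow_le_rpow_iff (norm_nonneg _) (norm_nonneg _)
          (show 0 < (2 : ℝ≥0∞).toReal by norm_num),
        lp.norm_rpow_eq_tsum (by norm_num), lp.norm_rpow_eq_tsum (by norm_num)]
      simp only [LinearMap.coe_mk, AddHom.coe_mk, norm_mul, norm_phase, one_mul]
      exact ((Equiv.subRight m).tsum_eq (fun n => ‖f n‖ ^ (2 : ℝ≥0∞).toReal)).le)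

theorem mon_apply (θ : Matrix (Fin d) (Fin d) ℝ) (m : Lattice d) (f : GNS d) (n : Lattice d) :
    mon θ m f n = phase θ m (n - m) * f (n - m) := rfl

theorem phase_mul (θ : Matrix (Fin d) (Fin d) ℝ) (m n r : Lattice d) :
    phase θ m (n + r) * phase θ n r = phase θ m n * phase θ (m + n) r := by
  unfold phase
  rw [← Complex.exp_add, ← Complex.exp_add, ← add_mul, ← add_mul]
  congr 2
  rw [← Complex.ofReal_add, ← Complex.ofReal_add, ← mul_add, ← mul_add,
    ← Finset.sum_add_distrib, ← Finset.sum_add_distrib]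
  congr 2
  refine Finset.sum_congr rfl fun j _ => ?_
  rw [← Finset.sum_add_distrib, ← Finset.sum_add_distrib]
  refine Finset.sum_congr rfl fun l _ => ?_
  simp only [Pi.add_apply, Int.cast_add]
  ring

theorem mon_mul (θ : Matrix (Fin d) (Fin d) ℝ) (m n : Lattice d) :
    mon θ m * mon θ n = phase θ m n • mon θ (m + n) := by
  ext f r
  have h := phase_mul θ m n (r - (m + n))
  have e1 : n + (r - (m + n)) = r - m := by abel
  have e2 : r - m - n = r - (m + n) := by abel
  rw [e1] at h
  change phase θ m (r - m) * (phase θ n (r - m - n) * f (r - m - n))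
    = phase θ m n * (phase θ (m + n) (r - (m + n)) * f (r - (m + n)))
  rw [e2, ← mul_assoc, h, mul_assoc]

/-- The unitary generator `U_j`. -/
def gen (θ : Matrix (Fin d) (Fin d) ℝ) (j : Fin d) : GNS d →L[ℂ] GNS d :=
  mon θ (Pi.single j 1)

/-- The commutation relation `U_k U_j = e^{2πi θ_{kj}} U_j U_k`. -/
theorem gen_comm (θ : Matrix (Fin d) (Fin d) ℝ) (hθ : θ.transpose = -θ) (k j : Fin d) :
    gen θ k * gen θ j
      = Complex.exp (2 * Real.pi * Complex.I * (θ k j : ℂ)) • (gen θ j * gen θ k) := by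
  have key : ∀ a b : Fin d,
      (∑ i, ∑ l ∈ Finset.univ.filter (fun l => l < i),
        θ i l * ((Pi.single a 1 : Lattice d) i : ℝ) * ((Pi.single b 1 : Lattice d) l : ℝ))
        = if b < a then θ a b else 0 := by
    intro a b
    rw [Finset.sum_eq_single a]
    · rw [Finset.sum_filter, Finset.sum_eq_single b]
      · simp
      · intro l _ hl
        simp [hl]
      · simp
    · intro i _ hi
      simp [hi]
    · simp
  have hs : ∀ a b, θ b a = -θ a b := fun a b => by
    have := congrFun (congrFun hθ a) b
    simpa using this
  unfold gen
  rw [mon_mul, mon_mul, smul_smul, add_comm]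
  congr 1
  unfold phase
  rw [key, key, ← Complex.exp_add]
  congr 1
  rcases lt_trichotomy k j with h | h | h
  · simp only [not_lt.2 h.le, h, if_true, if_false]
    rw [hs k j]
    push_cast
    ring
  · subst h
    have := hs k k
    have h0 : θ k k = 0 := by linarith
    simp [h0]
  · simp only [not_lt.2 h.le, h, if_true, if_false]
    push_cast
    ring

/-- The quantum torus `𝕋^d_θ`: the von Neumann algebra generated by `U_1, …, U_d`
on the GNS space of the trace (as a double commutant). -/
def vN (θ : Matrix (Fin d) (Fin d) ℝ) : VonNeumannAlgebra (GNS d) where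
  toStarSubalgebra := StarSubalgebra.centralizer ℂ
    (StarSubalgebra.centralizer ℂ (Set.range (gen θ)) : Set (GNS d →L[ℂ] GNS d))
  centralizer_centralizer' := by
    change Set.centralizer (Set.centralizer
      (StarSubalgebra.centralizer ℂ
        (StarSubalgebra.centralizer ℂ (Set.range (gen θ)) : Set (GNS d →L[ℂ] GNS d)) :
          Set (GNS d →L[ℂ] GNS d)))
      = (StarSubalgebra.centralizer ℂ
        (StarSubalgebra.centralizer ℂ (Set.range (gen θ)) : Set (GNS d →L[ℂ] GNS d)) :
          Set (GNS d →L[ℂ] GNS d))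
    rw [StarSubalgebra.coe_centralizer_centralizer, Set.centralizer_centralizer_centralizer]

/-- The canonical trace: `τ(x)` is the coefficient of `U^0 = 1` in `x`. -/
def trace (x : GNS d →L[ℂ] GNS d) : ℂ :=
  inner ℂ (lp.single 2 (0 : Lattice d) (1 : ℂ) : GNS d) (x (lp.single 2 (0 : Lattice d) (1 : ℂ)))

/-- `|x|^p`, by functional calculus. -/
def absPow {H : Type*} [NormedAddCommGroup H] [InnerProductSpace ℂ H] [CompleteSpace H]
    (p : ℝ) (x : H →L[ℂ] H) : H →L[ℂ] H :=
  CFC.abs x ^ p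

/-- `‖x‖_p = τ(|x|^p)^{1/p}` for `p < ∞`, and the operator norm for `p = ∞`, on `𝕋^d_θ`. -/
def opLpNorm (p : ℝ≥0∞) (x : GNS d →L[ℂ] GNS d) : ℝ :=
  if p = ∞ then ‖x‖ else (trace (absPow p.toReal x)).re ^ (1 / p.toReal)

/-! ### Test elements and distributions -/

/-- Rapidly decreasing families on `ℤ^d`; the family `a` stands for the element `∑ a_m U^m`
of `𝓢(𝕋^d_θ)`. -/
def Test (d : ℕ) : Submodule ℂ (Lattice d → ℂ) where
  carrier := {a | ∀ N : ℕ, ∃ C : ℝ, ∀ m, (1 + ‖m‖) ^ N * ‖a m‖ ≤ C}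
  add_mem' := by
    intro a b ha hb N
    obtain ⟨C, hC⟩ := ha N
    obtain ⟨D, hD⟩ := hb N
    refine ⟨C + D, fun m => ?_⟩
    calc (1 + ‖m‖) ^ N * ‖(a + b) m‖ ≤ (1 + ‖m‖) ^ N * (‖a m‖ + ‖b m‖) := by
          gcongr
          exact norm_add_le _ _
      _ ≤ C + D := by
          rw [mul_add]
          exact add_le_add (hC m) (hD m)
  zero_mem' := fun N => ⟨0, fun m => by simp⟩
  smul_mem' := by
    intro c a ha N
    obtain ⟨C, hC⟩ := ha N
    refine ⟨‖c‖ * C, fun m => ?_⟩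
    rw [Pi.smul_apply, norm_smul, mul_left_comm]
    exact mul_le_mul_of_nonneg_left (hC m) (norm_nonneg _)

/-- The operator `∑ a_m U^m` (an absolutely convergent series). -/
def Test.op (θ : Matrix (Fin d) (Fin d) ℝ) (a : Test d) : GNS d →L[ℂ] GNS d :=
  ∑' m, a.1 m • mon θ m

/-- Polynomial growth of a symbol on `ℤ^d`. -/
def SlowGrowth (φ : Lattice d → ℂ) : Prop :=
  ∃ (N : ℕ) (C : ℝ), ∀ m, ‖φ m‖ ≤ C * (1 + ‖m‖) ^ N

/-- The Fourier multiplier `∑ a_m U^m ↦ ∑ φ(m) a_m U^m` on `𝓢(𝕋^d_θ)`. -/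
def Test.mult (φ : Lattice d → ℂ) (hφ : SlowGrowth φ) : Test d →ₗ[ℂ] Test d where
  toFun a := ⟨fun m => φ m * a.1 m, by
    intro N
    obtain ⟨M, C, hC⟩ := hφ
    obtain ⟨D, hD⟩ := a.2 (N + M)
    refine ⟨|C| * D, fun m => ?_⟩
    have h1 : ‖φ m‖ ≤ |C| * (1 + ‖m‖) ^ M :=
      (hC m).trans (by gcongr; exact le_abs_self C)
    calc (1 + ‖m‖) ^ N * ‖φ m * a.1 m‖
        ≤ (1 + ‖m‖) ^ N * (|C| * (1 + ‖m‖) ^ M * ‖a.1 m‖) := by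
          rw [norm_mul]
          gcongr
      _ = |C| * ((1 + ‖m‖) ^ (N + M) * ‖a.1 m‖) := by ring
      _ ≤ |C| * D := by
          gcongr
          exact hD m⟩
  map_add' a b := by
    ext m
    simp [mul_add]
  map_smul' c a := by
    ext m
    simp [mul_left_comm]

/-- The symbol `∏_j (2πi m_j)^{α_j}` of the partial derivation
`D^α = ∂_1^{α_1} ⋯ ∂_d^{α_d}`, where `∂_j U_j = 2πi U_j` and `∂_j U_k = 0` for `k ≠ j`. -/
def derivSymbol (α : Fin d → ℕ) (m : Lattice d) : ℂ :=
  ∏ j, (2 * Real.pi * Complex.I * (m j : ℂ)) ^ α j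

theorem slowGrowth_deriv (α : Fin d → ℕ) : SlowGrowth (derivSymbol α) := by
  refine ⟨∑ j, α j, ∏ j, (2 * Real.pi) ^ α j, fun m => ?_⟩
  unfold derivSymbol
  rw [norm_prod, ← Finset.prod_pow_eq_pow_sum, ← Finset.prod_mul_distrib]
  refine Finset.prod_le_prod (fun _ _ => norm_nonneg _) fun j _ => ?_
  rw [norm_pow, ← mul_pow]
  have h1 : ‖m j‖ ≤ ‖m‖ := norm_le_pi_norm m j
  have h2 : ‖(2 * Real.pi * Complex.I * (m j : ℂ) : ℂ)‖ = 2 * Real.pi * ‖m j‖ := by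
    simp [abs_of_pos Real.pi_pos, Int.norm_eq_abs]
  rw [h2]
  have := Real.pi_pos
  gcongr
  linarith

/-- The partial derivation `D^α` on `𝓢(𝕋^d_θ)`. -/
def Test.D (α : Fin d → ℕ) : Test d →ₗ[ℂ] Test d :=
  Test.mult (derivSymbol α) (slowGrowth_deriv α)

/-- The multi-indices `α ∈ ℕ₀^d` with `|α|₁ ≤ k`. -/
def multiIdx (d k : ℕ) : Finset (Fin d → ℕ) :=
  (Fintype.piFinset fun _ => Finset.range (k + 1)).filter fun α => ∑ j, α j ≤ k

/-- The norms `p_N(x) = sup_{|α|₁ ≤ N} ‖D^α x‖_∞` that define the topology of `𝓢(𝕋^d_θ)`. -/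
def Test.seminorm (θ : Matrix (Fin d) (Fin d) ℝ) (N : ℕ) (a : Test d) : ℝ≥0 :=
  (multiIdx d N).sup fun α => ‖Test.op θ (Test.D α a)‖₊

/-- Linear functionals on `𝓢(𝕋^d_θ)`. -/
abbrev Functional (d : ℕ) : Type := Test d →ₗ[ℂ] ℂ

/-- `F` is a distribution: it is continuous for the topology given by the increasing sequence of
norms `p_N`. -/
def IsDistribution (θ : Matrix (Fin d) (Fin d) ℝ) (F : Functional d) : Prop :=
  ∃ (N : ℕ) (C : ℝ), ∀ a, ‖F a‖ ≤ C * (Test.seminorm θ N a : ℝ)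

theorem rapid_single (m : Lattice d) (c : ℂ) : (Pi.single m c : Lattice d → ℂ) ∈ Test d := by
  intro N
  refine ⟨(1 + ‖m‖) ^ N * ‖c‖, fun n => ?_⟩
  by_cases h : n = m
  · subst h
    simp
  · simp only [Pi.single_apply, h, if_false, norm_zero, mul_zero]
    positivity

/-- The element `(U^m)^* = conj(σ(m, -m)) U^{-m}` of `𝓢(𝕋^d_θ)`. -/
def starMon (θ : Matrix (Fin d) (Fin d) ℝ) (m : Lattice d) : Test d :=
  ⟨Pi.single (-m) (star (phase θ m (-m))), rapid_single _ _⟩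

/-- The Fourier coefficient `F̂(m) = ⟨F, (U^m)^*⟩`. -/
def coeff (θ : Matrix (Fin d) (Fin d) ℝ) (F : Functional d) (m : Lattice d) : ℂ :=
  F (starMon θ m)

theorem SlowGrowth.neg {φ : Lattice d → ℂ} (hφ : SlowGrowth φ) : SlowGrowth fun m => φ (-m) := by
  obtain ⟨N, C, h⟩ := hφ
  exact ⟨N, C, fun m => by simpa using h (-m)⟩

/-- The Fourier multiplier with symbol `φ` on distributions, by duality:
`⟨M_φ F, x⟩ = ⟨F, M_{φ(-·)} x⟩`, so that `(M_φ F)^(m) = φ(m) F̂(m)`. -/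
def mult (φ : Lattice d → ℂ) (hφ : SlowGrowth φ) (F : Functional d) : Functional d :=
  F ∘ₗ Test.mult (fun m => φ (-m)) hφ.neg

theorem coeff_mult (θ : Matrix (Fin d) (Fin d) ℝ) (φ : Lattice d → ℂ) (hφ : SlowGrowth φ)
    (F : Functional d) (m : Lattice d) : coeff θ (mult φ hφ F) m = φ m * coeff θ F m := by
  unfold coeff mult
  rw [LinearMap.comp_apply, ← smul_eq_mul, ← map_smul]
  congr 1
  ext n
  by_cases h : n = -m
  · subst h
    simp [Test.mult, starMon]
  · simp [Test.mult, starMon, h]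

/-- The partial derivation `D^α` on distributions: `⟨D^α F, x⟩ = (-1)^{|α|₁} ⟨F, D^α x⟩`. -/
def D (α : Fin d → ℕ) (F : Functional d) : Functional d :=
  (-1 : ℂ) ^ (∑ j, α j) • (F ∘ₗ Test.D α)

/-! ### The spaces `L_p(𝕋^d_θ)` and `W^k_p(𝕋^d_θ)` -/

/-- `y` is a Cauchy sequence of `(𝕋^d_θ, ‖·‖_p)` whose limit, in the completion, induces the
distribution `F` through `⟨y, x⟩ = τ(y x)`. -/
def Represents (θ : Matrix (Fin d) (Fin d) ℝ) (p : ℝ≥0∞) (y : ℕ → vN θ) (F : Functional d) :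
    Prop :=
  (∀ δ : ℝ, 0 < δ → ∃ N, ∀ i, N ≤ i → ∀ j, N ≤ j →
    opLpNorm p ((y i : GNS d →L[ℂ] GNS d) - (y j : GNS d →L[ℂ] GNS d)) < δ) ∧
  ∀ a : Test d,
    Tendsto (fun n => trace ((y n : GNS d →L[ℂ] GNS d) * Test.op θ a)) atTop (𝓝 (F a))

/-- `L_p(𝕋^d_θ)`, the completion of `(𝕋^d_θ, ‖·‖_p)`, as a space of distributions.
(For `p = ∞` the quantum torus is already complete, and this is `𝕋^d_θ` itself.) -/
def Lp (θ : Matrix (Fin d) (Fin d) ℝ) (p : ℝ≥0∞) : Set (Functional d) :=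
  {F | ∃ y : ℕ → vN θ, Represents θ p y F}

/-- The norm `‖F‖_p`, that is, the limit of `‖y_n‖_p` for every sequence `y` representing `F`;
it is `∞` outside `L_p(𝕋^d_θ)`. -/
def lpNorm (θ : Matrix (Fin d) (Fin d) ℝ) (p : ℝ≥0∞) (F : Functional d) : ℝ≥0∞ :=
  ⨅ (y : ℕ → vN θ) (_ : Represents θ p y F),
    limsup (fun n => ENNReal.ofReal (opLpNorm p (y n : GNS d →L[ℂ] GNS d))) atTop

/-- The Sobolev space `W^k_p(𝕋^d_θ)`. -/
def Sobolev (θ : Matrix (Fin d) (Fin d) ℝ) (k : ℕ) (p : ℝ≥0∞) : Set (Functional d) :=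
  {F | IsDistribution θ F ∧ ∀ α ∈ multiIdx d k, D α F ∈ Lp θ p}

/-- The Sobolev norm `(∑_{|α|₁ ≤ k} ‖D^α F‖_p^p)^{1/p}`, a supremum for `p = ∞`. -/
def sobolevNorm (θ : Matrix (Fin d) (Fin d) ℝ) (k : ℕ) (p : ℝ≥0∞) (F : Functional d) : ℝ≥0∞ :=
  if p = ∞ then (multiIdx d k).sup fun α => lpNorm θ p (D α F)
  else (∑ α ∈ multiIdx d k, lpNorm θ p (D α F) ^ p.toReal) ^ (1 / p.toReal)

/-! ### Moduli of smoothness -/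

/-- The symbol `d_u(m) = e^{2πi u·m} - 1`. -/
def diffSymbol (u : EuclideanSpace ℝ (Fin d)) (m : Lattice d) : ℂ :=
  Complex.exp (((2 * Real.pi * ∑ j, u j * (m j : ℝ) : ℝ) : ℂ) * Complex.I) - 1

theorem slowGrowth_diff (u : EuclideanSpace ℝ (Fin d)) : SlowGrowth (diffSymbol u) := by
  refine ⟨0, 2, fun m => ?_⟩
  unfold diffSymbol
  refine (norm_sub_le _ _).trans ?_
  rw [Complex.norm_exp_ofReal_mul_I]
  norm_num

/-- The difference operator `Δ_u`. -/
def diff (u : EuclideanSpace ℝ (Fin d)) (F : Functional d) : Functional d :=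
  mult (diffSymbol u) (slowGrowth_diff u) F

/-- The `k`-th order modulus of `L_p`-smoothness `ω^k_p(F, ε)`. -/
def modulus (θ : Matrix (Fin d) (Fin d) ℝ) (k : ℕ) (p : ℝ≥0∞) (F : Functional d) (ε : ℝ) : ℝ≥0∞ :=
  ⨆ (u : EuclideanSpace ℝ (Fin d)) (_ : 0 < ‖u‖ ∧ ‖u‖ ≤ ε), lpNorm θ p ((diff u)^[k] F)

/-! ### The K-functional and real interpolation -/

/-- `K(x, t; X₀, X₁)` for subspaces `X₀`, `X₁` of `E` with norms `N₀`, `N₁`. -/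
def kFunctional {E : Type*} [Add E] (X₀ X₁ : Set E) (N₀ N₁ : E → ℝ≥0∞) (x : E) (t : ℝ) : ℝ≥0∞ :=
  ⨅ (x₀ : E) (x₁ : E) (_ : x₀ ∈ X₀ ∧ x₁ ∈ X₁ ∧ x = x₀ + x₁), N₀ x₀ + ENNReal.ofReal t * N₁ x₁

/-- The norm `(∫_0^∞ (t^{-η} K(x, t))^q dt/t)^{1/q}`, a supremum for `q = ∞`. -/
def interpNorm {E : Type*} [Add E] (X₀ X₁ : Set E) (N₀ N₁ : E → ℝ≥0∞) (η : ℝ) (q : ℝ≥0∞) (x : E) :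
    ℝ≥0∞ :=
  if q = ∞ then ⨆ (t : ℝ) (_ : 0 < t), ENNReal.ofReal (t ^ (-η)) * kFunctional X₀ X₁ N₀ N₁ x t
  else (∫⁻ t in Ioi (0 : ℝ),
    (ENNReal.ofReal (t ^ (-η)) * kFunctional X₀ X₁ N₀ N₁ x t) ^ q.toReal * ENNReal.ofReal (1 / t))
      ^ (1 / q.toReal)

/-- The real interpolation space `(X₀, X₁)_{η,q}`. -/
def interpSpace {E : Type*} [Add E] (X₀ X₁ : Set E) (N₀ N₁ : E → ℝ≥0∞) (η : ℝ) (q : ℝ≥0∞) :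
    Set E :=
  {x | (∃ x₀ ∈ X₀, ∃ x₁ ∈ X₁, x = x₀ + x₁) ∧ interpNorm X₀ X₁ N₀ N₁ η q x < ∞}

/-! ### Besov spaces -/

/-- `φ` generates a Littlewood-Paley decomposition. -/
structure IsLittlewoodPaley (φ : 𝓢(EuclideanSpace ℝ (Fin d), ℝ)) : Prop where
  tsupport_subset : tsupport (φ : EuclideanSpace ℝ (Fin d) → ℝ) ⊆ {ξ | 2⁻¹ ≤ ‖ξ‖ ∧ ‖ξ‖ ≤ 2}
  pos : ∀ ξ, 2⁻¹ < ‖ξ‖ → ‖ξ‖ < 2 → 0 < φ ξ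
  hasSum : ∀ ξ, ξ ≠ 0 → HasSum (fun j : ℤ => φ ((2 : ℝ) ^ (-j) • ξ)) 1

/-- The symbol `m ↦ φ(2^{-j} m)`. -/
def blockSymbol (φ : 𝓢(EuclideanSpace ℝ (Fin d), ℝ)) (j : ℕ) (m : Lattice d) : ℂ :=
  (φ ((2 : ℝ) ^ (-(j : ℤ)) • WithLp.toLp 2 fun i => (m i : ℝ)) : ℂ)

theorem slowGrowth_block (φ : 𝓢(EuclideanSpace ℝ (Fin d), ℝ)) (j : ℕ) :
    SlowGrowth (blockSymbol φ j) := by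
  obtain ⟨C, hC⟩ := φ.decay 0 0
  refine ⟨0, C, fun m => ?_⟩
  have h := hC.2 ((2 : ℝ) ^ (-(j : ℤ)) • WithLp.toLp 2 fun i => (m i : ℝ))
  simpa [blockSymbol] using h

/-- The Littlewood-Paley block `φ̃_j * F`. -/
def block (φ : 𝓢(EuclideanSpace ℝ (Fin d), ℝ)) (j : ℕ) (F : Functional d) : Functional d :=
  mult (blockSymbol φ j) (slowGrowth_block φ j) F

/-- The Besov norm `(|F̂(0)|^q + ∑_{j ≥ 0} 2^{qjα} ‖φ̃_j * F‖_p^q)^{1/q}`, a supremum for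
`q = ∞`. -/
def besovNorm (θ : Matrix (Fin d) (Fin d) ℝ) (φ : 𝓢(EuclideanSpace ℝ (Fin d), ℝ)) (α : ℝ)
    (p q : ℝ≥0∞) (F : Functional d) : ℝ≥0∞ :=
  if q = ∞ then max ‖coeff θ F 0‖ₑ
    (⨆ j : ℕ, ENNReal.ofReal ((2 : ℝ) ^ ((j : ℝ) * α)) * lpNorm θ p (block φ j F))
  else (‖coeff θ F 0‖ₑ ^ q.toReal + ∑' j : ℕ,
    (ENNReal.ofReal ((2 : ℝ) ^ ((j : ℝ) * α)) * lpNorm θ p (block φ j F)) ^ q.toReal)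
      ^ (1 / q.toReal)

/-- The Besov space `B^α_{p,q}(𝕋^d_θ)`. -/
def Besov (θ : Matrix (Fin d) (Fin d) ℝ) (φ : 𝓢(EuclideanSpace ℝ (Fin d), ℝ)) (α : ℝ)
    (p q : ℝ≥0∞) : Set (Functional d) :=
  {F | IsDistribution θ F ∧ besovNorm θ φ α p q F < ∞}

end QTorus

end

/-! Everything reduces to Fourier multipliers that are averages of translations. Translation by `u`
multiplies the coefficient at `m` by `e^{2πi u·m}`; it is conjugation by a diagonal unitary that
fixes the trace vector, so it preserves the algebra and every `L_p` norm. Hence the symbol `∫ f(w)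
e^{2πi U(w)·m} dw` acts on `L_p` with norm at most `∫ |f|`, for all `p` and `θ` at once
(`MulBound.integral`). By Fourier inversion a Schwartz symbol is of this type, with a bound that
does not change under dilation.

The noncommutative input is duality. Hölder's inequality comes from the three lines theorem applied
to exponentials of a regularized `log |x|`, and its sharpness from the duality map `x |x|^{p-2}`
(for `p = ∞`, from cyclicity of the trace vector). After a mollification the norm of `L_p` is a
supremum over test elements in a dual ball (`lpNorm_eq_dualNorm`, `mem_Lp_iff`), so completions can
be handled through functionals.

Part (1), lower bound: `Δ_u^k` has norm at most `2^k`, and `Δ_u^k = A_u^k (u·∇)^k` with a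
contractive average `A_u`. Upper bound: let `G(t)` be the symbol of a bump of integral one dilated
by `t`, let `b_l` be the coefficients of `(z-1)^k`, and put `S(t) = ∑ b_l l^k G(lt)`. Averages of
`k`-th differences have the symbols `E(t) = ∑ b_l G(lt)`, and `∑ b_l l^k E(lε) = ∑ b_l S(lε)`. On
the right the term `l = 0` is the constant `(-1)^k k!`; solving for it splits the identity into
averaged differences, controlled by the modulus, and the symbols `S(lε)`, `l ≥ 1`. A derivative of
order `k` of `S(t)` is `t^{-k}` times another average of `k`-th differences, so the same modulus
controls it. Lower derivatives follow from Poincaré's inequality.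

Part (2): the K-functional is sampled at `t = 2^{-jk}`. Boundedness of the blocks on `L_p` and a
Jackson estimate on `W^k_p` bound the `j`-th block by `K(2^{-jk})`. Conversely, the partial sums of
the Littlewood-Paley series, with Bernstein's inequality, give decompositions that bound `K` by a
convolution of the Besov sequence with a geometric kernel, summable because `0 < η < 1`. A discrete
Young inequality concludes. -/

noncomputable section

namespace QTorus

/-! ### Matrix coefficients on the GNS space and traciality. -/

variable {d : ℕ} {θ : Matrix (Fin d) (Fin d) ℝ}

/-- The basis vector `U^m` of the GNS space. -/
def basisVec (m : Lattice d) : GNS d := lp.single 2 m (1 : ℂ)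

theorem inner_basisVec (m : Lattice d) (f : GNS d) : inner ℂ (basisVec m) f = f m := by
  rw [basisVec, lp.inner_single_left]; simp

theorem norm_basisVec (m : Lattice d) : ‖(basisVec m : GNS d)‖ = 1 := by
  rw [basisVec, lp.norm_single (by norm_num)]; simp

theorem hasSum_basisVec (f : GNS d) : HasSum (fun m => f m • basisVec m) f := by
  have := lp.hasSum_single (p := 2) (by norm_num) f
  convert this using 2 with m
  rw [basisVec, ← lp.single_smul]; simp

theorem ext_basisVec {x y : GNS d →L[ℂ] GNS d} (h : ∀ m, x (basisVec m) = y (basisVec m)) :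
    x = y := by
  ext1 f
  have h1 := (hasSum_basisVec f).mapL x
  have h2 := (hasSum_basisVec f).mapL y
  simp only [map_smul, h] at h1 h2
  exact h1.unique h2

theorem trace_eq (x : GNS d →L[ℂ] GNS d) : trace x = x (basisVec 0) 0 :=
  inner_basisVec 0 _

@[simp] theorem phase_zero_left (m : Lattice d) : phase θ 0 m = 1 := by
  simp [phase]

@[simp] theorem phase_zero_right (m : Lattice d) : phase θ m 0 = 1 := by
  simp [phase]

theorem phase_neg_neg (m n : Lattice d) : phase θ (-m) (-n) = phase θ m n := by
  simp [phase]

theorem phase_ne_zero (m n : Lattice d) : phase θ m n ≠ 0 := by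
  intro h
  have := norm_phase θ m n
  simp [h] at this

theorem star_phase_mul_phase (m n : Lattice d) : star (phase θ m n) * phase θ m n = 1 := by
  have := RCLike.conj_mul (phase θ m n)
  rw [norm_phase] at this
  simpa using this

theorem mon_basisVec (m n : Lattice d) :
    mon θ m (basisVec n) = phase θ m n • basisVec (m + n) := by
  ext r
  rw [mon_apply]
  simp only [basisVec, lp.single_apply, lp.coeFn_smul, Pi.smul_apply, smul_eq_mul, Pi.single_apply]
  by_cases h : r = m + n
  · subst h; simp
  · have : r - m ≠ n := fun h' => h (by rw [← h']; abel)
    simp [h, this]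

theorem mon_zero : mon θ 0 = 1 := by
  refine ext_basisVec fun m => ?_
  rw [mon_basisVec]; simp

theorem norm_mon_le (m : Lattice d) : ‖mon θ m‖ ≤ 1 :=
  LinearMap.mkContinuous_norm_le _ zero_le_one _

/-- The adjoint is a left inverse, since monomials are isometric (`h2`), and the multiplication law
supplies a right inverse (`h1`); the two must agree. -/
theorem star_mon (m : Lattice d) : star (mon θ m) = star (phase θ m (-m)) • mon θ (-m) := by
  have h1 : mon θ m * (star (phase θ m (-m)) • mon θ (-m)) = 1 := by
    rw [mul_smul_comm, mon_mul, smul_smul, star_phase_mul_phase, one_smul, add_neg_cancel, mon_zero]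
  have h2 : star (mon θ m) * mon θ m = 1 := by
    refine ext_basisVec fun n => ?_
    ext r
    rw [← inner_basisVec, ← inner_basisVec]
    change inner ℂ _ ((ContinuousLinearMap.adjoint (mon θ m)) (mon θ m (basisVec n))) = _
    rw [ContinuousLinearMap.adjoint_inner_right, mon_basisVec, mon_basisVec, inner_smul_left,
      inner_smul_right, inner_basisVec]
    rw [one_apply_eq_self]
    by_cases h : r = n
    · subst h
      have := star_phase_mul_phase (θ := θ) m r
      simpa [basisVec] using this
    · have h' : basisVec (d := d) n r = 0 := lp.single_apply_ne _ _ _ h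
      have h2' : basisVec (d := d) (m + n) (m + r) = 0 :=
        lp.single_apply_ne _ _ _ fun hh => h (add_left_cancel hh)
      rw [inner_basisVec, h', h2', mul_zero, mul_zero]
  calc star (mon θ m) = star (mon θ m) * (mon θ m * (star (phase θ m (-m)) • mon θ (-m))) := by
        rw [h1, mul_one]
    _ = _ := by rw [← mul_assoc, h2, one_mul]

/-- A single commutation relation is enough: the commutant of the generators and their adjoints is
closed under the star, so the relation with `star z` is another instance of the same condition. -/
theorem mem_vN {x : GNS d →L[ℂ] GNS d} : x ∈ vN θ ↔
    ∀ z : GNS d →L[ℂ] GNS d, (∀ j, gen θ j * z = z * gen θ j) →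
      (∀ j, star (gen θ j) * z = z * star (gen θ j)) → z * x = x * z := by
  change x ∈ StarSubalgebra.centralizer ℂ _ ↔ _
  rw [StarSubalgebra.mem_centralizer_iff]
  have hz : ∀ z : GNS d →L[ℂ] GNS d, z ∈ StarSubalgebra.centralizer ℂ (Set.range (gen θ)) ↔
      (∀ j, gen θ j * z = z * gen θ j) ∧ (∀ j, star (gen θ j) * z = z * star (gen θ j)) := by
    intro z
    rw [StarSubalgebra.mem_centralizer_iff]
    simp [forall_and]
  constructor
  · intro h z h1 h2
    exact (h z ((hz z).2 ⟨h1, h2⟩)).1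
  · intro h z hz'
    refine ⟨h z ((hz z).1 hz').1 ((hz z).1 hz').2, ?_⟩
    have := (hz (star z)).1 (star_mem hz')
    exact h _ this.1 this.2

theorem gen_mem (j : Fin d) : gen θ j ∈ vN θ := mem_vN.2 fun _ h _ => (h j).symm

theorem smul_mem_vN (c : ℂ) {x : GNS d →L[ℂ] GNS d} (hx : x ∈ vN θ) : c • x ∈ vN θ :=
  (vN θ).toStarSubalgebra.smul_mem hx c

theorem mon_mem (m : Lattice d) : mon θ m ∈ vN θ := by
  have hadd : ∀ m n : Lattice d, mon θ m ∈ vN θ → mon θ n ∈ vN θ → mon θ (m + n) ∈ vN θ := by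
    intro m n hm hn
    have h := smul_mem_vN (phase θ m n)⁻¹ (mul_mem hm hn)
    rwa [mon_mul, smul_smul, inv_mul_cancel₀ (phase_ne_zero m n), one_smul] at h
  have hneg : ∀ m : Lattice d, mon θ m ∈ vN θ → mon θ (-m) ∈ vN θ := by
    intro m hm
    have h := smul_mem_vN (star (phase θ m (-m)))⁻¹ (star_mem hm)
    rwa [star_mon, smul_smul, inv_mul_cancel₀ (star_ne_zero.2 (phase_ne_zero m (-m))),
      one_smul] at h
  -- Phases are invertible scalars, so the exponents of the monomials in the algebra form a
  -- subgroup; it contains the unit vectors and is therefore the whole lattice.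
  let S : AddSubgroup (Lattice d) :=
    { carrier := {m | mon θ m ∈ vN θ}
      add_mem' := fun {a b} ha hb => hadd a b ha hb
      zero_mem' := by
        change mon θ 0 ∈ vN θ
        rw [mon_zero]; exact one_mem _
      neg_mem' := fun {a} ha => hneg a ha }
  have h : ∑ j, m j • (Pi.single j 1 : Lattice d) ∈ S :=
    S.sum_mem fun j _ => S.zsmul_mem (gen_mem j) _
  have e : ∑ j, m j • (Pi.single j 1 : Lattice d) = m := by
    ext i
    simp [Finset.sum_apply, Pi.single_apply]
  rw [e] at h
  exact h

theorem summable_shift_right (m : Lattice d) (f : GNS d) :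
    Summable fun n => ‖phase θ (n - m) m * f (n - m)‖ ^ (2 : ℝ≥0∞).toReal := by
  have h := (lp.memℓp f).summable (by norm_num)
  simp only [norm_mul, norm_phase, one_mul]
  exact (Equiv.subRight m).summable_iff.2 h

/-- Right multiplication by the monomial `U^m`. -/
def rmon (θ : Matrix (Fin d) (Fin d) ℝ) (m : Lattice d) : GNS d →L[ℂ] GNS d :=
  LinearMap.mkContinuous
    { toFun := fun f => ⟨fun n => phase θ (n - m) m * f (n - m),
        (memℓp_gen_iff (by norm_num)).2 (summable_shift_right m f)⟩
      map_add' := fun f g => by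
        ext n
        exact mul_add _ _ _
      map_smul' := fun c f => by
        ext n
        exact mul_left_comm _ _ _ } 1 (fun f => by
      rw [one_mul, ← Real.rpow_le_rpow_iff (norm_nonneg _) (norm_nonneg _)
          (show 0 < (2 : ℝ≥0∞).toReal by norm_num),
        lp.norm_rpow_eq_tsum (by norm_num), lp.norm_rpow_eq_tsum (by norm_num)]
      simp only [LinearMap.coe_mk, AddHom.coe_mk, norm_mul, norm_phase, one_mul]
      exact ((Equiv.subRight m).tsum_eq (fun n => ‖f n‖ ^ (2 : ℝ≥0∞).toReal)).le)

theorem rmon_apply (m : Lattice d) (f : GNS d) (n : Lattice d) :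
    rmon θ m f n = phase θ (n - m) m * f (n - m) := rfl

/-- Left and right multiplications commute by associativity, which is the cocycle identity
`phase_mul`. Right multiplications thus lie in the commutant of the generators and commute with the
whole algebra. -/
theorem mon_mul_rmon (n m : Lattice d) : mon θ n * rmon θ m = rmon θ m * mon θ n := by
  ext f r
  have h := phase_mul θ n (r - n - m) m
  have e1 : r - n - m + m = r - n := by abel
  have e2 : n + (r - n - m) = r - m := by abel
  have e3 : r - m - n = r - n - m := by abel
  rw [e1, e2] at h
  change phase θ n (r - n) * (phase θ (r - n - m) m * f (r - n - m)) =
    phase θ (r - m) m * (phase θ n (r - m - n) * f (r - m - n))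
  rw [e3, ← mul_assoc, h]
  ring

theorem rmon_commute {x : GNS d →L[ℂ] GNS d} (hx : x ∈ vN θ) (m : Lattice d) :
    rmon θ m * x = x * rmon θ m := by
  refine mem_vN.1 hx _ (fun j => mon_mul_rmon _ _) (fun j => ?_)
  rw [gen, star_mon, smul_mul_assoc, mon_mul_rmon, mul_smul_comm]

theorem rmon_basisVec_zero (m : Lattice d) : rmon θ m (basisVec 0) = basisVec m := by
  ext r
  rw [rmon_apply]
  simp only [basisVec, lp.single_apply, Pi.single_apply]
  by_cases h : r = m
  · subst h; simp
  · simp [h, sub_eq_zero]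

/-- The matrix coefficients of `x` are determined by its Fourier coefficients. -/
theorem apply_basisVec {x : GNS d →L[ℂ] GNS d} (hx : x ∈ vN θ) (m n : Lattice d) :
    x (basisVec m) n = phase θ (n - m) m * x (basisVec 0) (n - m) := by
  rw [← rmon_basisVec_zero (θ := θ) m]
  change (x * rmon θ m) _ n = _
  rw [← rmon_commute hx]
  rfl

theorem ext_vN {x y : GNS d →L[ℂ] GNS d} (hx : x ∈ vN θ) (hy : y ∈ vN θ)
    (h : x (basisVec 0) = y (basisVec 0)) : x = y := by
  refine ext_basisVec fun m => ?_
  ext n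
  rw [apply_basisVec hx, apply_basisVec hy, h]

/-- Expand `y ω` in the basis and read off the matrix coefficients of `x`. The trace pairing becomes
a bilinear series in Fourier coefficients, which gives traciality and lets multipliers be moved from
one factor to the other. -/
theorem hasSum_trace_mul {x : GNS d →L[ℂ] GNS d} (hx : x ∈ vN θ) (y : GNS d →L[ℂ] GNS d) :
    HasSum (fun m => y (basisVec 0) m * (phase θ (-m) m * x (basisVec 0) (-m)))
      (trace (x * y)) := by
  have h := ((hasSum_basisVec (y (basisVec 0))).mapL x).mapL (innerSL ℂ (basisVec 0))
  have e : trace (x * y) = innerSL ℂ (basisVec 0) (x (y (basisVec 0))) := rfl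
  rw [e]
  refine h.congr_fun ?_
  intro m
  rw [map_smul, map_smul, innerSL_apply_apply, inner_basisVec, apply_basisVec hx m 0, zero_sub,
    smul_eq_mul]

/-- The two series agree under `m ↦ -m`, because the phase satisfies `σ(-m, m) = σ(m, -m)`. -/
theorem trace_mul_comm {x y : GNS d →L[ℂ] GNS d} (hx : x ∈ vN θ) (hy : y ∈ vN θ) :
    trace (x * y) = trace (y * x) := by
  have h1 := hasSum_trace_mul hx y
  have h2 := hasSum_trace_mul hy x
  rw [← (Equiv.neg (Lattice d)).hasSum_iff] at h2
  refine h1.unique ?_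
  convert h2 using 2 with m
  simp only [Function.comp, Equiv.neg_apply, neg_neg]
  rw [← phase_neg_neg (-m) m, neg_neg]
  ring

theorem trace_add (x y : GNS d →L[ℂ] GNS d) : trace (x + y) = trace x + trace y := by
  simp [trace_eq]

theorem trace_sub (x y : GNS d →L[ℂ] GNS d) : trace (x - y) = trace x - trace y := by
  simp [trace_eq]

theorem trace_smul (c : ℂ) (x : GNS d →L[ℂ] GNS d) : trace (c • x) = c * trace x := by
  simp [trace_eq]

end QTorus

namespace QTorus

open scoped ComplexOrder

/-! ### Noncommutative `L_p` norms with respect to a tracial vector state -/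

section Tracial

variable {H : Type*} [NormedAddCommGroup H] [InnerProductSpace ℂ H] [CompleteSpace H]

/-- The vector functional `x ↦ ⟪ω, x ω⟫`. -/
def vecState (ω : H) : (H →L[ℂ] H) →L[ℂ] ℂ :=
  (innerSL ℂ ω) ∘L (ContinuousLinearMap.apply ℂ H ω)

theorem vecState_apply (ω : H) (x : H →L[ℂ] H) : vecState ω x = inner ℂ ω (x ω) := rfl

/-- The `L_p` norm of an operator with respect to a vector state. -/
def vecLpNorm (ω : H) (p : ℝ≥0∞) (x : H →L[ℂ] H) : ℝ :=
  if p = ∞ then ‖x‖ else (vecState ω (absPow p.toReal x)).re ^ (1 / p.toReal)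

/-- `ω` is a tracial unit vector for `S`. -/
structure IsTracial (S : VonNeumannAlgebra H) (ω : H) : Prop where
  norm_eq : ‖ω‖ = 1
  comm : ∀ x ∈ S, ∀ y ∈ S, vecState ω (x * y) = vecState ω (y * x)

variable {S : VonNeumannAlgebra H} {ω : H}

theorem vecState_nonneg (ω : H) {x : H →L[ℂ] H} (hx : 0 ≤ x) : 0 ≤ vecState ω x :=
  ((ContinuousLinearMap.nonneg_iff_isPositive x).1 hx).inner_nonneg_right _

theorem vecState_re_nonneg (ω : H) {x : H →L[ℂ] H} (hx : 0 ≤ x) : 0 ≤ (vecState ω x).re :=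
  (Complex.le_def.1 (vecState_nonneg ω hx)).1

theorem vecState_mono (ω : H) {x y : H →L[ℂ] H} (h : x ≤ y) :
    (vecState ω x).re ≤ (vecState ω y).re := by
  have := vecState_re_nonneg ω (sub_nonneg.2 h)
  rw [map_sub, Complex.sub_re] at this
  linarith

theorem IsTracial.vecState_one (h : IsTracial S ω) : vecState ω 1 = 1 := by
  rw [vecState_apply, one_apply_eq_self, inner_self_eq_norm_sq_to_K, h.norm_eq]
  simp

theorem mem_of_commute {x : H →L[ℂ] H} (h : ∀ z ∈ S.commutant, z * x = x * z) : x ∈ S := by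
  rw [← S.commutant_commutant, VonNeumannAlgebra.mem_commutant_iff]
  exact h

theorem commute_of_mem {x z : H →L[ℂ] H} (hx : x ∈ S) (hz : z ∈ S.commutant) : Commute x z :=
  VonNeumannAlgebra.mem_commutant_iff.1 hz x hx

theorem cfc_mem_vN {x : H →L[ℂ] H} (hx : x ∈ S) (f : ℝ → ℝ) : cfc f x ∈ S :=
  mem_of_commute fun _ hz => ((commute_of_mem hx hz).cfc_real f).symm

theorem exp_mem_vN {x : H →L[ℂ] H} (hx : x ∈ S) (c : ℂ) : NormedSpace.exp (c • x) ∈ S :=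
  mem_of_commute fun _ hz => ((commute_of_mem hx hz).symm.smul_right c).exp_right

theorem star_mul_self_mem {x : H →L[ℂ] H} (hx : x ∈ S) : star x * x ∈ S :=
  mul_mem (star_mem hx) hx

theorem vecState_star_mul (ω : H) (x y : H →L[ℂ] H) :
    vecState ω (star y * x) = inner ℂ (y ω) (x ω) := by
  change inner ℂ ω (ContinuousLinearMap.adjoint y (x ω)) = _
  rw [ContinuousLinearMap.adjoint_inner_right]

/-- This is Hölder's inequality for exponents `∞` and `1` with a positive second factor. Write `c =
s²` with `s` in the algebra and move one `s` to the left by traciality: the value is `⟪s ω, w (s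
ω)⟫`, while `τ(c) = ‖s ω‖²`. -/
theorem IsTracial.norm_vecState_mul_le (h : IsTracial S ω) {w c : H →L[ℂ] H} (hw : w ∈ S) (hc : c ∈ S)
    (h0 : 0 ≤ c) : ‖vecState ω (w * c)‖ ≤ ‖w‖ * (vecState ω c).re := by
  obtain ⟨s, hs, hsa, rfl⟩ : ∃ s ∈ S, IsSelfAdjoint s ∧ s * s = c := by
    refine ⟨cfc Real.sqrt c, cfc_mem_vN hc _, cfc_predicate _ _, ?_⟩
    rw [← cfc_mul _ _ _ (by fun_prop) (by fun_prop)]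
    conv_rhs => rw [← cfc_id' ℝ c]
    exact cfc_congr fun t ht => Real.mul_self_sqrt (spectrum_nonneg_of_nonneg h0 ht)
  have e1 : vecState ω (w * (s * s)) = inner ℂ (s ω) (w (s ω)) := by
    rw [← mul_assoc, h.comm _ (mul_mem hw hs) _ hs]
    conv_lhs => rw [← hsa.star_eq]
    rw [hsa.star_eq]
    have := vecState_star_mul ω (w * s) s
    rwa [hsa.star_eq] at this
  have e2 : (vecState ω (s * s)).re = ‖s ω‖ ^ 2 := by
    have := vecState_star_mul ω s s
    rw [hsa.star_eq] at this
    rw [this, inner_self_eq_norm_sq_to_K]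
    norm_cast
  rw [e1, e2]
  calc _ ≤ ‖s ω‖ * ‖w (s ω)‖ := norm_inner_le_norm _ _
    _ ≤ ‖s ω‖ * (‖w‖ * ‖s ω‖) := by gcongr; exact w.le_opNorm _
    _ = _ := by ring

theorem norm_exp_imaginary_le {L : H →L[ℂ] H} (hL : IsSelfAdjoint L) (t : ℝ) :
    ‖NormedSpace.exp ((t * Complex.I) • L)‖ ≤ 1 := by
  have h := (selfAdjoint.expUnitary ((t : ℝ) • (⟨L, hL⟩ : selfAdjoint (H →L[ℂ] H)))).2
  rw [selfAdjoint.expUnitary_coe, selfAdjoint.val_smul] at h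
  have e : (t * Complex.I) • L = Complex.I • (t • L) := by
    rw [mul_comm, mul_smul]
    rfl
  rw [e]
  set U := NormedSpace.exp (Complex.I • (t • L)) with hU
  have h1 : ‖U‖ * ‖U‖ ≤ 1 := by
    rw [← CStarRing.norm_star_mul_self, Unitary.star_mul_self_of_mem h]
    exact ContinuousLinearMap.norm_id_le
  nlinarith [norm_nonneg U]

theorem exp_smul_add {L : H →L[ℂ] H} (a b : ℂ) :
    NormedSpace.exp ((a + b) • L) = NormedSpace.exp (a • L) * NormedSpace.exp (b • L) := by
  rw [add_smul]
  let +nondep : NormedAlgebra ℚ (H →L[ℂ] H) := .restrictScalars ℚ ℂ (H →L[ℂ] H)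
  exact NormedSpace.exp_add_of_commute (((Commute.refl L).smul_left a).smul_right b)

theorem exp_real_smul {L : H →L[ℂ] H} (hL : IsSelfAdjoint L) (r : ℝ) :
    NormedSpace.exp ((r : ℂ) • L) = cfc (fun t : ℝ => Real.exp (r * t)) L := by
  have e : (r : ℂ) • L = r • L := rfl
  rw [e, ← CFC.real_exp_eq_normedSpace_exp ((IsSelfAdjoint.all r).smul hL),
    ← cfc_comp_smul r Real.exp L (by fun_prop) hL]
  rfl

theorem norm_exp_smul_le {L : H →L[ℂ] H} (hL : IsSelfAdjoint L) (z : ℂ) :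
    ‖NormedSpace.exp (z • L)‖ ≤ Real.exp (|z.re| * ‖L‖) := by
  have hz : z = z.re + z.im * Complex.I := (Complex.re_add_im z).symm
  rw [hz, exp_smul_add]
  refine (norm_mul_le _ _).trans ?_
  have h1 : ‖NormedSpace.exp ((z.re : ℂ) • L)‖ ≤ Real.exp (|z.re| * ‖L‖) := by
    rw [exp_real_smul hL]
    refine norm_cfc_le (by positivity) fun t ht => ?_
    have : |t| ≤ ‖L‖ := by
      rcases subsingleton_or_nontrivial (H →L[ℂ] H) with hs | hs
      · simp [Subsingleton.elim L 0] at ht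
      · exact spectrum.norm_le_norm_of_mem ht
    rw [Real.norm_of_nonneg (by positivity)]
    refine Real.exp_le_exp.2 ((le_abs_self _).trans ?_)
    rw [abs_mul]
    gcongr
  calc _ ≤ Real.exp (|z.re| * ‖L‖) * 1 := by
        gcongr
        exact norm_exp_imaginary_le hL _
    _ = _ := by simp

theorem exp_real_smul_nonneg {L : H →L[ℂ] H} (hL : IsSelfAdjoint L) (r : ℝ) :
    0 ≤ NormedSpace.exp ((r : ℂ) • L) := by
  have h : IsSelfAdjoint ((r : ℂ) • L) := by
    rw [IsSelfAdjoint, star_smul, hL.star_eq]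
    simp
  exact h.exp_nonneg

/-- Hölder's inequality for exponentials, by the three lines theorem. -/
theorem IsTracial.norm_exp_mul_exp_le (h : IsTracial S ω) {L₁ L₂ w : H →L[ℂ] H}
    (h1 : L₁ ∈ S) (h2 : L₂ ∈ S) (hw : w ∈ S) (hs1 : IsSelfAdjoint L₁) (hs2 : IsSelfAdjoint L₂)
    (hw1 : ‖w‖ ≤ 1) {p q : ℝ} (hpq : p.HolderConjugate q) :
    ‖vecState ω (NormedSpace.exp L₂ * w * NormedSpace.exp L₁)‖ ≤
      (vecState ω (NormedSpace.exp ((q : ℂ) • L₂))).re ^ (1 / q) *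
        (vecState ω (NormedSpace.exp ((p : ℂ) • L₁))).re ^ (1 / p) := by
  have hp := hpq.pos
  have hq := hpq.symm.pos
  -- At `z = 1/p` both exponents equal one. On `Re z = 0` the real part of the exponents leaves only
  -- `e^{q L₂}`, on `Re z = 1` only `e^{p L₁}`; all other factors are contractions.
  set F : ℂ → ℂ := fun z => vecState ω
    (NormedSpace.exp ((q * (1 - z)) • L₂) * w * NormedSpace.exp ((p * z) • L₁)) with hF
  have hd : Differentiable ℂ F := by
    intro z
    have d1 : DifferentiableAt ℂ (fun z : ℂ => NormedSpace.exp ((q * (1 - z)) • L₂)) z :=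
      DifferentiableAt.comp (g := fun u : ℂ => NormedSpace.exp (u • L₂)) z
        (hasDerivAt_exp_smul_const (𝕂 := ℂ) L₂ (q * (1 - z))).differentiableAt (by fun_prop)
    have d2 : DifferentiableAt ℂ (fun z : ℂ => NormedSpace.exp ((p * z) • L₁)) z :=
      DifferentiableAt.comp (g := fun u : ℂ => NormedSpace.exp (u • L₁)) z
        (hasDerivAt_exp_smul_const (𝕂 := ℂ) L₁ (p * z)).differentiableAt (by fun_prop)
    exact (vecState ω).differentiableAt.comp z ((d1.mul_const w).mul d2)
  have hb : BddAbove (norm ∘ F '' Complex.HadamardThreeLines.verticalClosedStrip 0 1) := by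
    refine ⟨‖vecState ω‖ * (Real.exp (q * ‖L₂‖) * 1 * Real.exp (p * ‖L₁‖)), ?_⟩
    rintro _ ⟨z, hz, rfl⟩
    have hz : 0 ≤ z.re ∧ z.re ≤ 1 := hz
    refine ((vecState ω).le_opNorm _).trans ?_
    gcongr
    refine (norm_mul_le _ _).trans ?_
    gcongr
    · refine (norm_mul_le _ _).trans ?_
      gcongr
      refine (norm_exp_smul_le hs2 _).trans (Real.exp_le_exp.2 ?_)
      gcongr
      have : ((q : ℂ) * (1 - z)).re = q * (1 - z.re) := by simp
      rw [this, abs_of_nonneg (mul_nonneg hq.le (by linarith))]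
      nlinarith
    · refine (norm_exp_smul_le hs1 _).trans (Real.exp_le_exp.2 ?_)
      gcongr
      have : ((p : ℂ) * z).re = p * z.re := by simp
      rw [this, abs_of_nonneg (mul_nonneg hp.le hz.1)]
      nlinarith
  have hW : ∀ s t : ℝ, NormedSpace.exp ((s * Complex.I) • L₂) * w *
      NormedSpace.exp ((t * Complex.I) • L₁) ∈ S ∧ ‖NormedSpace.exp ((s * Complex.I) • L₂) * w *
      NormedSpace.exp ((t * Complex.I) • L₁)‖ ≤ 1 := by
    intro s t
    refine ⟨mul_mem (mul_mem (exp_mem_vN h2 _) hw) (exp_mem_vN h1 _), ?_⟩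
    calc _ ≤ ‖NormedSpace.exp ((s * Complex.I) • L₂) * w‖ *
          ‖NormedSpace.exp ((t * Complex.I) • L₁)‖ := norm_mul_le _ _
      _ ≤ (‖NormedSpace.exp ((s * Complex.I) • L₂)‖ * ‖w‖) *
          ‖NormedSpace.exp ((t * Complex.I) • L₁)‖ := by gcongr; exact norm_mul_le _ _
      _ ≤ (1 * 1) * 1 := by
          gcongr
          · exact norm_exp_imaginary_le hs2 s
          · exact norm_exp_imaginary_le hs1 t
      _ = 1 := by norm_num
  have key := Complex.HadamardThreeLines.norm_le_interp_of_mem_verticalClosedStrip₀₁' F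
    (z := ((1 / p : ℝ) : ℂ)) (a := (vecState ω (NormedSpace.exp ((q : ℂ) • L₂))).re)
    (b := (vecState ω (NormedSpace.exp ((p : ℂ) • L₁))).re)
    (by
      change ((1 / p : ℝ) : ℂ).re ∈ Icc 0 1
      rw [Complex.ofReal_re]
      exact ⟨by positivity, by rw [div_le_one hp]; exact hpq.lt.le⟩) hd.diffContOnCl hb
    (by
      intro z hz
      have hz : z.re = 0 := hz
      have hz' : z = z.im * Complex.I := by
        conv_lhs => rw [← Complex.re_add_im z, hz]
        simp
      obtain ⟨m1, m2⟩ := hW (-(q * z.im)) (p * z.im)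
      -- Traciality carries the positive exponential to the right end, where `norm_vecState_mul_le`
      -- applies.
      have e : F z = vecState ω ((NormedSpace.exp (((-(q * z.im) : ℝ) * Complex.I) • L₂) * w *
          NormedSpace.exp (((p * z.im : ℝ) * Complex.I) • L₁)) *
            NormedSpace.exp ((q : ℂ) • L₂)) := by
        rw [h.comm _ m1 _ (exp_mem_vN h2 _), hF]
        simp only
        have e1 : (q : ℂ) * (1 - z) = q + ((-(q * z.im) : ℝ) : ℂ) * Complex.I := by
          conv_lhs => rw [hz']
          push_cast
          ring
        have e2 : (p : ℂ) * z = ((p * z.im : ℝ) : ℂ) * Complex.I := by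
          conv_lhs => rw [hz']
          push_cast
          ring
        rw [← mul_assoc, ← mul_assoc, ← exp_smul_add, e1, e2]
      rw [e]
      refine (h.norm_vecState_mul_le m1 (exp_mem_vN h2 _) (exp_real_smul_nonneg hs2 q)).trans ?_
      exact mul_le_of_le_one_left (vecState_re_nonneg ω (exp_real_smul_nonneg hs2 q)) m2)
    (by
      intro z hz
      have hz : z.re = 1 := hz
      have hz' : z = 1 + z.im * Complex.I := by
        conv_lhs => rw [← Complex.re_add_im z, hz]
        simp
      obtain ⟨m1, m2⟩ := hW (-(q * z.im)) (p * z.im)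
      have e : F z = vecState ω ((NormedSpace.exp (((-(q * z.im) : ℝ) * Complex.I) • L₂) * w *
          NormedSpace.exp (((p * z.im : ℝ) * Complex.I) • L₁)) *
            NormedSpace.exp ((p : ℂ) • L₁)) := by
        rw [hF]
        simp only
        have e1 : (q : ℂ) * (1 - z) = ((-(q * z.im) : ℝ) : ℂ) * Complex.I := by
          conv_lhs => rw [hz']
          push_cast
          ring
        have e2 : (p : ℂ) * z = ((p * z.im : ℝ) : ℂ) * Complex.I + p := by
          conv_lhs => rw [hz']
          push_cast
          ring
        rw [mul_assoc _ (NormedSpace.exp _) (NormedSpace.exp _), ← exp_smul_add, e1, e2]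
      rw [e]
      refine (h.norm_vecState_mul_le m1 (exp_mem_vN h1 _) (exp_real_smul_nonneg hs1 p)).trans ?_
      exact mul_le_of_le_one_left (vecState_re_nonneg ω (exp_real_smul_nonneg hs1 p)) m2)
  have ez : F ((1 / p : ℝ) : ℂ) = vecState ω (NormedSpace.exp L₂ * w * NormedSpace.exp L₁) := by
    have e1 : (q : ℂ) * (1 - ((1 / p : ℝ) : ℂ)) = 1 := by
      have : q * (1 - 1 / p) = 1 := by
        have := hpq.symm.one_sub_inv
        rw [one_div, hpq.one_sub_inv, mul_inv_cancel₀ hq.ne']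
      exact_mod_cast this
    have e2 : (p : ℂ) * ((1 / p : ℝ) : ℂ) = 1 := by
      have : p * (1 / p) = 1 := by field_simp
      exact_mod_cast this
    rw [hF]
    simp only
    rw [e1, e2, one_smul, one_smul]
  rw [ez, Complex.ofReal_re] at key
  have e3 : 1 - 1 / p = 1 / q := by
    rw [one_div, hpq.one_sub_inv, one_div]
  rwa [e3] at key

end Tracial

end QTorus

namespace QTorus

/-! ### Regularized polar decomposition and Hölder's inequality. -/

section Tracial

variable {H : Type*} [NormedAddCommGroup H] [InnerProductSpace ℂ H] [CompleteSpace H]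
variable {S : VonNeumannAlgebra H} {ω : H}

theorem continuousOn_rpow_spectrum {r : ℝ} (hr : 0 ≤ r) (s : Set ℝ) :
    ContinuousOn (fun t : ℝ => t ^ r) s :=
  (Real.continuous_rpow_const hr).continuousOn

theorem continuous_max_rpow {ε : ℝ} (hε : 0 < ε) (r : ℝ) :
    Continuous fun t : ℝ => max t ε ^ r :=
  (continuous_id.max continuous_const).rpow_const fun t =>
    Or.inl (hε.trans_le (le_max_right t ε)).ne'

/-- All powers of `|x|` are written as functions of the one operator `x* x`, so that inequalities
between traces become inequalities between real functions on its spectrum. -/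
theorem absPow_eq {p : ℝ} (hp : 0 ≤ p) (x : H →L[ℂ] H) :
    absPow p x = cfc (fun t : ℝ => t ^ (p / 2)) (star x * x) := by
  have h0 := star_mul_self_nonneg x
  rw [absPow, CFC.abs, CFC.sqrt_eq_rpow, CFC.rpow_rpow_of_exponent_nonneg _ _ _ (by norm_num) hp,
    CFC.rpow_eq_cfc_real h0]
  congr 1
  ext t
  congr 1
  ring

theorem absPow_nonneg (p : ℝ) (x : H →L[ℂ] H) : 0 ≤ absPow p x :=
  CFC.rpow_nonneg

/-- The quantity `τ(|x|^p)`. -/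
def powTrace (ω : H) (p : ℝ) (x : H →L[ℂ] H) : ℝ := (vecState ω (absPow p x)).re

theorem powTrace_nonneg (ω : H) (p : ℝ) (x : H →L[ℂ] H) : 0 ≤ powTrace ω p x :=
  vecState_re_nonneg ω (absPow_nonneg p x)

theorem vecLpNorm_top (ω : H) (x : H →L[ℂ] H) : vecLpNorm ω ∞ x = ‖x‖ := if_pos rfl

theorem vecLpNorm_of_ne_top (ω : H) {p : ℝ≥0∞} (hp : p ≠ ∞) (x : H →L[ℂ] H) :
    vecLpNorm ω p x = powTrace ω p.toReal x ^ (1 / p.toReal) := if_neg hp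

theorem vecLpNorm_nonneg (ω : H) (p : ℝ≥0∞) (x : H →L[ℂ] H) : 0 ≤ vecLpNorm ω p x := by
  by_cases hp : p = ∞
  · rw [hp, vecLpNorm_top]; exact norm_nonneg x
  · rw [vecLpNorm_of_ne_top ω hp]; exact Real.rpow_nonneg (powTrace_nonneg _ _ _) _

theorem vecState_re_le_of_forall (ω : H) {T : H →L[ℂ] H} (hT : 0 ≤ T) {f g : ℝ → ℝ}
    (hf : Continuous f) (hg : Continuous g) (h : ∀ t, 0 ≤ t → f t ≤ g t) :
    (vecState ω (cfc f T)).re ≤ (vecState ω (cfc g T)).re :=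
  vecState_mono ω (cfc_mono (fun t ht => h t (spectrum_nonneg_of_nonneg hT ht)) hf.continuousOn
    hg.continuousOn)

theorem IsTracial.vecState_add_const (h : IsTracial S ω) {T : H →L[ℂ] H} (hT : 0 ≤ T) {f : ℝ → ℝ}
    (hf : Continuous f) (c : ℝ) :
    (vecState ω (cfc (fun t => f t + c) T)).re = (vecState ω (cfc f T)).re + c := by
  rw [cfc_add_const c f T hf.continuousOn (IsSelfAdjoint.of_nonneg hT), map_add, Complex.add_re,
    Algebra.algebraMap_eq_smul_one]
  have e : (c • (1 : H →L[ℂ] H)) = (c : ℂ) • (1 : H →L[ℂ] H) := rfl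
  rw [e, map_smul, h.vecState_one]
  simp

theorem star_mul_cfc (x : H →L[ℂ] H) {f : ℝ → ℝ} (hf : Continuous f) :
    star (x * cfc f (star x * x)) * (x * cfc f (star x * x)) =
      cfc (fun t => f t * t * f t) (star x * x) := by
  set T := star x * x with hT
  have hTs : IsSelfAdjoint T := IsSelfAdjoint.star_mul_self x
  have hs : IsSelfAdjoint (cfc f T) := cfc_predicate _ _
  have e1 : cfc (fun t => f t * t) T = cfc f T * T := by
    rw [cfc_mul f (fun t => t) T hf.continuousOn continuous_id.continuousOn, cfc_id' ℝ T]
  rw [cfc_mul (fun t => f t * t) f T (hf.mul continuous_id).continuousOn hf.continuousOn, e1,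
    star_mul, hs.star_eq, hT]
  simp only [mul_assoc]

theorem max_rpow_le {t ε r : ℝ} (ht : 0 ≤ t) (hε : 0 < ε) :
    max t ε ^ r ≤ t ^ r + ε ^ r := by
  rcases le_total t ε with h | h
  · rw [max_eq_right h]
    linarith [Real.rpow_nonneg ht r]
  · rw [max_eq_left h]
    linarith [Real.rpow_nonneg hε.le r]

theorem IsTracial.vecState_max_le (h : IsTracial S ω) {p ε : ℝ} (hp : 0 ≤ p) (hε : 0 < ε)
    (x : H →L[ℂ] H) : (vecState ω (cfc (fun t : ℝ => max t ε ^ (p / 2)) (star x * x))).re ≤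
      powTrace ω p x + ε ^ (p / 2) := by
  have hT := star_mul_self_nonneg x
  have hc := Real.continuous_rpow_const (q := p / 2) (by positivity)
  rw [powTrace, absPow_eq hp, ← h.vecState_add_const hT hc]
  exact vecState_re_le_of_forall ω hT (continuous_max_rpow hε _) (hc.add continuous_const)
    fun t ht => max_rpow_le ht hε

/-- A regularized polar decomposition `x = u e^L`, where `e^L` is close to `|x|`. -/
theorem exists_polar {x : H →L[ℂ] H} (hx : x ∈ S) {ε : ℝ} (hε : 0 < ε) :
    ∃ u ∈ S, ∃ L ∈ S, IsSelfAdjoint L ∧ ‖u‖ ≤ 1 ∧ x = u * NormedSpace.exp L ∧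
      ∀ r : ℝ, NormedSpace.exp ((r : ℂ) • L) =
        cfc (fun t : ℝ => max t ε ^ (r / 2)) (star x * x) := by
  set T := star x * x with hTdef
  have hT : 0 ≤ T := star_mul_self_nonneg x
  have hTS : T ∈ S := star_mul_self_mem hx
  have hpos : ∀ t : ℝ, 0 < max t ε := fun t => hε.trans_le (le_max_right t ε)
  have hlog : Continuous fun t : ℝ => 1 / 2 * Real.log (max t ε) :=
    continuous_const.mul ((continuous_id.max continuous_const).log fun t => (hpos t).ne')
  -- The factor `1/2` appears because `T = |x|²`; the cut-off at `ε` keeps the logarithm bounded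
  -- when `x` is not invertible.
  set L := cfc (fun t : ℝ => 1 / 2 * Real.log (max t ε)) T with hL
  have hLsa : IsSelfAdjoint L := cfc_predicate _ _
  have hexp : ∀ r : ℝ, NormedSpace.exp ((r : ℂ) • L) =
      cfc (fun t : ℝ => max t ε ^ (r / 2)) T := by
    intro r
    rw [exp_real_smul hLsa, hL, ← cfc_comp' (fun s : ℝ => Real.exp (r * s)) _ T (by fun_prop)
      hlog.continuousOn]
    congr 1
    ext t
    rw [Real.rpow_def_of_pos (hpos t)]
    congr 1
    ring
  have h1 : NormedSpace.exp L = cfc (fun t : ℝ => max t ε ^ ((1 : ℝ) / 2)) T := by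
    rw [← hexp 1]; simp
  -- `A` is the inverse of `e^L`, and `x A` is a contraction because `t ≤ max t ε` on the spectrum.
  set A := cfc (fun t : ℝ => max t ε ^ ((-1 : ℝ) / 2)) T with hA
  refine ⟨x * A, mul_mem hx (cfc_mem_vN hTS _), L, cfc_mem_vN hTS _, hLsa, ?_, ?_, hexp⟩
  · have e : star (x * A) * (x * A) = cfc (fun t : ℝ => max t ε ^ ((-1 : ℝ) / 2) * t *
        max t ε ^ ((-1 : ℝ) / 2)) T := by
      exact star_mul_cfc x (continuous_max_rpow hε _)
    have hn : ‖star (x * A) * (x * A)‖ ≤ 1 := by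
      rw [e]
      refine norm_cfc_le zero_le_one fun t ht => ?_
      have ht0 := spectrum_nonneg_of_nonneg hT ht
      rw [mul_right_comm, ← Real.rpow_add (hpos t), Real.norm_of_nonneg
        (mul_nonneg (Real.rpow_nonneg (hpos t).le _) ht0)]
      norm_num
      rw [Real.rpow_neg_one, inv_mul_le_iff₀ (hpos t), mul_one]
      exact le_max_left _ _
    rw [CStarRing.norm_star_mul_self] at hn
    nlinarith [norm_nonneg (x * A)]
  · rw [h1, mul_assoc, hA, ← cfc_mul _ _ T (continuous_max_rpow hε _).continuousOn
      (continuous_max_rpow hε _).continuousOn]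
    have : (fun t : ℝ => max t ε ^ ((-1 : ℝ) / 2) * max t ε ^ ((1 : ℝ) / 2)) = fun _ => 1 := by
      ext t
      rw [← Real.rpow_add (hpos t)]
      norm_num
    rw [this, cfc_const_one ℝ T, mul_one]

theorem tendsto_add_rpow (P : ℝ) {r : ℝ} (hr : 0 < r) :
    Tendsto (fun ε : ℝ => P + ε ^ r) (𝓝[>] 0) (𝓝 P) := by
  have : Tendsto (fun ε : ℝ => P + ε ^ r) (𝓝[>] 0) (𝓝 (P + 0 ^ r)) :=
    ((continuous_const.add (Real.continuous_rpow_const hr.le)).tendsto 0).mono_left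
      nhdsWithin_le_nhds
  rwa [Real.zero_rpow hr.ne', add_zero] at this

/-- Polar decomposition of both factors reduces the claim to the inequality for exponentials. The
regularization changes the traces by at most `ε^{p/2}` and `ε^{q/2}`, which disappear as `ε → 0`. -/
theorem IsTracial.holder_real (h : IsTracial S ω) {x y : H →L[ℂ] H} (hx : x ∈ S) (hy : y ∈ S)
    {p q : ℝ} (hpq : p.HolderConjugate q) :
    ‖vecState ω (star y * x)‖ ≤ powTrace ω q y ^ (1 / q) * powTrace ω p x ^ (1 / p) := by
  have hp := hpq.pos
  have hq := hpq.symm.pos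
  have key : ∀ ε : ℝ, 0 < ε → ‖vecState ω (star y * x)‖ ≤
      (powTrace ω q y + ε ^ (q / 2)) ^ (1 / q) * (powTrace ω p x + ε ^ (p / 2)) ^ (1 / p) := by
    intro ε hε
    obtain ⟨u, hu, L, hL, hLs, hu1, hxe, hexp⟩ := exists_polar hx hε
    obtain ⟨v, hv, M, hM, hMs, hv1, hye, hexp'⟩ := exists_polar hy hε
    have hMe : star (NormedSpace.exp M) = NormedSpace.exp M := by
      have := hexp' 1
      rw [Complex.ofReal_one, one_smul] at this
      rw [this]
      exact (cfc_predicate (p := IsSelfAdjoint) _ _ : IsSelfAdjoint _).star_eq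
    have e : star y * x = NormedSpace.exp M * (star v * u) * NormedSpace.exp L := by
      conv_lhs => rw [hxe, hye, star_mul, hMe]
      simp only [mul_assoc]
    rw [e]
    have hw : ‖star v * u‖ ≤ 1 := by
      calc _ ≤ ‖star v‖ * ‖u‖ := norm_mul_le _ _
        _ ≤ 1 * 1 := by rw [norm_star]; gcongr
        _ = 1 := one_mul 1
    refine (h.norm_exp_mul_exp_le hL hM (mul_mem (star_mem hv) hu) hLs hMs hw hpq).trans ?_
    rw [hexp, hexp']
    have hc : ∀ (z : H →L[ℂ] H) (r : ℝ),
        0 ≤ (vecState ω (cfc (fun t : ℝ => max t ε ^ (r / 2)) (star z * z))).re := fun z r =>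
      vecState_re_nonneg ω (cfc_nonneg fun t _ =>
        Real.rpow_nonneg (hε.le.trans (le_max_right t ε)) _)
    refine mul_le_mul (Real.rpow_le_rpow (hc _ _) (h.vecState_max_le hq.le hε y) (by positivity))
      (Real.rpow_le_rpow (hc _ _) (h.vecState_max_le hp.le hε x) (by positivity))
      (Real.rpow_nonneg (hc _ _) _)
      (Real.rpow_nonneg (add_nonneg (powTrace_nonneg _ _ _) (by positivity)) _)
  have hc : ∀ (P r : ℝ), 0 < r → Tendsto (fun ε : ℝ => (P + ε ^ (r / 2)) ^ (1 / r)) (𝓝[>] 0)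
      (𝓝 (P ^ (1 / r))) := fun P r hr =>
    ((Real.continuous_rpow_const (q := 1 / r) (by positivity)).tendsto P).comp
      (tendsto_add_rpow P (by positivity))
  exact ge_of_tendsto ((hc _ q hq).mul (hc _ p hp))
    (eventually_mem_nhdsWithin.mono fun ε hε => key ε hε)

/-- At the endpoint no interpolation is needed: after polar decomposition of `x` alone,
`norm_vecState_mul_le` suffices. -/
theorem IsTracial.holder_one (h : IsTracial S ω) {x y : H →L[ℂ] H} (hx : x ∈ S) (hy : y ∈ S) :
    ‖vecState ω (star y * x)‖ ≤ ‖y‖ * powTrace ω 1 x := by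
  have key : ∀ ε : ℝ, 0 < ε → ‖vecState ω (star y * x)‖ ≤
      ‖y‖ * (powTrace ω 1 x + ε ^ ((1 : ℝ) / 2)) := by
    intro ε hε
    obtain ⟨u, hu, L, hL, hLs, hu1, hxe, hexp⟩ := exists_polar hx hε
    have h1 := hexp 1
    rw [Complex.ofReal_one, one_smul] at h1
    have hE : NormedSpace.exp L ∈ S := by
      have := exp_mem_vN hL 1
      rwa [one_smul] at this
    have h0 : 0 ≤ NormedSpace.exp L := by
      have := exp_real_smul_nonneg hLs 1
      rwa [Complex.ofReal_one, one_smul] at this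
    have e : star y * x = star y * u * NormedSpace.exp L := by
      conv_lhs => rw [hxe]
      simp only [mul_assoc]
    rw [e]
    refine (h.norm_vecState_mul_le (mul_mem (star_mem hy) hu) hE h0).trans ?_
    have hw : ‖star y * u‖ ≤ ‖y‖ := by
      calc _ ≤ ‖star y‖ * ‖u‖ := norm_mul_le _ _
        _ ≤ ‖y‖ * 1 := by rw [norm_star]; gcongr
        _ = ‖y‖ := mul_one _
    rw [h1]
    have := h.vecState_max_le zero_le_one hε x
    refine mul_le_mul hw this ?_ (norm_nonneg y)
    rw [← h1]
    exact vecState_re_nonneg ω h0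
  exact ge_of_tendsto ((tendsto_add_rpow _ (by norm_num)).const_mul _)
    (eventually_mem_nhdsWithin.mono fun ε hε => key ε hε)

theorem vecState_star (ω : H) (x : H →L[ℂ] H) : vecState ω (star x) = star (vecState ω x) := by
  change inner ℂ ω (ContinuousLinearMap.adjoint x ω) = star (inner ℂ ω (x ω))
  rw [ContinuousLinearMap.adjoint_inner_right]
  exact (inner_conj_symm _ _).symm

theorem holderConjugate_cases {p q : ℝ≥0∞} (h : p.HolderConjugate q) :
    (p = 1 ∧ q = ∞) ∨ (p = ∞ ∧ q = 1) ∨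
      (p ≠ ∞ ∧ q ≠ ∞ ∧ p.toReal.HolderConjugate q.toReal) := by
  by_cases hp : p = ∞
  · subst hp
    refine Or.inr (Or.inl ⟨rfl, ?_⟩)
    have := h.inv_add_inv_eq_one
    simpa using this
  by_cases hq : q = ∞
  · subst hq
    refine Or.inl ⟨?_, rfl⟩
    have := h.inv_add_inv_eq_one
    simpa using this
  exact Or.inr (Or.inr ⟨hp, hq, ENNReal.HolderConjugate.toReal_of_ne_top hp hq⟩)

/-- **Hölder's inequality** for the noncommutative `L_p` norms. -/
theorem IsTracial.holder (h : IsTracial S ω) {x y : H →L[ℂ] H} (hx : x ∈ S) (hy : y ∈ S)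
    {p q : ℝ≥0∞} (hpq : p.HolderConjugate q) :
    ‖vecState ω (star y * x)‖ ≤ vecLpNorm ω q y * vecLpNorm ω p x := by
  rcases holderConjugate_cases hpq with ⟨rfl, rfl⟩ | ⟨rfl, rfl⟩ | ⟨hp, hq, hr⟩
  · rw [vecLpNorm_top, vecLpNorm_of_ne_top ω ENNReal.one_ne_top]
    simpa using h.holder_one hx hy
  · rw [vecLpNorm_top, vecLpNorm_of_ne_top ω ENNReal.one_ne_top]
    have e : vecState ω (star y * x) = star (vecState ω (star x * y)) := by
      rw [← vecState_star, star_mul, star_star]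
    rw [e, norm_star, mul_comm]
    simpa using h.holder_one hy hx
  · rw [vecLpNorm_of_ne_top ω hp, vecLpNorm_of_ne_top ω hq]
    exact h.holder_real hx hy hr

end Tracial

end QTorus

namespace QTorus

/-! ### Sharpness of Hölder's inequality: norming elements. -/

section Tracial

variable {H : Type*} [NormedAddCommGroup H] [InnerProductSpace ℂ H] [CompleteSpace H]
variable {S : VonNeumannAlgebra H} {ω : H}

theorem powTrace_smul (ω : H) {p : ℝ} (hp : 0 < p) (c : ℂ) (x : H →L[ℂ] H) :
    powTrace ω p (c • x) = ‖c‖ ^ p * powTrace ω p x := by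
  have hc := Real.continuous_rpow_const (q := p / 2) (by positivity)
  have hT := star_mul_self_nonneg x
  have e : star (c • x) * (c • x) = (‖c‖ ^ 2 : ℝ) • (star x * x) := by
    rw [star_smul, smul_mul_smul_comm]
    have : star c * c = ((‖c‖ ^ 2 : ℝ) : ℂ) := by
      have := RCLike.conj_mul c
      push_cast
      exact this
    rw [this]
    rfl
  have e2 : cfc (fun t : ℝ => t ^ (p / 2)) ((‖c‖ ^ 2 : ℝ) • (star x * x)) =
      ((‖c‖ ^ p : ℝ) : ℂ) • cfc (fun t : ℝ => t ^ (p / 2)) (star x * x) := by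
    rw [← cfc_comp_const_mul (‖c‖ ^ 2) (fun t : ℝ => t ^ (p / 2)) _ hc.continuousOn
      (IsSelfAdjoint.of_nonneg hT)]
    have : ((‖c‖ ^ p : ℝ) : ℂ) • cfc (fun t : ℝ => t ^ (p / 2)) (star x * x) =
      (‖c‖ ^ p) • cfc (fun t : ℝ => t ^ (p / 2)) (star x * x) := rfl
    rw [this, ← cfc_const_mul _ _ _ hc.continuousOn]
    refine cfc_congr fun t ht => ?_
    have ht0 := spectrum_nonneg_of_nonneg hT ht
    rw [Real.mul_rpow (by positivity) ht0, ← Real.rpow_natCast, ← Real.rpow_mul (norm_nonneg c)]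
    congr 2
    push_cast
    ring
  rw [powTrace, powTrace, absPow_eq hp.le, absPow_eq hp.le, e, e2, map_smul, smul_eq_mul,
    Complex.re_ofReal_mul]

theorem toReal_pos_of_one_le {p : ℝ≥0∞} (h1 : 1 ≤ p) (hp : p ≠ ∞) : 0 < p.toReal :=
  ENNReal.toReal_pos (zero_lt_one.trans_le h1).ne' hp

theorem vecLpNorm_smul (ω : H) {p : ℝ≥0∞} (h1 : 1 ≤ p) (c : ℂ) (x : H →L[ℂ] H) :
    vecLpNorm ω p (c • x) = ‖c‖ * vecLpNorm ω p x := by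
  by_cases hp : p = ∞
  · rw [hp, vecLpNorm_top, vecLpNorm_top, norm_smul]
  · have hp0 := toReal_pos_of_one_le h1 hp
    rw [vecLpNorm_of_ne_top ω hp, vecLpNorm_of_ne_top ω hp, powTrace_smul ω hp0,
      Real.mul_rpow (by positivity) (powTrace_nonneg _ _ _), ← Real.rpow_mul (norm_nonneg c),
      mul_one_div_cancel hp0.ne', Real.rpow_one]

/-- The regularized duality map for the noncommutative `L_p` norm. -/
theorem IsTracial.exists_dual (h : IsTracial S ω) {x : H →L[ℂ] H} (hx : x ∈ S) {p ε : ℝ}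
    (hp : 1 ≤ p) (hε : 0 < ε) : ∃ y ∈ S,
      powTrace ω p x - ε ^ (p / 2) ≤ ‖vecState ω (star y * x)‖ ∧ (p = 1 → ‖y‖ ≤ 1) ∧
      ∀ q : ℝ, p.HolderConjugate q → powTrace ω q y ≤ powTrace ω p x + ε ^ (p / 2) := by
  set T := star x * x with hTdef
  have hT : 0 ≤ T := star_mul_self_nonneg x
  have hTS : T ∈ S := star_mul_self_mem hx
  have hpos : ∀ t : ℝ, 0 < max t ε := fun t => hε.trans_le (le_max_right t ε)
  have hcp := Real.continuous_rpow_const (q := p / 2) (by positivity)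
  have hf := continuous_max_rpow hε ((p - 2) / 2)
  have hfn : ∀ t : ℝ, 0 ≤ max t ε ^ ((p - 2) / 2) := fun t => Real.rpow_nonneg (hpos t).le _
  -- Up to the regularization `y = x |x|^{p-2}`, with halved exponent since `T = |x|²`. Then `y* x =
  -- |x|^p`, and `|y|^q = |x|^{(p-1)q} = |x|^p` for the conjugate exponent.
  set A := cfc (fun t : ℝ => max t ε ^ ((p - 2) / 2)) T with hA
  have hAs : IsSelfAdjoint A := cfc_predicate _ _
  have hyy := star_mul_cfc x hf
  rw [← hTdef, ← hA] at hyy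
  refine ⟨x * A, mul_mem hx (cfc_mem_vN hTS _), ?_, ?_, ?_⟩
  · have e : star (x * A) * x = cfc (fun t : ℝ => max t ε ^ ((p - 2) / 2) * t) T := by
      rw [cfc_mul _ (fun t => t) T hf.continuousOn continuous_id.continuousOn, cfc_id' ℝ T,
        star_mul, hAs.star_eq, hTdef, mul_assoc]
    rw [e]
    have h1 : (vecState ω (cfc (fun t : ℝ => t ^ (p / 2)) T)).re ≤
        (vecState ω (cfc (fun t : ℝ => max t ε ^ ((p - 2) / 2) * t + ε ^ (p / 2)) T)).re := by
      refine vecState_re_le_of_forall ω hT hcp ((hf.mul continuous_id).add continuous_const)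
        fun t ht => ?_
      rcases le_total t ε with hh | hh
      · exact (Real.rpow_le_rpow ht hh (by positivity)).trans
          (le_add_of_nonneg_left (mul_nonneg (hfn t) ht))
      · rw [max_eq_left hh]
        have ht' : 0 < t := hε.trans_le hh
        have : t ^ ((p - 2) / 2) * t = t ^ (p / 2) := by
          rw [← Real.rpow_add_one ht'.ne']
          congr 1
          ring
        rw [this]
        exact le_add_of_nonneg_right (by positivity)
    rw [h.vecState_add_const (f := fun t : ℝ => max t ε ^ ((p - 2) / 2) * t) hT
      (hf.mul continuous_id)] at h1
    rw [powTrace, absPow_eq (by positivity), ← hTdef]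
    have h2 := Complex.re_le_norm
      (vecState ω (cfc (fun t : ℝ => max t ε ^ ((p - 2) / 2) * t) T))
    linarith
  · rintro rfl
    have hn : ‖star (x * A) * (x * A)‖ ≤ 1 := by
      rw [hyy]
      refine norm_cfc_le zero_le_one fun t ht => ?_
      have ht0 := spectrum_nonneg_of_nonneg hT ht
      rw [mul_right_comm, ← Real.rpow_add (hpos t), Real.norm_of_nonneg
        (mul_nonneg (Real.rpow_nonneg (hpos t).le _) ht0)]
      norm_num
      rw [Real.rpow_neg_one, inv_mul_le_iff₀ (hpos t), mul_one]
      exact le_max_left _ _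
    rw [CStarRing.norm_star_mul_self] at hn
    nlinarith [norm_nonneg (x * A)]
  · intro q hpq
    have hq := hpq.symm.pos
    have hcq := Real.continuous_rpow_const (q := q / 2) (by positivity)
    have hg : Continuous fun t : ℝ => max t ε ^ ((p - 2) / 2) * t * max t ε ^ ((p - 2) / 2) :=
      (hf.mul continuous_id).mul hf
    refine le_trans ?_ (h.vecState_max_le (p := p) (by positivity) hε x)
    rw [powTrace, absPow_eq hq.le, hyy,
      ← cfc_comp' (fun t : ℝ => t ^ (q / 2)) _ T hcq.continuousOn hg.continuousOn
        (IsSelfAdjoint.of_nonneg hT), ← hTdef]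
    refine vecState_re_le_of_forall ω hT (hcq.comp hg) (continuous_max_rpow hε _) fun t ht => ?_
    have h1 : max t ε ^ ((p - 2) / 2) * t * max t ε ^ ((p - 2) / 2) ≤ max t ε ^ (p - 1) := by
      rw [mul_right_comm, ← Real.rpow_add (hpos t)]
      calc _ ≤ max t ε ^ ((p - 2) / 2 + (p - 2) / 2) * max t ε :=
            mul_le_mul_of_nonneg_left (le_max_left t ε) (Real.rpow_nonneg (hpos t).le _)
        _ = _ := by
            rw [← Real.rpow_add_one (hpos t).ne']
            congr 1
            ring
    have h0 : 0 ≤ max t ε ^ ((p - 2) / 2) * t * max t ε ^ ((p - 2) / 2) :=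
      mul_nonneg (mul_nonneg (hfn t) ht) (hfn t)
    refine (Real.rpow_le_rpow h0 h1 (by positivity)).trans_eq ?_
    rw [← Real.rpow_mul (hpos t).le]
    congr 1
    have := hpq.sub_one_mul_conj
    linear_combination this / 2

theorem IsTracial.norming_one (h : IsTracial S ω) {x : H →L[ℂ] H} (hx : x ∈ S) {c : ℝ}
    (hc : c < powTrace ω 1 x) : ∃ y ∈ S, ‖y‖ ≤ 1 ∧ c < ‖vecState ω (star y * x)‖ := by
  have ht := (tendsto_add_rpow (-powTrace ω 1 x) (r := 1 / 2) (by norm_num)).eventually_lt_const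
    (neg_lt_neg hc)
  obtain ⟨ε, h1, hε⟩ := (ht.and eventually_mem_nhdsWithin).exists
  obtain ⟨y, hy, h2, h3, -⟩ := h.exists_dual hx le_rfl hε
  exact ⟨y, hy, h3 rfl, by linarith⟩

theorem IsTracial.norming_real (h : IsTracial S ω) {x : H →L[ℂ] H} (hx : x ∈ S) {p q c : ℝ}
    (hpq : p.HolderConjugate q) (hc : c < powTrace ω p x ^ (1 / p)) :
    ∃ y ∈ S, powTrace ω q y ≤ 1 ∧ c < ‖vecState ω (star y * x)‖ := by
  have hp := hpq.pos
  have hq := hpq.symm.pos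
  set P := powTrace ω p x with hP
  rcases (powTrace_nonneg ω p x).eq_or_lt with h0 | h0
  · rw [← hP] at h0
    rw [← h0, Real.zero_rpow (by positivity)] at hc
    refine ⟨0, zero_mem _, ?_, by simpa using hc⟩
    have := powTrace_smul ω hq 0 (0 : H →L[ℂ] H)
    rw [zero_smul, norm_zero, Real.zero_rpow hq.ne', zero_mul] at this
    rw [this]; exact zero_le_one
  · rw [← hP] at h0
    -- This is the lower bound for the pairing once `y` has been divided by `(P + ε^{p/2})^{1/q}` to
    -- enter the unit ball; its limit is `P^{1-1/q} = P^{1/p}`.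
    have hlim : Tendsto (fun ε : ℝ => (P + -ε ^ (p / 2)) * (P + ε ^ (p / 2)) ^ (-(1 / q)))
        (𝓝[>] 0) (𝓝 (P * P ^ (-(1 / q)))) := by
      have h1 := tendsto_add_rpow P (r := p / 2) (by positivity)
      have h2 := (tendsto_add_rpow (-P) (r := p / 2) (by positivity)).neg
      simp only [neg_add, neg_neg] at h2
      exact h2.mul (h1.rpow_const (Or.inl h0.ne'))
    have hPe : P * P ^ (-(1 / q)) = P ^ (1 / p) := by
      rw [mul_comm, ← Real.rpow_add_one h0.ne']
      congr 1
      have := hpq.inv_add_inv_eq_one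
      rw [one_div, one_div]
      linarith
    rw [hPe] at hlim
    obtain ⟨ε, h1, hε⟩ := ((hlim.eventually_const_lt hc).and eventually_mem_nhdsWithin).exists
    have hε : 0 < ε := hε
    obtain ⟨y, hy, h2, -, h3⟩ := h.exists_dual hx hpq.lt.le hε
    set M := P + ε ^ (p / 2) with hM
    have hM0 : 0 < M := by positivity
    refine ⟨((M ^ (-(1 / q)) : ℝ) : ℂ) • y, S.toStarSubalgebra.smul_mem hy _, ?_, ?_⟩
    · rw [powTrace_smul ω hq, Complex.norm_real, Real.norm_of_nonneg (by positivity),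
        ← Real.rpow_mul hM0.le]
      have : -(1 / q) * q = -1 := by field_simp
      rw [this, Real.rpow_neg_one, inv_mul_le_iff₀ hM0, mul_one]
      exact h3 q hpq
    · rw [star_smul, smul_mul_assoc, map_smul, norm_smul, norm_star, Complex.norm_real,
        Real.norm_of_nonneg (by positivity)]
      refine h1.trans_le ?_
      rw [mul_comm]
      gcongr
      linarith

/-- `ω` is a cyclic vector. -/
def IsCyclicVector (S : VonNeumannAlgebra H) (ω : H) : Prop :=
  DenseRange fun x : S => (x : H →L[ℂ] H) ω

/-- Test against a contraction `w`: by traciality `τ(w* a b*) = ⟪w (b ω), a ω⟫`, and Cauchy-Schwarz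
applies. These products play the role of rank one operators in the next proof. -/
theorem IsTracial.powTrace_one_mul_star_le (h : IsTracial S ω) {a b : H →L[ℂ] H} (ha : a ∈ S)
    (hb : b ∈ S) : powTrace ω 1 (a * star b) ≤ ‖a ω‖ * ‖b ω‖ := by
  refine le_of_forall_lt fun c hc => ?_
  obtain ⟨w, hw, hw1, hcw⟩ := h.norming_one (mul_mem ha (star_mem hb)) hc
  refine hcw.trans_le ?_
  have e : vecState ω (star w * (a * star b)) = inner ℂ (w (b ω)) (a ω) := by
    rw [← mul_assoc, h.comm _ (mul_mem (star_mem hw) ha) _ (star_mem hb), ← mul_assoc, ← star_mul]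
    exact vecState_star_mul ω a (w * b)
  rw [e, mul_comm]
  refine (norm_inner_le_norm _ _).trans ?_
  gcongr
  refine (w.le_opNorm _).trans ?_
  exact mul_le_of_le_one_left (norm_nonneg _) hw1

/-- If `x` were bounded by `c` on the unit ball of `L_1`, testing on `a b*` would give `|⟪a ω, x (b
ω)⟫| ≤ c ‖a ω‖ ‖b ω‖`. Cyclicity makes such vectors dense, so `‖x‖ ≤ c`, a contradiction. -/
theorem IsTracial.norming_top (h : IsTracial S ω) (hd : IsCyclicVector S ω) {x : H →L[ℂ] H}
    (hx : x ∈ S) {c : ℝ} (hc : c < ‖x‖) :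
    ∃ y ∈ S, powTrace ω 1 y ≤ 1 ∧ c < ‖vecState ω (star y * x)‖ := by
  by_contra! hcon
  have hp1 : ∀ (r : ℂ) (y : H →L[ℂ] H), powTrace ω 1 (r • y) = ‖r‖ * powTrace ω 1 y := by
    intro r y
    rw [powTrace_smul ω one_pos, Real.rpow_one]
  have hc0 : 0 ≤ c := by
    have := hcon 0 (zero_mem _) (by
      have := hp1 0 0
      rw [zero_smul, norm_zero, zero_mul] at this
      rw [this]; exact zero_le_one)
    simpa using this
  have key : ∀ y ∈ S, ∀ M : ℝ, 0 < M → powTrace ω 1 y ≤ M →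
      ‖vecState ω (star y * x)‖ ≤ c * M := by
    intro y hy M hM hyM
    have h1 := hcon (((M⁻¹ : ℝ) : ℂ) • y) (S.toStarSubalgebra.smul_mem hy _) (by
      rw [hp1, Complex.norm_real, Real.norm_of_nonneg (by positivity), inv_mul_le_iff₀ hM, mul_one]
      exact hyM)
    rwa [star_smul, smul_mul_assoc, map_smul, norm_smul, norm_star, Complex.norm_real,
      Real.norm_of_nonneg (by positivity), inv_mul_le_iff₀ hM, mul_comm] at h1
  have key2 : ∀ a ∈ S, ∀ b ∈ S, ‖inner ℂ (a ω) (x (b ω))‖ ≤ c * (‖a ω‖ * ‖b ω‖) := by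
    intro a ha b hb
    have e : inner ℂ (a ω) (x (b ω)) = vecState ω (star (a * star b) * x) := by
      rw [star_mul, star_star, mul_assoc, h.comm _ hb _ (mul_mem (star_mem ha) hx), mul_assoc]
      exact (vecState_star_mul ω (x * b) a).symm
    rw [e]
    -- `key` needs a positive bound, and `‖a ω‖ ‖b ω‖` may vanish; hence the slack `δ`.
    refine le_of_forall_pos_le_add fun δ hδ => ?_
    have h2 := key _ (mul_mem ha (star_mem hb)) (‖a ω‖ * ‖b ω‖ + δ / (c + 1)) (by positivity)
      ((h.powTrace_one_mul_star_le ha hb).trans (le_add_of_nonneg_right (by positivity)))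
    refine h2.trans ?_
    rw [mul_add]
    gcongr
    rw [mul_div_assoc', div_le_iff₀ (by positivity)]
    nlinarith
  have key3 : ∀ ξ η : H, ‖inner ℂ ξ (x η)‖ ≤ c * (‖ξ‖ * ‖η‖) := by
    intro ξ η
    refine isClosed_property2 (p := fun ξ η => ‖inner ℂ ξ (x η)‖ ≤ c * (‖ξ‖ * ‖η‖)) hd
      (isClosed_le (by fun_prop) (by fun_prop)) (fun a b => key2 a a.2 b b.2) ξ η
  refine hc.not_ge (x.opNorm_le_bound hc0 fun η => ?_)
  have h4 := key3 (x η) η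
  rw [inner_self_eq_norm_sq_to_K] at h4
  have h5 : ‖x η‖ ^ 2 ≤ c * (‖x η‖ * ‖η‖) := by simpa using h4
  rcases (norm_nonneg (x η)).eq_or_lt with h0 | h0
  · rw [← h0]; positivity
  · nlinarith

theorem IsTracial.norming (h : IsTracial S ω) (hd : IsCyclicVector S ω) {x : H →L[ℂ] H}
    (hx : x ∈ S) {p q : ℝ≥0∞} (hpq : p.HolderConjugate q) {c : ℝ} (hc : c < vecLpNorm ω p x) :
    ∃ y ∈ S, vecLpNorm ω q y ≤ 1 ∧ c < ‖vecState ω (star y * x)‖ := by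
  rcases holderConjugate_cases hpq with ⟨rfl, rfl⟩ | ⟨rfl, rfl⟩ | ⟨hp, hq, hr⟩
  · rw [vecLpNorm_of_ne_top ω ENNReal.one_ne_top] at hc
    simp only [vecLpNorm_top]
    exact h.norming_one hx (by simpa using hc)
  · simp only [vecLpNorm_of_ne_top ω ENNReal.one_ne_top]
    rw [vecLpNorm_top] at hc
    simpa using h.norming_top hd hx hc
  · simp only [vecLpNorm_of_ne_top ω hq]
    rw [vecLpNorm_of_ne_top ω hp] at hc
    obtain ⟨y, hy, h1, h2⟩ := h.norming_real hx hr hc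
    exact ⟨y, hy, Real.rpow_le_one (powTrace_nonneg _ _ _) h1 hr.symm.one_div_nonneg, h2⟩

theorem IsTracial.vecLpNorm_le (h : IsTracial S ω) (hd : IsCyclicVector S ω) {x : H →L[ℂ] H}
    (hx : x ∈ S) {p q : ℝ≥0∞} (hpq : p.HolderConjugate q) {C : ℝ}
    (hC : ∀ y ∈ S, vecLpNorm ω q y ≤ 1 → ‖vecState ω (star y * x)‖ ≤ C) :
    vecLpNorm ω p x ≤ C := by
  refine le_of_forall_lt fun c hc => ?_
  obtain ⟨y, hy, h1, h2⟩ := h.norming hd hx hpq hc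
  exact h2.trans_le (hC y hy h1)

theorem IsTracial.vecLpNorm_le_norm (h : IsTracial S ω) {x : H →L[ℂ] H}
    {p : ℝ≥0∞} (h1 : 1 ≤ p) : vecLpNorm ω p x ≤ ‖x‖ := by
  by_cases hp : p = ∞
  · rw [hp, vecLpNorm_top]
  · have hp0 := toReal_pos_of_one_le h1 hp
    rw [vecLpNorm_of_ne_top ω hp]
    have hb : powTrace ω p.toReal x ≤ ‖x‖ ^ p.toReal := by
      rw [powTrace, absPow_eq hp0.le]
      refine (Complex.re_le_norm _).trans ?_
      rw [vecState_apply]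
      refine (norm_inner_le_norm _ _).trans ?_
      rw [h.norm_eq, one_mul]
      refine (ContinuousLinearMap.le_opNorm _ _).trans ?_
      rw [h.norm_eq, mul_one]
      refine norm_cfc_le (by positivity) fun t ht => ?_
      have ht0 := spectrum_nonneg_of_nonneg (star_mul_self_nonneg x) ht
      have ht1 : t ≤ ‖x‖ ^ 2 := by
        rcases subsingleton_or_nontrivial (H →L[ℂ] H) with hs | hs
        · simp [Subsingleton.elim (star x * x) 0] at ht
        · have := spectrum.norm_le_norm_of_mem ht
          rw [CStarRing.norm_star_mul_self, Real.norm_of_nonneg ht0] at this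
          rwa [sq]
      rw [Real.norm_of_nonneg (Real.rpow_nonneg ht0 _)]
      refine (Real.rpow_le_rpow ht0 ht1 (by positivity)).trans_eq ?_
      rw [← Real.rpow_natCast, ← Real.rpow_mul (norm_nonneg x)]
      congr 1
      push_cast
      ring
    calc _ ≤ (‖x‖ ^ p.toReal) ^ (1 / p.toReal) :=
          Real.rpow_le_rpow (powTrace_nonneg _ _ _) hb (by positivity)
      _ = ‖x‖ := by
          rw [← Real.rpow_mul (norm_nonneg x), mul_one_div_cancel hp0.ne', Real.rpow_one]

end Tracial

end QTorus

namespace QTorus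

/-! ### Invariance of the norms under unitary conjugation. -/

section Conjugation

variable {H : Type*} [NormedAddCommGroup H] [InnerProductSpace ℂ H] [CompleteSpace H]

theorem absPow_conj {p : ℝ} (hp : 0 ≤ p) {U : H →L[ℂ] H} (hU : U ∈ unitary (H →L[ℂ] H))
    (x : H →L[ℂ] H) : absPow p (U * x * star U) = U * absPow p x * star U := by
  have e : star (U * x * star U) * (U * x * star U) =
      Unitary.conjStarAlgAut ℂ (H →L[ℂ] H) ⟨U, hU⟩ (star x * x) := by
    rw [Unitary.conjStarAlgAut_apply, star_mul, star_mul, star_star]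
    calc _ = U * star x * (star U * U) * x * star U := by
          simp only [mul_assoc]
      _ = U * (star x * x) * star U := by
          rw [Unitary.star_mul_self_of_mem hU, mul_one, mul_assoc U]
  have hc : Continuous (Unitary.conjStarAlgAut ℂ (H →L[ℂ] H) ⟨U, hU⟩) := by
    change Continuous fun x : H →L[ℂ] H => U * x * star U
    fun_prop
  rw [absPow_eq hp, absPow_eq hp, e, ← StarAlgHomClass.map_cfc (R := ℝ) (S := ℂ)
    (Unitary.conjStarAlgAut ℂ (H →L[ℂ] H) ⟨U, hU⟩) _ _
    (continuousOn_rpow_spectrum (by positivity) _) hc (IsSelfAdjoint.star_mul_self x)]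
  rfl

/-- Conjugation is an automorphism, hence commutes with the functional calculus, and it preserves
the state because `U*` fixes `ω`. This is what makes translations isometric on every `L_p`. -/
theorem vecLpNorm_conj {p : ℝ≥0∞} {ω : H} {U : H →L[ℂ] H} (hU : U ∈ unitary (H →L[ℂ] H))
    (hω : star U ω = ω) (x : H →L[ℂ] H) :
    vecLpNorm ω p (U * x * star U) = vecLpNorm ω p x := by
  by_cases hp : p = ∞
  · rw [hp, vecLpNorm_top, vecLpNorm_top, CStarRing.norm_mul_mem_unitary _ (Unitary.star_mem hU),
      CStarRing.norm_mem_unitary_mul _ hU]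
  · rw [vecLpNorm_of_ne_top ω hp, vecLpNorm_of_ne_top ω hp, powTrace, powTrace,
      absPow_conj ENNReal.toReal_nonneg hU]
    congr 2
    rw [vecState_apply, vecState_apply]
    have : ∀ y : H →L[ℂ] H, inner ℂ ω ((U * y * star U) ω) =
        inner ℂ (star U ω) (y (star U ω)) := by
      intro y
      change inner ℂ ω (U (y (star U ω))) = inner ℂ (ContinuousLinearMap.adjoint U ω) _
      rw [ContinuousLinearMap.adjoint_inner_left]
    rw [this, hω]

end Conjugation

variable {d : ℕ} {θ : Matrix (Fin d) (Fin d) ℝ}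

/-! ### Test elements as operators -/

/-- The sum of `‖v‖^{-N}` over a lattice of rank less than `N` converges. The comparison with `(1 +
‖m‖)^{-N}` is made for `m ≠ 0`, and one term does not affect summability. -/
theorem exists_summable_weight (d : ℕ) :
    ∃ N : ℕ, Summable fun m : Lattice d => ((1 + ‖m‖) ^ N)⁻¹ := by
  set L := Submodule.span ℤ (Set.range (Pi.basisFun ℝ (Fin d))) with hL
  obtain ⟨N, hN⟩ := exists_nat_gt (Module.finrank ℤ L : ℝ)
  have h := ZLattice.summable_norm_rpow L (-(N : ℝ)) (by linarith)
  let φ : Lattice d → L := fun m => ⟨fun i => (m i : ℝ), by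
    have : (fun i => (m i : ℝ)) = ∑ i, m i • (Pi.basisFun ℝ (Fin d)) i := by
      ext j
      simp [Finset.sum_apply, Pi.single_apply]
    rw [this]
    exact Submodule.sum_mem _ fun i _ =>
      Submodule.smul_mem _ _ (Submodule.subset_span (Set.mem_range_self i))⟩
  have hφ : Function.Injective φ := by
    intro m n hmn
    ext i
    have h3 : (m i : ℝ) = (n i : ℝ) := congrFun (congrArg Subtype.val hmn) i
    exact_mod_cast h3
  have h2 := h.comp_injective hφ
  have hnorm : ∀ m, ‖φ m‖ = ‖m‖ := by
    intro m
    change ‖(fun i => (m i : ℝ))‖ = ‖m‖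
    simp [Pi.norm_def, ← Int.norm_cast_real, nnnorm]
  refine ⟨N, Summable.of_norm_bounded_eventually h2 ?_⟩
  filter_upwards [Set.Finite.compl_mem_cofinite (Set.finite_singleton (0 : Lattice d))] with m hm
  have hm0 : 0 < ‖m‖ := norm_pos_iff.2 hm
  rw [Function.comp, hnorm, Real.rpow_neg hm0.le, Real.rpow_natCast,
    Real.norm_of_nonneg (by positivity)]
  gcongr
  linarith

theorem Test.summable_weight_mul (a : Test d) (N : ℕ) :
    Summable fun m => (1 + ‖m‖) ^ N * ‖a.1 m‖ := by
  obtain ⟨M, hM⟩ := exists_summable_weight d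
  obtain ⟨C, hC⟩ := a.2 (N + M)
  refine Summable.of_nonneg_of_le (fun m => by positivity) (fun m => ?_) (hM.mul_left C)
  rw [← div_eq_mul_inv, le_div_iff₀ (by positivity)]
  calc _ = (1 + ‖m‖) ^ (N + M) * ‖a.1 m‖ := by ring
    _ ≤ C := hC m

theorem Test.summable_norm (a : Test d) : Summable fun m => ‖a.1 m‖ := by
  simpa using (Test.summable_weight_mul a 0)

theorem Test.summable_op (θ : Matrix (Fin d) (Fin d) ℝ) (a : Test d) :
    Summable fun m => ‖a.1 m • mon θ m‖ := by
  refine Summable.of_nonneg_of_le (fun m => norm_nonneg _) (fun m => ?_) (Test.summable_norm a)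
  rw [norm_smul]
  exact mul_le_of_le_one_right (norm_nonneg _) (norm_mon_le m)

theorem Test.hasSum_op (θ : Matrix (Fin d) (Fin d) ℝ) (a : Test d) :
    HasSum (fun m => a.1 m • mon θ m) (Test.op θ a) :=
  ((Test.summable_op θ a)).of_norm.hasSum

theorem Test.norm_op_le (θ : Matrix (Fin d) (Fin d) ℝ) (a : Test d) :
    ‖Test.op θ a‖ ≤ ∑' m, ‖a.1 m‖ := by
  refine (norm_tsum_le_tsum_norm ((Test.summable_op θ a))).trans ?_
  refine ((Test.summable_op θ a)).tsum_le_tsum (fun m => ?_) (Test.summable_norm a)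
  rw [norm_smul]
  exact mul_le_of_le_one_right (norm_nonneg _) (norm_mon_le m)

theorem Test.op_add (a b : Test d) : Test.op θ (a + b) = Test.op θ a + Test.op θ b := by
  refine (Test.hasSum_op θ (a + b)).unique ((((Test.hasSum_op θ a)).add ((Test.hasSum_op θ b))).congr_fun ?_)
  intro m
  exact add_smul _ _ _

theorem Test.op_smul (c : ℂ) (a : Test d) : Test.op θ (c • a) = c • Test.op θ a := by
  refine (Test.hasSum_op θ (c • a)).unique ((((Test.hasSum_op θ a)).const_smul c).congr_fun ?_)
  intro m
  exact mul_smul c (a.1 m) (mon θ m)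

theorem Test.op_basisVec (a : Test d) (m : Lattice d) : Test.op θ a (basisVec 0) m = a.1 m := by
  have h := (((Test.hasSum_op θ a)).mapL (ContinuousLinearMap.apply ℂ (GNS d) (basisVec 0))).mapL
    (innerSL ℂ (basisVec m))
  have h2 : HasSum (fun n => if n = m then a.1 m else 0) (a.1 m) := hasSum_ite_eq m (a.1 m)
  rw [innerSL_apply_apply, inner_basisVec] at h
  refine h.unique (h2.congr_fun fun n => ?_)
  rw [innerSL_apply_apply, inner_basisVec]
  change a.1 n • (mon θ n (basisVec 0)) m = _
  rw [mon_basisVec, phase_zero_right, one_smul, add_zero]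
  by_cases hn : n = m
  · subst hn
    simp [basisVec]
  · have : basisVec (d := d) n m = 0 := lp.single_apply_ne _ _ _ (Ne.symm hn)
    rw [this, if_neg hn, smul_zero]

theorem Test.op_mem (a : Test d) : Test.op θ a ∈ vN θ := by
  refine mem_vN.2 fun z h1 h2 => ?_
  have hL := ((Test.hasSum_op θ a)).mul_left z
  have hR := ((Test.hasSum_op θ a)).mul_right z
  refine hL.unique (hR.congr_fun fun m => ?_)
  rw [mul_smul_comm, smul_mul_assoc, mem_vN.1 (mon_mem m) z h1 h2]

/-! ### The trace of the quantum torus -/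

theorem vecLpNorm_basisVec (p : ℝ≥0∞) (x : GNS d →L[ℂ] GNS d) :
    vecLpNorm (basisVec 0) p x = opLpNorm p x := rfl

theorem isTracial_vN (θ : Matrix (Fin d) (Fin d) ℝ) : IsTracial (vN θ) (basisVec 0) where
  norm_eq := norm_basisVec 0
  comm _ hx _ hy := trace_mul_comm hx hy

theorem isCyclicVector_vN (θ : Matrix (Fin d) (Fin d) ℝ) : IsCyclicVector (vN θ) (basisVec 0) := by
  intro f
  refine mem_closure_of_tendsto (hasSum_basisVec f) (Eventually.of_forall fun s => ?_)
  refine ⟨⟨∑ m ∈ s, f m • mon θ m, sum_mem fun m _ => smul_mem_vN _ (mon_mem m)⟩, ?_⟩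
  simp [mon_basisVec]

/-- The elements `b` such that `x ↦ τ(x b)` is a functional of norm at most one for `‖·‖_p`. -/
def dualBall (θ : Matrix (Fin d) (Fin d) ℝ) (p : ℝ≥0∞) : Set (GNS d →L[ℂ] GNS d) :=
  {b | b ∈ vN θ ∧ opLpNorm p.conjExponent (star b) ≤ 1}

theorem one_le_conjExponent (p : ℝ≥0∞) : 1 ≤ p.conjExponent := by
  rw [ENNReal.conjExponent]
  exact le_self_add

theorem norm_trace_mul_le {x b : GNS d →L[ℂ] GNS d} {p : ℝ≥0∞} (hp : 1 ≤ p) (hx : x ∈ vN θ)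
    (hb : b ∈ vN θ) : ‖trace (x * b)‖ ≤ opLpNorm p.conjExponent (star b) * opLpNorm p x := by
  have := (isTracial_vN θ).holder hx (star_mem hb) (ENNReal.HolderConjugate.conjExponent hp)
  rw [star_star] at this
  rw [trace_mul_comm hx hb]
  exact this

theorem norm_trace_mul_le_of_mem {x b : GNS d →L[ℂ] GNS d} {p : ℝ≥0∞} (hp : 1 ≤ p)
    (hx : x ∈ vN θ) (hb : b ∈ dualBall θ p) : ‖trace (x * b)‖ ≤ opLpNorm p x :=
  (norm_trace_mul_le hp hx hb.1).trans (mul_le_of_le_one_left (vecLpNorm_nonneg _ _ _) hb.2)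

/-- The norming half of duality: with `norm_trace_mul_le_of_mem` it makes `‖·‖_p` a supremum over
`dualBall`, so sums and averages can be estimated after pairing. -/
theorem opLpNorm_le {x : GNS d →L[ℂ] GNS d} {p : ℝ≥0∞} (hp : 1 ≤ p)
    (hx : x ∈ vN θ) {C : ℝ} (hC : ∀ b ∈ dualBall θ p, ‖trace (x * b)‖ ≤ C) :
    opLpNorm p x ≤ C := by
  refine (isTracial_vN θ).vecLpNorm_le (isCyclicVector_vN θ) hx
    (ENNReal.HolderConjugate.conjExponent hp) fun y hy h1 => ?_
  have := hC (star y) ⟨star_mem hy, by rwa [star_star]⟩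
  rwa [trace_mul_comm hx (star_mem hy)] at this

theorem mem_dualBall_of_norm_le {b : GNS d →L[ℂ] GNS d} (p : ℝ≥0∞) (hb : b ∈ vN θ)
    (h : ‖b‖ ≤ 1) : b ∈ dualBall θ p :=
  ⟨hb, ((isTracial_vN θ).vecLpNorm_le_norm (one_le_conjExponent p)).trans
    (by rwa [norm_star])⟩

theorem norm_trace_mul_le_opNorm {x b : GNS d →L[ℂ] GNS d} {p : ℝ≥0∞} (hp : 1 ≤ p)
    (hx : x ∈ vN θ) (hb : b ∈ vN θ) : ‖trace (x * b)‖ ≤ opLpNorm p x * ‖b‖ := by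
  refine (norm_trace_mul_le hp hx hb).trans ?_
  rw [mul_comm]
  refine mul_le_mul_of_nonneg_left ?_ (vecLpNorm_nonneg _ _ _)
  have := (isTracial_vN θ).vecLpNorm_le_norm (x := star b) (one_le_conjExponent p)
  rwa [norm_star] at this

theorem opLpNorm_nonneg (p : ℝ≥0∞) (x : GNS d →L[ℂ] GNS d) : 0 ≤ opLpNorm p x :=
  vecLpNorm_nonneg _ _ _

theorem opLpNorm_smul {p : ℝ≥0∞} (hp : 1 ≤ p) (c : ℂ) (x : GNS d →L[ℂ] GNS d) :
    opLpNorm p (c • x) = ‖c‖ * opLpNorm p x :=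
  vecLpNorm_smul _ hp c x

theorem opLpNorm_le_norm {p : ℝ≥0∞} (hp : 1 ≤ p) (x : GNS d →L[ℂ] GNS d) : opLpNorm p x ≤ ‖x‖ :=
  -- The norm depends only on the trace vector, which is common to all tori, so any matrix may be
  -- used here.
  (isTracial_vN (0 : Matrix (Fin d) (Fin d) ℝ)).vecLpNorm_le_norm hp

/-! ### Translations -/

/-- The character `m ↦ e^{2πi u·m}`. -/
def chr (u : EuclideanSpace ℝ (Fin d)) (m : Lattice d) : ℂ :=
  Complex.exp (((2 * Real.pi * ∑ j, u j * (m j : ℝ) : ℝ) : ℂ) * Complex.I)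

theorem norm_chr (u : EuclideanSpace ℝ (Fin d)) (m : Lattice d) : ‖chr u m‖ = 1 :=
  Complex.norm_exp_ofReal_mul_I _

theorem chr_add (u v : EuclideanSpace ℝ (Fin d)) (m : Lattice d) :
    chr (u + v) m = chr u m * chr v m := by
  rw [chr, chr, chr, ← Complex.exp_add, ← add_mul, ← Complex.ofReal_add, ← mul_add,
    ← Finset.sum_add_distrib]
  congr 5
  ext j
  rw [PiLp.add_apply]
  ring

theorem chr_add_right (u : EuclideanSpace ℝ (Fin d)) (m n : Lattice d) :
    chr u (m + n) = chr u m * chr u n := by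
  rw [chr, chr, chr, ← Complex.exp_add, ← add_mul, ← Complex.ofReal_add, ← mul_add,
    ← Finset.sum_add_distrib]
  congr 5
  ext j
  rw [Pi.add_apply]
  push_cast
  ring

@[simp] theorem chr_zero (m : Lattice d) : chr 0 m = 1 := by simp [chr]

@[simp] theorem chr_zero_right (u : EuclideanSpace ℝ (Fin d)) : chr u 0 = 1 := by simp [chr]

theorem chr_neg (u : EuclideanSpace ℝ (Fin d)) (m : Lattice d) : chr (-u) m = star (chr u m) := by
  have h1 : chr (-u) m * chr u m = 1 := by rw [← chr_add]; simp
  have h2 : star (chr u m) * chr u m = 1 := by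
    have := RCLike.conj_mul (chr u m)
    rw [norm_chr] at this
    simpa using this
  have h3 : chr u m ≠ 0 := fun h => by simp [h] at h1
  exact mul_right_cancel₀ h3 (h1.trans h2.symm)

theorem continuous_chr (m : Lattice d) :
    Continuous fun u : EuclideanSpace ℝ (Fin d) => chr u m := by
  unfold chr
  fun_prop

/-- The diagonal unitary with entries `e^{2πi u·m}`. -/
def diagChr (u : EuclideanSpace ℝ (Fin d)) : GNS d →L[ℂ] GNS d :=
  LinearMap.mkContinuous
    { toFun := fun f => ⟨fun n => chr u n * f n, (memℓp_gen_iff (by norm_num)).2 (by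
        simpa only [norm_mul, norm_chr, one_mul] using (lp.memℓp f).summable (by norm_num))⟩
      map_add' := fun f g => by
        ext n
        exact mul_add _ _ _
      map_smul' := fun c f => by
        ext n
        exact mul_left_comm _ _ _ } 1 (fun f => by
      rw [one_mul, ← Real.rpow_le_rpow_iff (norm_nonneg _) (norm_nonneg _)
          (show 0 < (2 : ℝ≥0∞).toReal by norm_num),
        lp.norm_rpow_eq_tsum (by norm_num), lp.norm_rpow_eq_tsum (by norm_num)]
      simp only [LinearMap.coe_mk, AddHom.coe_mk, norm_mul, norm_chr, one_mul]
      exact le_rfl)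

theorem diagChr_apply (u : EuclideanSpace ℝ (Fin d)) (f : GNS d) (n : Lattice d) :
    diagChr u f n = chr u n * f n := rfl

theorem norm_diagChr_le (u : EuclideanSpace ℝ (Fin d)) : ‖diagChr u‖ ≤ 1 :=
  LinearMap.mkContinuous_norm_le _ zero_le_one _

theorem diagChr_mul (u v : EuclideanSpace ℝ (Fin d)) :
    diagChr u * diagChr v = diagChr (u + v) := by
  ext f n
  change chr u n * (chr v n * f n) = chr (u + v) n * f n
  rw [chr_add, mul_assoc]

theorem diagChr_zero : diagChr (0 : EuclideanSpace ℝ (Fin d)) = 1 := by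
  ext f n
  change chr 0 n * f n = f n
  rw [chr_zero, one_mul]

theorem diagChr_basisVec (u : EuclideanSpace ℝ (Fin d)) (m : Lattice d) :
    diagChr u (basisVec m) = chr u m • basisVec m := by
  ext n
  change chr u n * basisVec m n = chr u m * basisVec m n
  by_cases h : n = m
  · rw [h]
  · have : basisVec (d := d) m n = 0 := lp.single_apply_ne _ _ _ h
    rw [this, mul_zero, mul_zero]

theorem star_diagChr (u : EuclideanSpace ℝ (Fin d)) : star (diagChr u) = diagChr (-u) := by
  refine ContinuousLinearMap.ext fun f => ?_
  refine ext_inner_left ℂ fun g => ?_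
  change inner ℂ g (ContinuousLinearMap.adjoint (diagChr u) f) = _
  rw [ContinuousLinearMap.adjoint_inner_right, lp.inner_eq_tsum, lp.inner_eq_tsum]
  congr 1
  ext n
  rw [diagChr_apply, diagChr_apply, chr_neg]
  simp only [RCLike.inner_apply, map_mul]
  change f n * (star (chr u n) * _) = _
  ring

/-- Dominated convergence in `ℓ²` with majorant `2² |f n|²`. This is strong continuity, so averages
of translations are integrated vector by vector. -/
theorem continuous_diagChr_apply (f : GNS d) :
    Continuous fun u : EuclideanSpace ℝ (Fin d) => diagChr u f := by
  have hf := (lp.memℓp f).summable (show 0 < (2 : ℝ≥0∞).toReal by norm_num)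
  rw [continuous_iff_continuousAt]
  intro v
  rw [ContinuousAt, tendsto_iff_norm_sub_tendsto_zero]
  have h : Tendsto (fun u : EuclideanSpace ℝ (Fin d) =>
      ‖diagChr u f - diagChr v f‖ ^ (2 : ℝ≥0∞).toReal) (𝓝 v) (𝓝 0) := by
    have h1 : ∀ u, ‖diagChr u f - diagChr v f‖ ^ (2 : ℝ≥0∞).toReal =
        ∑' n, ‖(chr u n - chr v n) * f n‖ ^ (2 : ℝ≥0∞).toReal := by
      intro u
      rw [lp.norm_rpow_eq_tsum (by norm_num)]
      congr 1
      ext n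
      rw [sub_mul]
      rfl
    simp only [h1]
    have h0 : ∑' n, ‖(chr v n - chr v n) * f n‖ ^ (2 : ℝ≥0∞).toReal = 0 := by simp
    rw [← h0]
    refine tendsto_tsum_of_dominated_convergence
      (bound := fun n => 2 ^ (2 : ℝ≥0∞).toReal * ‖f n‖ ^ (2 : ℝ≥0∞).toReal)
      (hf.mul_left _) (fun n => ?_) (Eventually.of_forall fun u n => ?_)
    · have : Continuous fun u : EuclideanSpace ℝ (Fin d) =>
          ‖(chr u n - chr v n) * f n‖ ^ (2 : ℝ≥0∞).toReal :=
        ((((continuous_chr n).sub continuous_const).mul continuous_const).norm).rpow_const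
          fun _ => Or.inr (by norm_num)
      exact this.tendsto v
    · rw [Real.norm_of_nonneg (by positivity), norm_mul,
        Real.mul_rpow (norm_nonneg _) (norm_nonneg _)]
      gcongr
      refine (norm_sub_le _ _).trans ?_
      rw [norm_chr, norm_chr]
      norm_num
  have h2 := h.rpow_const (p := ((2 : ℝ≥0∞).toReal)⁻¹) (Or.inr (by norm_num))
  rw [Real.zero_rpow (by norm_num)] at h2
  refine h2.congr fun u => ?_
  rw [← Real.rpow_mul (norm_nonneg _), mul_inv_cancel₀ (by norm_num), Real.rpow_one]

/-- The translation of an operator by `u`. -/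
def translate (u : EuclideanSpace ℝ (Fin d)) (x : GNS d →L[ℂ] GNS d) : GNS d →L[ℂ] GNS d :=
  diagChr u * x * diagChr (-u)

theorem translate_mul (u : EuclideanSpace ℝ (Fin d)) (x y : GNS d →L[ℂ] GNS d) :
    translate u (x * y) = translate u x * translate u y := by
  unfold translate
  calc _ = diagChr u * x * (diagChr (-u) * diagChr u) * y * diagChr (-u) := by
        rw [diagChr_mul, neg_add_cancel, diagChr_zero]
        simp only [mul_assoc, mul_one]
    _ = _ := by simp only [mul_assoc]

theorem translate_translate_neg (u : EuclideanSpace ℝ (Fin d)) (x : GNS d →L[ℂ] GNS d) :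
    translate u (translate (-u) x) = x := by
  unfold translate
  calc _ = (diagChr u * diagChr (-u)) * x * (diagChr (- -u) * diagChr (-u)) := by
        simp only [mul_assoc]
    _ = _ := by
        rw [diagChr_mul, diagChr_mul, neg_neg, add_neg_cancel, diagChr_zero, one_mul, mul_one]

theorem star_translate (u : EuclideanSpace ℝ (Fin d)) (x : GNS d →L[ℂ] GNS d) :
    star (translate u x) = translate u (star x) := by
  unfold translate
  rw [star_mul, star_mul, star_diagChr, star_diagChr, neg_neg, mul_assoc]

theorem translate_mon (u : EuclideanSpace ℝ (Fin d)) (m : Lattice d) :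
    translate u (mon θ m) = chr u m • mon θ m := by
  refine ext_basisVec fun n => ?_
  change diagChr u (mon θ m (diagChr (-u) (basisVec n))) = chr u m • mon θ m (basisVec n)
  rw [diagChr_basisVec, map_smul, map_smul, mon_basisVec, map_smul, diagChr_basisVec, smul_smul,
    smul_smul, smul_smul]
  congr 1
  have h : chr (-u) n * chr u n = 1 := by rw [← chr_add]; simp
  rw [chr_add_right]
  linear_combination (phase θ m n * chr u m) * h

/-- Translation by `-u` multiplies each generator by a nonzero scalar, so it maps the commutant of
the generators to itself. Thus `x` commutes with `translate (-u) z`, and translating back by `u`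
gives the claim. -/
theorem translate_mem (u : EuclideanSpace ℝ (Fin d)) {x : GNS d →L[ℂ] GNS d} (hx : x ∈ vN θ) :
    translate u x ∈ vN θ := by
  refine mem_vN.2 fun z h1 h2 => ?_
  have hg : ∀ j, translate (-u) (gen θ j) = chr (-u) (Pi.single j 1) • gen θ j := fun j =>
    translate_mon _ _
  have hne : ∀ j, chr (-u) (Pi.single j 1 : Lattice d) ≠ 0 := fun j h => by
    have := norm_chr (-u) (Pi.single j 1 : Lattice d)
    simp [h] at this
  have key : translate (-u) z * x = x * translate (-u) z := by
    refine mem_vN.1 hx _ (fun j => ?_) (fun j => ?_)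
    · have := congrArg (translate (-u)) (h1 j)
      rw [translate_mul, translate_mul, hg, smul_mul_assoc, mul_smul_comm] at this
      exact smul_right_injective _ (hne j) this
    · have := congrArg (translate (-u)) (h2 j)
      rw [translate_mul, translate_mul, ← star_translate, hg, star_smul, smul_mul_assoc,
        mul_smul_comm] at this
      exact smul_right_injective _ (star_ne_zero.2 (hne j)) this
  have := congrArg (translate u) key
  rwa [translate_mul, translate_mul, translate_translate_neg] at this

theorem translate_basisVec (u : EuclideanSpace ℝ (Fin d)) (x : GNS d →L[ℂ] GNS d)
    (m : Lattice d) : translate u x (basisVec 0) m = chr u m * x (basisVec 0) m := by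
  change diagChr u (x (diagChr (-u) (basisVec 0))) m = _
  rw [diagChr_basisVec, chr_zero_right, one_smul, diagChr_apply]

theorem opLpNorm_translate (p : ℝ≥0∞) (u : EuclideanSpace ℝ (Fin d)) (x : GNS d →L[ℂ] GNS d) :
    opLpNorm p (translate u x) = opLpNorm p x := by
  have hU : diagChr u ∈ unitary (GNS d →L[ℂ] GNS d) := by
    rw [Unitary.mem_iff, star_diagChr, diagChr_mul, diagChr_mul, neg_add_cancel, add_neg_cancel,
      diagChr_zero]
    exact ⟨rfl, rfl⟩
  have := vecLpNorm_conj (p := p) (ω := (basisVec 0 : GNS d)) hU (by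
    rw [star_diagChr, diagChr_basisVec, chr_zero_right, one_smul]) x
  rw [← vecLpNorm_basisVec, ← vecLpNorm_basisVec, ← this]
  rw [star_diagChr]
  rfl

end QTorus

namespace QTorus

variable {d : ℕ} {θ : Matrix (Fin d) (Fin d) ℝ}

/-! ### Averages of translations -/

theorem norm_translate_apply_le (u : EuclideanSpace ℝ (Fin d)) (x : GNS d →L[ℂ] GNS d)
    (η : GNS d) : ‖translate u x η‖ ≤ ‖x‖ * ‖η‖ := by
  change ‖diagChr u (x (diagChr (-u) η))‖ ≤ _
  have h : ∀ (v : EuclideanSpace ℝ (Fin d)) (ξ : GNS d), ‖diagChr v ξ‖ ≤ ‖ξ‖ := fun v ξ =>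
    ((diagChr v).le_opNorm ξ).trans (mul_le_of_le_one_left (norm_nonneg _) (norm_diagChr_le v))
  refine (h _ _).trans ((x.le_opNorm _).trans ?_)
  gcongr
  exact h _ _

theorem continuous_translate_apply (x : GNS d →L[ℂ] GNS d) (η : GNS d) :
    Continuous fun u : EuclideanSpace ℝ (Fin d) => translate u x η := by
  set g : EuclideanSpace ℝ (Fin d) → GNS d := fun u => x (diagChr (-u) η) with hg
  have hgc : Continuous g := x.continuous.comp ((continuous_diagChr_apply η).comp continuous_neg)
  rw [continuous_iff_continuousAt]
  intro v
  change Tendsto (fun u => diagChr u (g u)) (𝓝 v) (𝓝 (diagChr v (g v)))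
  have h1 : Tendsto (fun u => diagChr u (g u - g v)) (𝓝 v) (𝓝 0) := by
    have h0 : Tendsto (fun u => ‖g u - g v‖) (𝓝 v) (𝓝 0) := by
      rw [← tendsto_iff_norm_sub_tendsto_zero]
      exact hgc.tendsto v
    refine squeeze_zero_norm (fun u => ?_) h0
    exact ((diagChr u).le_opNorm _).trans (mul_le_of_le_one_left (norm_nonneg _)
      (norm_diagChr_le u))
  have h2 := h1.add ((continuous_diagChr_apply (g v)).tendsto v)
  rw [zero_add] at h2
  refine h2.congr fun u => ?_
  rw [← map_add, sub_add_cancel]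

section Average

variable {Ω : Type*} [MeasurableSpace Ω] {μ : Measure Ω} {f : Ω → ℂ}
  {U : Ω → EuclideanSpace ℝ (Fin d)}

theorem integrable_smul_translate (hf : Integrable f μ) (hU : Measurable U)
    (x : GNS d →L[ℂ] GNS d) (η : GNS d) :
    Integrable (fun w => f w • translate (U w) x η) μ := by
  refine Integrable.mono' (hf.norm.mul_const (‖x‖ * ‖η‖)) (hf.aestronglyMeasurable.smul
    ((continuous_translate_apply x η).stronglyMeasurable.comp_measurable
      hU).aestronglyMeasurable) (Eventually.of_forall fun w => ?_)
  rw [norm_smul]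
  gcongr
  exact norm_translate_apply_le _ _ _

/-- The weak integral `∫ f(w) T_{U(w)} x dμ(w)`. -/
def average (μ : Measure Ω) (f : Ω → ℂ) (U : Ω → EuclideanSpace ℝ (Fin d))
    (hf : Integrable f μ) (hU : Measurable U) (x : GNS d →L[ℂ] GNS d) : GNS d →L[ℂ] GNS d :=
  LinearMap.mkContinuous
    { toFun := fun η => ∫ w, f w • translate (U w) x η ∂μ
      map_add' := fun η ξ => by
        rw [← integral_add (integrable_smul_translate hf hU x η)
          (integrable_smul_translate hf hU x ξ)]
        simp only [map_add, smul_add]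
      map_smul' := fun c η => by
        rw [RingHom.id_apply, ← integral_smul]
        simp only [map_smul]
        congr 1
        ext1 w
        rw [smul_comm] } ((∫ w, ‖f w‖ ∂μ) * ‖x‖) (fun η => by
      refine (norm_integral_le_integral_norm _).trans ?_
      rw [mul_assoc, ← integral_mul_const]
      refine integral_mono (integrable_smul_translate hf hU x η).norm (hf.norm.mul_const _)
        fun w => ?_
      simp only [norm_smul]
      gcongr
      exact norm_translate_apply_le _ _ _)

theorem average_apply (hf : Integrable f μ) (hU : Measurable U) (x : GNS d →L[ℂ] GNS d)
    (η : GNS d) : average μ f U hf hU x η = ∫ w, f w • translate (U w) x η ∂μ := rfl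

theorem inner_average (hf : Integrable f μ) (hU : Measurable U) (x : GNS d →L[ℂ] GNS d)
    (ξ η : GNS d) : inner ℂ ξ (average μ f U hf hU x η) =
      ∫ w, f w * inner ℂ ξ (translate (U w) x η) ∂μ := by
  rw [average_apply, ← innerSL_apply_apply ℂ ξ,
    ← ContinuousLinearMap.integral_comp_comm _ (integrable_smul_translate hf hU x η)]
  simp only [map_smul, innerSL_apply_apply, smul_eq_mul]

theorem average_mem (hf : Integrable f μ) (hU : Measurable U) {x : GNS d →L[ℂ] GNS d}
    (hx : x ∈ vN θ) : average μ f U hf hU x ∈ vN θ := by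
  refine mem_vN.2 fun z h1 h2 => ContinuousLinearMap.ext fun η => ?_
  change z (average μ f U hf hU x η) = average μ f U hf hU x (z η)
  rw [average_apply, average_apply,
    ← ContinuousLinearMap.integral_comp_comm _ (integrable_smul_translate hf hU x η)]
  congr 1
  ext1 w
  rw [map_smul]
  exact congrArg (fun A : GNS d →L[ℂ] GNS d => f w • A η)
    (mem_vN.1 (translate_mem (U w) hx) z h1 h2)

theorem average_basisVec (hf : Integrable f μ) (hU : Measurable U) (x : GNS d →L[ℂ] GNS d)
    (m : Lattice d) : average μ f U hf hU x (basisVec 0) m =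
      (∫ w, f w * chr (U w) m ∂μ) * x (basisVec 0) m := by
  rw [← inner_basisVec, inner_average, ← integral_mul_const]
  congr 1
  ext1 w
  rw [inner_basisVec, translate_basisVec, mul_assoc]

theorem trace_average_mul (hf : Integrable f μ) (hU : Measurable U) (x b : GNS d →L[ℂ] GNS d) :
    trace (average μ f U hf hU x * b) = ∫ w, f w * trace (translate (U w) x * b) ∂μ :=
  inner_average hf hU x _ _

/-- Minkowski's inequality by duality: pairing with `dualBall` brings the estimate under a scalar
integral, where translations are isometric. All multiplier bounds below stem from this one, hence
their independence of `p` and `θ`. -/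
theorem opLpNorm_average_le (hf : Integrable f μ) (hU : Measurable U) {x : GNS d →L[ℂ] GNS d}
    (hx : x ∈ vN θ) {p : ℝ≥0∞} (hp : 1 ≤ p) :
    opLpNorm p (average μ f U hf hU x) ≤ (∫ w, ‖f w‖ ∂μ) * opLpNorm p x := by
  refine opLpNorm_le hp (average_mem hf hU hx) fun b hb => ?_
  rw [trace_average_mul, ← integral_mul_const]
  refine norm_integral_le_of_norm_le (hf.norm.mul_const _) (Eventually.of_forall fun w => ?_)
  rw [norm_mul]
  gcongr
  rw [← opLpNorm_translate p (U w) x]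
  exact norm_trace_mul_le_of_mem hp (translate_mem _ hx) hb

end Average

/-! ### Schwartz symbols -/

/-- The inclusion of the lattice in the Euclidean space. -/
def latVec (m : Lattice d) : EuclideanSpace ℝ (Fin d) := WithLp.toLp 2 fun i => (m i : ℝ)

theorem latVec_apply (m : Lattice d) (i : Fin d) : latVec m i = (m i : ℝ) := rfl

theorem norm_le_norm_latVec (m : Lattice d) : ‖m‖ ≤ ‖latVec m‖ := by
  refine (pi_norm_le_iff_of_nonneg (norm_nonneg _)).2 fun i => ?_
  have := PiLp.norm_apply_le (latVec m) i
  rwa [latVec_apply, Int.norm_cast_real] at this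

theorem chr_smul_eq (t : ℝ) (v : EuclideanSpace ℝ (Fin d)) (m : Lattice d) :
    chr (t • v) m = Complex.exp (((2 * Real.pi * inner ℝ v (t • latVec m) : ℝ) : ℂ) *
      Complex.I) := by
  rw [chr, PiLp.inner_apply]
  congr 5
  ext j
  simp only [PiLp.smul_apply, latVec_apply, smul_eq_mul, RCLike.inner_apply, conj_trivial]
  ring

-- Fourier inversion exhibits a dilated Schwartz symbol as a superposition of characters, so its
-- multiplier is an average of translations.
open FourierTransform in
theorem schwartz_eq_integral (ψ : 𝓢(EuclideanSpace ℝ (Fin d), ℂ)) (t : ℝ) (m : Lattice d) :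
    ψ (t • latVec m) = ∫ v, (𝓕 ψ) v * chr (t • v) m := by
  have h : ψ = 𝓕⁻ (𝓕 ψ) := (FourierTransform.fourierInv_fourier_eq ψ).symm
  conv_lhs => rw [h, SchwartzMap.fourierInv_coe, Real.fourierInv_eq']
  congr 1
  ext1 v
  rw [chr_smul_eq, smul_eq_mul, mul_comm]

theorem schwartz_mem_test (ψ : 𝓢(EuclideanSpace ℝ (Fin d), ℂ)) {t : ℝ} (ht : 0 < t) :
    (fun m => ψ (t • latVec m)) ∈ Test d := by
  intro N
  obtain ⟨C, hC, h0⟩ := ψ.decay 0 0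
  obtain ⟨D, hD, hN⟩ := ψ.decay N 0
  refine ⟨2 ^ N * (C + D / t ^ N), fun m => ?_⟩
  have h0 := h0 (t • latVec m)
  have hN := hN (t • latVec m)
  simp only [norm_iteratedFDeriv_zero, pow_zero, one_mul] at h0 hN
  have h1 : ‖m‖ ^ N * ‖ψ (t • latVec m)‖ ≤ D / t ^ N := by
    rw [le_div_iff₀ (by positivity)]
    refine le_trans ?_ hN
    rw [norm_smul, mul_pow, Real.norm_of_nonneg ht.le, mul_right_comm, mul_comm (‖m‖ ^ N)]
    gcongr
    exact norm_le_norm_latVec m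
  have h2 : (1 + ‖m‖) ^ N ≤ 2 ^ N * (1 + ‖m‖ ^ N) := by
    have hm := norm_nonneg m
    rcases le_total ‖m‖ 1 with h | h
    · calc (1 + ‖m‖) ^ N ≤ 2 ^ N := by gcongr; linarith
        _ ≤ _ := le_mul_of_one_le_right (by positivity) (by linarith [pow_nonneg hm N])
    · calc (1 + ‖m‖) ^ N ≤ (2 * ‖m‖) ^ N := by gcongr; linarith
        _ ≤ _ := by rw [mul_pow]; gcongr; linarith
  calc _ ≤ 2 ^ N * (1 + ‖m‖ ^ N) * ‖ψ (t • latVec m)‖ := by gcongr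
    _ = 2 ^ N * (‖ψ (t • latVec m)‖ + ‖m‖ ^ N * ‖ψ (t • latVec m)‖) := by ring
    _ ≤ _ := by gcongr

/-- A smooth bump function of integral one, supported in the ball of radius `r`. -/
theorem exists_bump (d : ℕ) {r : ℝ} (hr : 0 < r) :
    ∃ g : 𝓢(EuclideanSpace ℝ (Fin d), ℂ), tsupport g ⊆ Metric.closedBall 0 r ∧
      ∫ v, g v = 1 ∧ ∫ v, ‖g v‖ = 1 := by
  let b : ContDiffBump (0 : EuclideanSpace ℝ (Fin d)) := ⟨r / 2, r, by positivity, by linarith⟩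
  let g₀ : EuclideanSpace ℝ (Fin d) → ℂ := fun v => (b.normed volume v : ℂ)
  have hs : HasCompactSupport g₀ :=
    (b.hasCompactSupport_normed (μ := volume)).comp_left Complex.ofReal_zero
  have hc : ContDiff ℝ ((⊤ : ℕ∞) : WithTop ℕ∞) g₀ := Complex.ofRealCLM.contDiff.comp b.contDiff_normed
  refine ⟨hs.toSchwartzMap hc, ?_, ?_, ?_⟩
  · change tsupport g₀ ⊆ _
    refine (closure_mono (Function.support_comp_subset Complex.ofReal_zero _)).trans ?_
    exact (b.tsupport_normed_eq (μ := volume)).subset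
  · change ∫ v, (b.normed volume v : ℂ) = 1
    rw [integral_complex_ofReal, b.integral_normed]
    simp
  · change ∫ v, ‖(b.normed volume v : ℂ)‖ = 1
    rw [← b.integral_normed (μ := volume)]
    congr 1
    ext1 v
    rw [Complex.norm_real, Real.norm_of_nonneg (b.nonneg_normed v)]

/-! ### Density of the test elements in the dual ball -/

theorem star_basisVec {x : GNS d →L[ℂ] GNS d} (hx : x ∈ vN θ) (m : Lattice d) :
    star x (basisVec 0) m = star (phase θ (-m) m * x (basisVec 0) (-m)) := by
  rw [← inner_basisVec]
  change inner ℂ _ (ContinuousLinearMap.adjoint x (basisVec 0)) = _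
  rw [ContinuousLinearMap.adjoint_inner_right, ← inner_conj_symm, inner_basisVec,
    apply_basisVec hx m 0, zero_sub]
  rfl

theorem norm_coeff_le (x : GNS d →L[ℂ] GNS d) (m : Lattice d) : ‖x (basisVec 0) m‖ ≤ ‖x‖ := by
  rw [← inner_basisVec]
  refine (norm_inner_le_norm _ _).trans ?_
  rw [norm_basisVec, one_mul]
  refine (x.le_opNorm _).trans ?_
  rw [norm_basisVec, mul_one]

theorem mul_mem_test {a : Lattice d → ℂ} (ha : a ∈ Test d) {b : Lattice d → ℂ} {B : ℝ}
    (hb : ∀ m, ‖b m‖ ≤ B) : (fun m => a m * b m) ∈ Test d := by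
  intro N
  obtain ⟨C, hC⟩ := ha N
  refine ⟨C * B, fun m => ?_⟩
  rw [norm_mul, ← mul_assoc]
  exact mul_le_mul (hC m) (hb m) (norm_nonneg _)
    ((by positivity : (0 : ℝ) ≤ (1 + ‖m‖) ^ N * ‖a m‖).trans (hC m))

-- Mollification: averaging translations against a bump of mass one stays in the dual ball and
-- multiplies the coefficients by `ψ(t m)`, which makes them rapidly decreasing. As `t → 0` the
-- factor tends to `ψ 0 = 1` and the pairing with `y` converges by dominated convergence.
open FourierTransform in
theorem norm_trace_mul_le_of_test {y b : GNS d →L[ℂ] GNS d} (hy : y ∈ vN θ) {p : ℝ≥0∞}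
    (hb : b ∈ dualBall θ p) {C : ℝ}
    (h : ∀ a : Test d, Test.op θ a ∈ dualBall θ p → ‖trace (y * Test.op θ a)‖ ≤ C) :
    ‖trace (y * b)‖ ≤ C := by
  obtain ⟨g, -, hg1, hg2⟩ := exists_bump d one_pos
  set ψ : 𝓢(EuclideanSpace ℝ (Fin d), ℂ) := 𝓕⁻ g with hψ
  have hgψ : 𝓕 ψ = g := FourierTransform.fourier_fourierInv_eq g
  have hψ0 : ψ 0 = 1 := by
    have := schwartz_eq_integral ψ 0 0
    rw [zero_smul, hgψ] at this
    simpa [hg1] using this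
  obtain ⟨D, hD, hDb⟩ := ψ.decay 0 0
  simp only [norm_iteratedFDeriv_zero, pow_zero, one_mul] at hDb
  have hcoef : ∀ (t : ℝ) (m : Lattice d), ‖star (ψ (t • latVec (-m)))‖ ≤ D := fun t m => by
    rw [norm_star]; exact hDb _
  have key : ∀ t : ℝ, 0 < t → ∃ a : Test d, Test.op θ a ∈ dualBall θ p ∧
      ∀ m, a.1 m = star (ψ (t • latVec (-m))) * b (basisVec 0) m := by
    intro t ht
    have hU : Measurable fun v : EuclideanSpace ℝ (Fin d) => t • v := by fun_prop
    -- The average is taken of `star b` because the dual ball constrains the norm of the adjoint;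
    -- `star z` is then the test element.
    set z := average volume g (fun v => t • v) g.integrable hU (star b) with hz
    have hzm : z ∈ vN θ := average_mem g.integrable hU (star_mem hb.1)
    have hzc : ∀ m, z (basisVec 0) m = ψ (t • latVec m) * star b (basisVec 0) m := by
      intro m
      rw [hz, average_basisVec, schwartz_eq_integral, hgψ]
    have hsz : ∀ m, star z (basisVec 0) m =
        star (ψ (t • latVec (-m))) * b (basisVec 0) m := by
      intro m
      rw [star_basisVec hzm, hzc]
      have := star_basisVec (star_mem hb.1) m
      rw [star_star] at this
      rw [this]
      simp only [star_mul]
      ring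
    have htest : (fun m => star (ψ (t • latVec (-m))) * b (basisVec 0) m) ∈ Test d := by
      refine mul_mem_test (B := ‖b‖) ?_ fun m => norm_coeff_le b m
      intro N
      obtain ⟨C, hC⟩ := schwartz_mem_test ψ ht N
      exact ⟨C, fun m => by simpa using hC (-m)⟩
    refine ⟨⟨_, htest⟩, ?_, fun m => rfl⟩
    have e : Test.op θ ⟨_, htest⟩ = star z := by
      refine ext_vN (Test.op_mem _) (star_mem hzm) ?_
      ext m
      rw [Test.op_basisVec, hsz]
    rw [e]
    refine ⟨star_mem hzm, ?_⟩
    rw [star_star]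
    refine (opLpNorm_average_le g.integrable hU (star_mem hb.1)
      (one_le_conjExponent p)).trans ?_
    rw [hg2, one_mul]
    exact hb.2
  choose! a ha1 ha2 using key
  have hlim : Tendsto (fun n : ℕ => trace (y * Test.op θ (a (1 / ((n : ℝ) + 1))))) atTop
      (𝓝 (trace (y * b))) := by
    have hs := hasSum_trace_mul hy b
    rw [← hs.tsum_eq]
    have hpos : ∀ n : ℕ, (0 : ℝ) < 1 / ((n : ℝ) + 1) := fun n => by positivity
    have he : ∀ n : ℕ, trace (y * Test.op θ (a (1 / ((n : ℝ) + 1)))) =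
        ∑' m, star (ψ ((1 / ((n : ℝ) + 1)) • latVec (-m))) *
          (b (basisVec 0) m * (phase θ (-m) m * y (basisVec 0) (-m))) := by
      intro n
      rw [← (hasSum_trace_mul hy (Test.op θ (a (1 / ((n : ℝ) + 1))))).tsum_eq]
      congr 1
      ext1 m
      rw [Test.op_basisVec, ha2 _ (hpos n), mul_assoc]
    simp only [he]
    refine tendsto_tsum_of_dominated_convergence (hs.summable.norm.mul_left D) (fun m => ?_)
      (Eventually.of_forall fun n m => ?_)
    · have h1 : Tendsto (fun n : ℕ => star (ψ ((1 / ((n : ℝ) + 1)) • latVec (-m)))) atTop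
          (𝓝 1) := by
        have hc : Continuous fun t : ℝ => star (ψ (t • latVec (-m))) := by
          have := ψ.continuous
          fun_prop
        have h2 := (hc.tendsto 0).comp tendsto_one_div_add_atTop_nhds_zero_nat
        rwa [zero_smul, hψ0, star_one] at h2
      have := h1.mul_const (b (basisVec 0) m * (phase θ (-m) m * y (basisVec 0) (-m)))
      rwa [one_mul] at this
    · rw [norm_mul]
      gcongr
      exact hcoef _ _
  exact le_of_tendsto hlim.norm (Eventually.of_forall fun n => h _ (ha1 _ (by positivity)))

end QTorus

namespace QTorus

variable {d : ℕ} {θ : Matrix (Fin d) (Fin d) ℝ} {p : ℝ≥0∞} {F G : Functional d}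

/-! ### `L_p` as a space of functionals -/

/-- The test elements in the dual ball of `L_p`. -/
def testBall (θ : Matrix (Fin d) (Fin d) ℝ) (p : ℝ≥0∞) : Set (Test d) :=
  {a | Test.op θ a ∈ dualBall θ p}

/-- The dual norm of a functional, `∞` if it is unbounded on the dual ball. -/
def dualNorm (θ : Matrix (Fin d) (Fin d) ℝ) (p : ℝ≥0∞) (F : Functional d) : ℝ≥0∞ :=
  ⨆ a ∈ testBall θ p, ‖F a‖ₑ

theorem opLpNorm_le_of_test (hp : 1 ≤ p) {y : GNS d →L[ℂ] GNS d} (hy : y ∈ vN θ) {C : ℝ}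
    (h : ∀ a ∈ testBall θ p, ‖trace (y * Test.op θ a)‖ ≤ C) : opLpNorm p y ≤ C :=
  opLpNorm_le hp hy fun _ hb => norm_trace_mul_le_of_test hy hb h

theorem dualNorm_le {C : ℝ≥0∞} (h : ∀ a ∈ testBall θ p, ‖F a‖ₑ ≤ C) : dualNorm θ p F ≤ C :=
  iSup₂_le h

theorem le_dualNorm {a : Test d} (ha : a ∈ testBall θ p) : ‖F a‖ₑ ≤ dualNorm θ p F :=
  le_iSup₂ (f := fun (a : Test d) (_ : a ∈ testBall θ p) => ‖F a‖ₑ) a ha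

theorem dualNorm_le_ofReal {C : ℝ} (h : ∀ a ∈ testBall θ p, ‖F a‖ ≤ C) :
    dualNorm θ p F ≤ ENNReal.ofReal C :=
  dualNorm_le fun a ha => by
    rw [← ofReal_norm]
    exact ENNReal.ofReal_le_ofReal (h a ha)

theorem mem_testBall_of_norm_le (p : ℝ≥0∞) {a : Test d} (h : ‖Test.op θ a‖ ≤ 1) :
    a ∈ testBall θ p :=
  mem_dualBall_of_norm_le p (Test.op_mem a) h

theorem exists_smul_mem_testBall (θ : Matrix (Fin d) (Fin d) ℝ) (p : ℝ≥0∞) (a : Test d) :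
    ∃ c : ℝ, 0 < c ∧ (c : ℂ) • a ∈ testBall θ p := by
  have h : 0 < 1 + ‖Test.op θ a‖ := by positivity
  refine ⟨(1 + ‖Test.op θ a‖)⁻¹, inv_pos.2 h, mem_testBall_of_norm_le p ?_⟩
  rw [Test.op_smul, norm_smul, Complex.norm_real, norm_inv, Real.norm_of_nonneg h.le,
    inv_mul_le_iff₀ h]
  linarith

theorem Represents.exists_forall_le (hp : 1 ≤ p) {y : ℕ → vN θ} (hy : Represents θ p y F) {δ : ℝ}
    (hδ : 0 < δ) : ∃ N, ∀ n, N ≤ n → ∀ a ∈ testBall θ p,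
      ‖F a - trace ((y n : GNS d →L[ℂ] GNS d) * Test.op θ a)‖ ≤ δ := by
  obtain ⟨N, hN⟩ := hy.1 δ hδ
  refine ⟨N, fun n hn a ha => ?_⟩
  refine le_of_tendsto ((hy.2 a).sub_const _).norm ?_
  filter_upwards [eventually_ge_atTop N] with j hj
  rw [← trace_sub, ← sub_mul]
  exact (norm_trace_mul_le_of_mem hp (sub_mem (y j).2 (y n).2) ha).trans (hN j hj n hn).le

theorem Represents.dualNorm_lt_top (hp : 1 ≤ p) {y : ℕ → vN θ} (hy : Represents θ p y F) :
    dualNorm θ p F < ∞ := by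
  obtain ⟨N, hN⟩ := hy.exists_forall_le hp one_pos
  refine (dualNorm_le_ofReal (C := 1 + opLpNorm p (y N : GNS d →L[ℂ] GNS d))
    fun a ha => ?_).trans_lt ENNReal.ofReal_lt_top
  have h1 := hN N le_rfl a ha
  have h2 := norm_trace_mul_le_of_mem hp (y N).2 ha
  have h3 := norm_add_le (F a - trace ((y N : GNS d →L[ℂ] GNS d) * Test.op θ a))
    (trace ((y N : GNS d →L[ℂ] GNS d) * Test.op θ a))
  rw [sub_add_cancel] at h3
  linarith

/-- Both norms are suprema over `testBall`, on which the functionals of `y n` converge uniformly to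
`F`. The limit is therefore the same for every representing sequence, which settles the infimum in
`lpNorm`. -/
theorem Represents.tendsto_opLpNorm (hp : 1 ≤ p) {y : ℕ → vN θ} (hy : Represents θ p y F) :
    Tendsto (fun n => ENNReal.ofReal (opLpNorm p (y n : GNS d →L[ℂ] GNS d))) atTop
      (𝓝 (dualNorm θ p F)) := by
  have hfin := (hy.dualNorm_lt_top hp).ne
  refine (ENNReal.tendsto_atTop hfin).2 fun ε hε => ?_
  wlog hε' : ε ≠ ∞ generalizing ε
  · obtain ⟨N, hN⟩ := this 1 one_pos ENNReal.one_ne_top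
    rw [not_not.1 hε']
    exact ⟨N, fun n hn => ⟨by simp, by simp⟩⟩
  obtain ⟨N, hN⟩ := hy.exists_forall_le hp (ENNReal.toReal_pos hε.ne' hε')
  refine ⟨N, fun n hn => ⟨?_, ?_⟩⟩
  · rw [tsub_le_iff_right]
    refine dualNorm_le fun a ha => ?_
    have h1 := hN n hn a ha
    have h2 := norm_trace_mul_le_of_mem hp (y n).2 ha
    have h3 := norm_add_le (F a - trace ((y n : GNS d →L[ℂ] GNS d) * Test.op θ a))
      (trace ((y n : GNS d →L[ℂ] GNS d) * Test.op θ a))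
    rw [sub_add_cancel] at h3
    rw [← ofReal_norm, ← ENNReal.ofReal_toReal hε', ← ENNReal.ofReal_add (opLpNorm_nonneg _ _)
      ENNReal.toReal_nonneg]
    exact ENNReal.ofReal_le_ofReal (by linarith)
  · rw [← ENNReal.ofReal_toReal hfin, ← ENNReal.ofReal_toReal hε',
      ← ENNReal.ofReal_add ENNReal.toReal_nonneg ENNReal.toReal_nonneg]
    refine ENNReal.ofReal_le_ofReal (opLpNorm_le_of_test hp (y n).2 fun a ha => ?_)
    have h1 := hN n hn a ha
    have h2 : ‖F a‖ ≤ (dualNorm θ p F).toReal := by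
      rw [← toReal_enorm]
      exact ENNReal.toReal_mono hfin (le_dualNorm ha)
    have h3 := norm_sub_norm_le (trace ((y n : GNS d →L[ℂ] GNS d) * Test.op θ a)) (F a)
    rw [norm_sub_rev] at h3
    linarith

theorem lpNorm_eq_dualNorm (hp : 1 ≤ p) (hF : F ∈ Lp θ p) : lpNorm θ p F = dualNorm θ p F := by
  obtain ⟨y, hy⟩ := hF
  refine le_antisymm (iInf₂_le_of_le y hy (hy.tendsto_opLpNorm hp).limsup_eq.le) ?_
  exact le_iInf₂ fun z hz => (hz.tendsto_opLpNorm hp).limsup_eq.ge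

theorem lpNorm_lt_top (hp : 1 ≤ p) (hF : F ∈ Lp θ p) : lpNorm θ p F < ∞ := by
  rw [lpNorm_eq_dualNorm hp hF]
  obtain ⟨y, hy⟩ := hF
  exact hy.dualNorm_lt_top hp

theorem lpNorm_eq_top (hF : F ∉ Lp θ p) : lpNorm θ p F = ∞ := by
  unfold lpNorm
  simp only [iInf_eq_top]
  exact fun y hy => absurd ⟨y, hy⟩ hF

theorem mem_Lp_of_lpNorm_ne_top (h : lpNorm θ p F ≠ ∞) : F ∈ Lp θ p :=
  not_not.1 fun hF => h (lpNorm_eq_top hF)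

theorem lpNorm_le_of_dualNorm_le (hp : 1 ≤ p) (hF : F ∈ Lp θ p) {C : ℝ≥0∞}
    (h : ∀ a ∈ testBall θ p, ‖F a‖ₑ ≤ C) : lpNorm θ p F ≤ C :=
  (lpNorm_eq_dualNorm hp hF).trans_le (dualNorm_le h)

theorem enorm_apply_le_lpNorm (hp : 1 ≤ p) {a : Test d} (ha : a ∈ testBall θ p) :
    ‖F a‖ₑ ≤ lpNorm θ p F := by
  by_cases hF : F ∈ Lp θ p
  · rw [lpNorm_eq_dualNorm hp hF]
    exact le_dualNorm ha
  · rw [lpNorm_eq_top hF]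
    exact le_top

theorem norm_apply_le_lpNorm (hp : 1 ≤ p) (hF : F ∈ Lp θ p) {a : Test d} (ha : a ∈ testBall θ p) :
    ‖F a‖ ≤ (lpNorm θ p F).toReal := by
  rw [← toReal_enorm]
  exact ENNReal.toReal_mono (lpNorm_lt_top hp hF).ne (enorm_apply_le_lpNorm hp ha)

/-- Membership is turned into uniform approximation on `testBall` by elements of the algebra.
Linearity, closedness and stability under multipliers are all checked in this form. -/
theorem mem_Lp_iff (hp : 1 ≤ p) : F ∈ Lp θ p ↔ ∀ δ : ℝ, 0 < δ → ∃ y ∈ vN θ,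
    ∀ a ∈ testBall θ p, ‖F a - trace (y * Test.op θ a)‖ ≤ δ := by
  constructor
  · rintro ⟨y, hy⟩ δ hδ
    obtain ⟨N, hN⟩ := hy.exists_forall_le hp hδ
    exact ⟨y N, (y N).2, hN N le_rfl⟩
  · intro h
    choose y hy hya using fun n : ℕ => h (1 / ((n : ℝ) + 1)) (by positivity)
    have hlim := tendsto_one_div_add_atTop_nhds_zero_nat (𝕜 := ℝ)
    refine ⟨fun n => ⟨y n, hy n⟩, fun δ hδ => ?_, fun a => ?_⟩
    · obtain ⟨N, hN⟩ := (hlim.eventually_lt_const (show 0 < δ / 4 by positivity)).exists_forall_of_atTop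
      refine ⟨N, fun i hi j hj => ?_⟩
      refine (opLpNorm_le_of_test (C := δ / 2) hp (sub_mem (hy i) (hy j)) fun a ha => ?_).trans_lt
        (half_lt_self hδ)
      rw [sub_mul, trace_sub]
      have h3 := norm_sub_le (F a - trace (y j * Test.op θ a)) (F a - trace (y i * Test.op θ a))
      rw [sub_sub_sub_cancel_left] at h3
      linarith [hN i hi, hN j hj, hya i a ha, hya j a ha]
    -- Uniform convergence on the ball gives convergence at every test element, since each one has a
    -- positive multiple in the ball.
    · obtain ⟨c, hc, hca⟩ := exists_smul_mem_testBall θ p a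
      rw [tendsto_iff_norm_sub_tendsto_zero]
      refine squeeze_zero (g := fun n : ℕ => c⁻¹ * (1 / ((n : ℝ) + 1))) (fun _ => norm_nonneg _)
        (fun n => ?_) (by simpa using hlim.const_mul c⁻¹)
      have := hya n _ hca
      rw [map_smul, Test.op_smul, mul_smul_comm, trace_smul, smul_eq_mul, ← mul_sub, norm_mul,
        Complex.norm_real, Real.norm_of_nonneg hc.le, norm_sub_rev] at this
      rwa [le_inv_mul_iff₀ hc]

/-- `L_p` is closed for the dual norm. -/
theorem mem_Lp_of_forall_exists (hp : 1 ≤ p) (h : ∀ δ : ℝ, 0 < δ → ∃ G ∈ Lp θ p,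
    ∀ a ∈ testBall θ p, ‖F a - G a‖ ≤ δ) : F ∈ Lp θ p := by
  refine (mem_Lp_iff hp).2 fun δ hδ => ?_
  obtain ⟨G, hG, hFG⟩ := h (δ / 2) (by positivity)
  obtain ⟨y, hy, hya⟩ := (mem_Lp_iff hp).1 hG (δ / 2) (by positivity)
  refine ⟨y, hy, fun a ha => ?_⟩
  have := norm_add_le (F a - G a) (G a - trace (y * Test.op θ a))
  rw [sub_add_sub_cancel] at this
  linarith [hFG a ha, hya a ha]

theorem add_mem_Lp (hp : 1 ≤ p) (hF : F ∈ Lp θ p) (hG : G ∈ Lp θ p) : F + G ∈ Lp θ p := by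
  refine (mem_Lp_iff hp).2 fun δ hδ => ?_
  obtain ⟨y, hy, hya⟩ := (mem_Lp_iff hp).1 hF (δ / 2) (by positivity)
  obtain ⟨z, hz, hza⟩ := (mem_Lp_iff hp).1 hG (δ / 2) (by positivity)
  refine ⟨y + z, add_mem hy hz, fun a ha => ?_⟩
  have := norm_add_le (F a - trace (y * Test.op θ a)) (G a - trace (z * Test.op θ a))
  rw [add_mul, trace_add, LinearMap.add_apply, add_sub_add_comm]
  linarith [hya a ha, hza a ha]

theorem smul_mem_Lp (hp : 1 ≤ p) (c : ℂ) (hF : F ∈ Lp θ p) : c • F ∈ Lp θ p := by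
  refine (mem_Lp_iff hp).2 fun δ hδ => ?_
  obtain ⟨y, hy, hya⟩ := (mem_Lp_iff hp).1 hF (δ / (‖c‖ + 1)) (by positivity)
  refine ⟨c • y, smul_mem_vN c hy, fun a ha => ?_⟩
  rw [smul_mul_assoc, trace_smul, LinearMap.smul_apply, smul_eq_mul, ← mul_sub, norm_mul]
  have h := hya a ha
  rw [le_div_iff₀ (by positivity)] at h
  nlinarith [norm_nonneg (F a - trace (y * Test.op θ a))]

theorem zero_mem_Lp (hp : 1 ≤ p) : (0 : Functional d) ∈ Lp θ p :=
  (mem_Lp_iff hp).2 fun δ hδ => ⟨0, zero_mem _, fun a _ => by simp [trace_eq, hδ.le]⟩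

theorem sum_mem_Lp (hp : 1 ≤ p) {ι : Type*} (s : Finset ι) {F : ι → Functional d}
    (h : ∀ i ∈ s, F i ∈ Lp θ p) : ∑ i ∈ s, F i ∈ Lp θ p := by
  classical
  induction s using Finset.induction_on with
  | empty => simpa using zero_mem_Lp hp
  | insert i s hi ih =>
    rw [Finset.sum_insert hi]
    exact add_mem_Lp hp (h i (Finset.mem_insert_self i s))
      (ih fun j hj => h j (Finset.mem_insert_of_mem hj))

theorem lpNorm_add_le (hp : 1 ≤ p) (F G : Functional d) :
    lpNorm θ p (F + G) ≤ lpNorm θ p F + lpNorm θ p G := by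
  by_cases hF : F ∈ Lp θ p
  · by_cases hG : G ∈ Lp θ p
    · refine lpNorm_le_of_dualNorm_le hp (add_mem_Lp hp hF hG) fun a ha => ?_
      rw [LinearMap.add_apply]
      exact (enorm_add_le _ _).trans
        (add_le_add (enorm_apply_le_lpNorm hp ha) (enorm_apply_le_lpNorm hp ha))
    · simp [lpNorm_eq_top hG]
  · simp [lpNorm_eq_top hF]

theorem lpNorm_zero (hp : 1 ≤ p) : lpNorm θ p (0 : Functional d) = 0 :=
  le_antisymm (lpNorm_le_of_dualNorm_le hp (zero_mem_Lp hp) fun a _ => by simp) zero_le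

theorem lpNorm_smul_le (hp : 1 ≤ p) (c : ℂ) (F : Functional d) :
    lpNorm θ p (c • F) ≤ ‖c‖ₑ * lpNorm θ p F := by
  by_cases hF : F ∈ Lp θ p
  · refine lpNorm_le_of_dualNorm_le hp (smul_mem_Lp hp c hF) fun a ha => ?_
    rw [LinearMap.smul_apply, smul_eq_mul, enorm_mul]
    gcongr
    exact enorm_apply_le_lpNorm hp ha
  · rw [lpNorm_eq_top hF]
    by_cases hc : c = 0
    · simp [hc, lpNorm_zero hp]
    · rw [ENNReal.mul_top (by simpa using hc)]
      exact le_top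

theorem lpNorm_sum_le (hp : 1 ≤ p) {ι : Type*} (s : Finset ι) (F : ι → Functional d) :
    lpNorm θ p (∑ i ∈ s, F i) ≤ ∑ i ∈ s, lpNorm θ p (F i) := by
  classical
  induction s using Finset.induction_on with
  | empty => simp [lpNorm_zero hp]
  | insert i s hi ih =>
    rw [Finset.sum_insert hi, Finset.sum_insert hi]
    exact (lpNorm_add_le hp _ _).trans (add_le_add le_rfl ih)

/-- Absolutely convergent series in `L_p`. -/
theorem lpNorm_le_tsum (hp : 1 ≤ p) {F : Functional d} {G : ℕ → Functional d}
    (hG : ∑' j, lpNorm θ p (G j) ≠ ∞) (h : ∀ a, HasSum (fun j => G j a) (F a)) :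
    F ∈ Lp θ p ∧ lpNorm θ p F ≤ ∑' j, lpNorm θ p (G j) := by
  have hj : ∀ j, G j ∈ Lp θ p := fun j => mem_Lp_of_lpNorm_ne_top (ENNReal.ne_top_of_tsum_ne_top hG j)
  have hs : Summable fun j => (lpNorm θ p (G j)).toReal := ENNReal.summable_toReal hG
  have hF : F ∈ Lp θ p := by
    refine mem_Lp_of_forall_exists hp fun δ hδ => ?_
    have ht := (tendsto_sum_nat_add fun j => (lpNorm θ p (G j)).toReal).eventually_lt_const hδ
    obtain ⟨N, hN⟩ := ht.exists
    refine ⟨∑ j ∈ Finset.range N, G j, sum_mem_Lp hp _ fun j _ => hj j, fun a ha => ?_⟩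
    rw [LinearMap.sum_apply]
    have h1 := (hasSum_nat_add_iff' N).2 (h a)
    rw [← h1.tsum_eq]
    refine (tsum_of_norm_bounded ((summable_nat_add_iff N).2 hs).hasSum fun j => ?_).trans hN.le
    exact norm_apply_le_lpNorm hp (hj _) ha
  refine ⟨hF, lpNorm_le_of_dualNorm_le hp hF fun a ha => ?_⟩
  rw [← (h a).tsum_eq]
  refine (enorm_tsum_le_tsum_enorm).trans ?_
  exact ENNReal.tsum_le_tsum fun j => enorm_apply_le_lpNorm hp ha

theorem norm_apply_le (hp : 1 ≤ p) (hF : F ∈ Lp θ p) (a : Test d) :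
    ‖F a‖ ≤ (lpNorm θ p F).toReal * ‖Test.op θ a‖ := by
  obtain ⟨y, hy⟩ := hF
  have hd := hy.tendsto_opLpNorm hp
  rw [← lpNorm_eq_dualNorm hp ⟨y, hy⟩] at hd
  have hd' := (ENNReal.tendsto_toReal (lpNorm_lt_top hp ⟨y, hy⟩).ne).comp hd
  refine le_of_tendsto_of_tendsto (hy.2 a).norm (hd'.mul_const _) (Eventually.of_forall fun n => ?_)
  simp only [Function.comp_apply, ENNReal.toReal_ofReal (opLpNorm_nonneg _ _)]
  exact norm_trace_mul_le_opNorm hp (y n).2 (Test.op_mem a)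

theorem isDistribution_of_mem_Lp (hp : 1 ≤ p) (hF : F ∈ Lp θ p) : IsDistribution θ F := by
  refine ⟨0, (lpNorm θ p F).toReal, fun a => (norm_apply_le hp hF a).trans ?_⟩
  gcongr
  have h : (0 : Fin d → ℕ) ∈ multiIdx d 0 := by
    simp only [multiIdx, Finset.mem_filter, Fintype.mem_piFinset]
    simp
  have h2 : Test.D 0 a = a := by
    ext m
    simp [Test.D, Test.mult, derivSymbol]
  have := Finset.le_sup (f := fun α => ‖Test.op θ (Test.D α a)‖₊) h
  simp only [h2] at this
  exact_mod_cast this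

theorem norm_op_starMon_le (m : Lattice d) : ‖Test.op θ (starMon θ m)‖ ≤ 1 := by
  refine (Test.norm_op_le θ _).trans ?_
  rw [tsum_eq_single (-m)]
  · simp [starMon, norm_phase]
  · intro n hn
    simp [starMon, hn]

theorem enorm_coeff_le (hp : 1 ≤ p) (F : Functional d) (m : Lattice d) :
    ‖coeff θ F m‖ₑ ≤ lpNorm θ p F :=
  enorm_apply_le_lpNorm hp (mem_testBall_of_norm_le p (norm_op_starMon_le m))

/-- The functional `x ↦ c τ(x)`, that is, the scalar `c` of the quantum torus. -/
def scalar (c : ℂ) : Functional d := c • (LinearMap.proj 0 ∘ₗ (Test d).subtype)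

theorem scalar_apply (c : ℂ) (a : Test d) : scalar c a = c * a.1 0 := rfl

theorem scalar_eq_trace (c : ℂ) (a : Test d) :
    scalar c a = trace (c • (1 : GNS d →L[ℂ] GNS d) * Test.op θ a) := by
  rw [smul_mul_assoc, one_mul, trace_smul, trace_eq, Test.op_basisVec, scalar_apply]

theorem scalar_mem_Lp (hp : 1 ≤ p) (c : ℂ) : scalar c ∈ Lp θ p :=
  (mem_Lp_iff hp).2 fun δ hδ => ⟨c • 1, smul_mem_vN c (one_mem _), fun a _ => by
    rw [← scalar_eq_trace, sub_self, norm_zero]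
    exact hδ.le⟩

theorem lpNorm_scalar_le (hp : 1 ≤ p) (c : ℂ) : lpNorm θ p (scalar c) ≤ ‖c‖ₑ := by
  refine lpNorm_le_of_dualNorm_le hp (scalar_mem_Lp hp c) fun a ha => ?_
  rw [scalar_eq_trace (θ := θ), ← ofReal_norm, ← ofReal_norm]
  refine ENNReal.ofReal_le_ofReal ((norm_trace_mul_le_of_mem hp (smul_mem_vN c (one_mem _)) ha).trans
    ((opLpNorm_le_norm hp _).trans ?_))
  rw [norm_smul]
  refine mul_le_of_le_one_right (norm_nonneg _) ?_
  exact ContinuousLinearMap.norm_id_le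

end QTorus

namespace QTorus

open scoped FourierTransform

variable {d : ℕ} {θ : Matrix (Fin d) (Fin d) ℝ} {p : ℝ≥0∞} {F G : Functional d}

/-! ### Fourier series of distributions -/

theorem norm_derivSymbol_le (α : Fin d → ℕ) (m : Lattice d) :
    ‖derivSymbol α m‖ ≤ (2 * Real.pi * (1 + ‖m‖)) ^ ∑ j, α j := by
  unfold derivSymbol
  rw [norm_prod, ← Finset.prod_pow_eq_pow_sum]
  refine Finset.prod_le_prod (fun _ _ => norm_nonneg _) fun j _ => ?_
  rw [norm_pow]
  have h1 : ‖m j‖ ≤ ‖m‖ := norm_le_pi_norm m j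
  have h2 : ‖(2 * Real.pi * Complex.I * (m j : ℂ) : ℂ)‖ = 2 * Real.pi * ‖m j‖ := by
    simp [abs_of_pos Real.pi_pos, Int.norm_eq_abs]
  rw [h2]
  have := Real.pi_pos
  gcongr
  linarith

/-- Operator norms of derivatives are replaced by weighted `ℓ¹` norms of coefficients, a form in
which truncation errors of Fourier series are visibly small. -/
theorem IsDistribution.exists_bound (h : IsDistribution θ F) :
    ∃ (N : ℕ) (C : ℝ), 0 ≤ C ∧ ∀ a : Test d, ‖F a‖ ≤ C * ∑' m, (1 + ‖m‖) ^ N * ‖a.1 m‖ := by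
  obtain ⟨N, C, hC⟩ := h
  have hπ : 1 ≤ 2 * Real.pi := by linarith [Real.pi_gt_three]
  refine ⟨N, |C| * (2 * Real.pi) ^ N, by positivity, fun a => ?_⟩
  refine (hC a).trans ?_
  rw [mul_assoc]
  have hS : 0 ≤ ∑' m, (1 + ‖m‖) ^ N * ‖a.1 m‖ := tsum_nonneg fun m => by positivity
  have key : Test.seminorm θ N a ≤
      Real.toNNReal ((2 * Real.pi) ^ N * ∑' m, (1 + ‖m‖) ^ N * ‖a.1 m‖) := by
    refine Finset.sup_le fun α hα => ?_
    rw [← norm_toNNReal]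
    refine Real.toNNReal_le_toNNReal ?_
    rw [← tsum_mul_left]
    refine (Test.norm_op_le θ _).trans
      ((Test.summable_norm _).tsum_le_tsum (fun m => ?_) ((Test.summable_weight_mul a N).mul_left _))
    change ‖derivSymbol α m * a.1 m‖ ≤ _
    rw [norm_mul, ← mul_assoc, ← mul_pow]
    refine mul_le_mul_of_nonneg_right ((norm_derivSymbol_le α m).trans ?_) (norm_nonneg _)
    refine pow_le_pow_right₀ ?_ (Finset.mem_filter.1 hα).2
    nlinarith [norm_nonneg m]
  have key' : (Test.seminorm θ N a : ℝ) ≤ (2 * Real.pi) ^ N * ∑' m, (1 + ‖m‖) ^ N * ‖a.1 m‖ := by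
    have := NNReal.coe_le_coe.2 key
    rwa [Real.coe_toNNReal _ (by positivity)] at this
  exact mul_le_mul (le_abs_self C) key' (by positivity) (abs_nonneg C)

/-- The monomial `U^m` as a test element. -/
def delta (m : Lattice d) : Test d := ⟨Pi.single m 1, rapid_single m 1⟩

theorem delta_apply (m n : Lattice d) : (delta m).1 n = if n = m then 1 else 0 :=
  Pi.single_apply m 1 n

/-- Truncating `a` to a finite set leaves a remainder whose weighted `ℓ¹` norm is the tail of a
convergent series, and `F` is continuous for that norm. -/
theorem IsDistribution.hasSum (h : IsDistribution θ F) (a : Test d) :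
    HasSum (fun m => a.1 m * F (delta m)) (F a) := by
  classical
  obtain ⟨N, C, hC, hF⟩ := h.exists_bound
  have hw := Test.summable_weight_mul a N
  set T := ∑' m, (1 + ‖m‖) ^ N * ‖a.1 m‖ with hT
  have hlim : Tendsto (fun s : Finset (Lattice d) => C * (T - ∑ m ∈ s, (1 + ‖m‖) ^ N * ‖a.1 m‖))
      atTop (𝓝 0) := by
    have h1 : Tendsto (fun s : Finset (Lattice d) => ∑ m ∈ s, (1 + ‖m‖) ^ N * ‖a.1 m‖) atTop
      (𝓝 T) := hw.hasSum
    simpa using (h1.const_sub T).const_mul C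
  refine tendsto_iff_norm_sub_tendsto_zero.2 (squeeze_zero (fun _ => norm_nonneg _) (fun s => ?_) hlim)
  have e1 : ∑ m ∈ s, a.1 m * F (delta m) - F a = F (∑ m ∈ s, a.1 m • delta m - a) := by
    simp only [map_sub, map_sum, map_smul, smul_eq_mul]
  have e2 : ∀ n, (∑ m ∈ s, a.1 m • delta m - a).1 n = if n ∈ s then 0 else -a.1 n := by
    intro n
    have : (∑ m ∈ s, a.1 m • delta m - a).1 n = ∑ m ∈ s, a.1 m * (delta m).1 n - a.1 n := by
      simp [Finset.sum_apply]
    rw [this]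
    simp only [delta_apply, mul_ite, mul_one, mul_zero]
    rw [Finset.sum_ite_eq]
    split_ifs <;> simp
  have e3 : ∑' n, (1 + ‖n‖) ^ N * ‖(∑ m ∈ s, a.1 m • delta m - a).1 n‖ =
      T - ∑ m ∈ s, (1 + ‖m‖) ^ N * ‖a.1 m‖ := by
    have h1 : HasSum (fun n => if n ∈ s then (1 + ‖n‖) ^ N * ‖a.1 n‖ else 0)
        (∑ m ∈ s, (1 + ‖m‖) ^ N * ‖a.1 m‖) := by
      rw [← Finset.sum_congr rfl fun n hn => if_pos hn]
      exact hasSum_sum_of_ne_finset_zero fun n hn => if_neg hn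
    rw [← (hw.hasSum.sub h1).tsum_eq]
    refine tsum_congr fun n => ?_
    rw [e2]
    split_ifs <;> simp
  rw [e1]
  refine (hF _).trans (le_of_eq ?_)
  rw [e3]

theorem IsDistribution.summable (h : IsDistribution θ F) (a : Test d) :
    Summable fun m => ‖a.1 m * F (delta m)‖ :=
  (h.hasSum a).summable.norm

theorem IsDistribution.hasSum_mult (h : IsDistribution θ F) {φ : Lattice d → ℂ}
    (hφ : SlowGrowth φ) (a : Test d) :
    HasSum (fun m => φ (-m) * (a.1 m * F (delta m))) (mult φ hφ F a) :=
  (h.hasSum (Test.mult _ hφ.neg a)).congr_fun fun m => by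
    change _ = φ (-m) * a.1 m * F (delta m)
    ring

/-! ### The algebra of Fourier multipliers -/

theorem SlowGrowth.of_bounded {φ : Lattice d → ℂ} {B : ℝ} (h : ∀ m, ‖φ m‖ ≤ B) : SlowGrowth φ :=
  ⟨0, B, by simpa using h⟩

theorem SlowGrowth.mul {φ ψ : Lattice d → ℂ} (hφ : SlowGrowth φ) (hψ : SlowGrowth ψ) :
    SlowGrowth (φ * ψ) := by
  obtain ⟨N, C, h⟩ := hφ
  obtain ⟨M, D, h'⟩ := hψ
  refine ⟨N + M, C * D, fun m => ?_⟩
  rw [Pi.mul_apply, norm_mul, pow_add, mul_mul_mul_comm]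
  exact mul_le_mul (h m) (h' m) (norm_nonneg _) ((norm_nonneg _).trans (h m))

theorem SlowGrowth.add {φ ψ : Lattice d → ℂ} (hφ : SlowGrowth φ) (hψ : SlowGrowth ψ) :
    SlowGrowth (φ + ψ) := by
  obtain ⟨N, C, h⟩ := hφ
  obtain ⟨M, D, h'⟩ := hψ
  refine ⟨N + M, |C| + |D|, fun m => ?_⟩
  have h1 : 1 ≤ 1 + ‖m‖ := by linarith [norm_nonneg m]
  have h2 : C * (1 + ‖m‖) ^ N ≤ |C| * (1 + ‖m‖) ^ (N + M) :=
    mul_le_mul (le_abs_self C) (pow_le_pow_right₀ h1 (by omega)) (by positivity) (abs_nonneg C)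
  have h3 : D * (1 + ‖m‖) ^ M ≤ |D| * (1 + ‖m‖) ^ (N + M) :=
    mul_le_mul (le_abs_self D) (pow_le_pow_right₀ h1 (by omega)) (by positivity) (abs_nonneg D)
  rw [add_mul]
  exact (norm_add_le _ _).trans (add_le_add ((h m).trans h2) ((h' m).trans h3))

theorem SlowGrowth.const (c : ℂ) : SlowGrowth fun _ : Lattice d => c := .of_bounded fun _ => le_rfl

theorem SlowGrowth.pow {φ : Lattice d → ℂ} (hφ : SlowGrowth φ) (n : ℕ) : SlowGrowth (φ ^ n) := by
  induction n with
  | zero => exact SlowGrowth.const (d := d) 1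
  | succ n ih => rw [pow_succ]; exact ih.mul hφ

theorem SlowGrowth.sum {ι : Type*} (s : Finset ι) {φ : ι → Lattice d → ℂ}
    (h : ∀ i ∈ s, SlowGrowth (φ i)) : SlowGrowth (∑ i ∈ s, φ i) := by
  classical
  induction s using Finset.induction_on with
  | empty => exact SlowGrowth.const (d := d) 0
  | insert i s hi ih =>
    rw [Finset.sum_insert hi]
    exact (h i (Finset.mem_insert_self i s)).add (ih fun j hj => h j (Finset.mem_insert_of_mem hj))

theorem mult_apply {φ : Lattice d → ℂ} (hφ : SlowGrowth φ) (F : Functional d) (a : Test d) :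
    mult φ hφ F a = F (Test.mult (fun m => φ (-m)) hφ.neg a) := rfl

theorem mult_congr {φ ψ : Lattice d → ℂ} (h : φ = ψ) (hφ : SlowGrowth φ) (hψ : SlowGrowth ψ)
    (F : Functional d) : mult φ hφ F = mult ψ hψ F := by
  subst h
  rfl

theorem mult_add {φ : Lattice d → ℂ} (hφ : SlowGrowth φ) (F G : Functional d) :
    mult φ hφ (F + G) = mult φ hφ F + mult φ hφ G := rfl

theorem mult_smul {φ : Lattice d → ℂ} (hφ : SlowGrowth φ) (c : ℂ) (F : Functional d) :
    mult φ hφ (c • F) = c • mult φ hφ F := rfl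

theorem mult_sum {ι : Type*} (s : Finset ι) {φ : Lattice d → ℂ} (hφ : SlowGrowth φ)
    (F : ι → Functional d) : mult φ hφ (∑ i ∈ s, F i) = ∑ i ∈ s, mult φ hφ (F i) := by
  ext a
  simp [mult_apply, LinearMap.sum_apply]

theorem add_mult {φ ψ : Lattice d → ℂ} (hφ : SlowGrowth φ) (hψ : SlowGrowth ψ) (F : Functional d) :
    mult (φ + ψ) (hφ.add hψ) F = mult φ hφ F + mult ψ hψ F := by
  ext a
  rw [LinearMap.add_apply, mult_apply, mult_apply, mult_apply, ← map_add]
  congr 1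
  ext m
  exact add_mul _ _ _

theorem sum_mult {ι : Type*} (s : Finset ι) {φ : ι → Lattice d → ℂ}
    (h : ∀ i, SlowGrowth (φ i)) (F : Functional d) :
    mult (∑ i ∈ s, φ i) (SlowGrowth.sum s fun i _ => h i) F = ∑ i ∈ s, mult (φ i) (h i) F := by
  classical
  ext a
  rw [LinearMap.sum_apply]
  simp only [mult_apply]
  rw [← map_sum]
  congr 1
  ext m
  change (∑ i ∈ s, φ i) (-m) * a.1 m = _
  simp [Finset.sum_apply, Finset.sum_mul, Test.mult]

theorem mult_mult {φ ψ : Lattice d → ℂ} (hφ : SlowGrowth φ) (hψ : SlowGrowth ψ) (F : Functional d) :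
    mult φ hφ (mult ψ hψ F) = mult (φ * ψ) (hφ.mul hψ) F := by
  ext a
  rw [mult_apply, mult_apply, mult_apply]
  congr 1
  ext m
  change ψ (-m) * (φ (-m) * a.1 m) = φ (-m) * ψ (-m) * a.1 m
  ring

theorem mult_const (c : ℂ) (F : Functional d) : mult _ (SlowGrowth.const c) F = c • F := by
  ext a
  rw [mult_apply, LinearMap.smul_apply, ← map_smul]
  rfl

theorem mult_one (h : SlowGrowth (1 : Lattice d → ℂ)) (F : Functional d) : mult 1 h F = F := by
  have := mult_const 1 F
  rwa [one_smul] at this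

theorem derivSymbol_neg (α : Fin d → ℕ) (m : Lattice d) :
    derivSymbol α (-m) = (-1) ^ (∑ j, α j) * derivSymbol α m := by
  unfold derivSymbol
  rw [← Finset.prod_pow_eq_pow_sum, ← Finset.prod_mul_distrib]
  refine Finset.prod_congr rfl fun j _ => ?_
  rw [← mul_pow]
  congr 1
  simp

theorem D_eq_mult (α : Fin d → ℕ) (F : Functional d) :
    D α F = mult (derivSymbol α) (slowGrowth_deriv α) F := by
  ext a
  rw [mult_apply]
  change (-1) ^ (∑ j, α j) * F (Test.D α a) = _
  rw [← smul_eq_mul, ← map_smul]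
  congr 1
  ext m
  change (-1) ^ (∑ j, α j) * (derivSymbol α m * a.1 m) = derivSymbol α (-m) * a.1 m
  rw [derivSymbol_neg, mul_assoc]

theorem diff_iterate (u : EuclideanSpace ℝ (Fin d)) (k : ℕ) (F : Functional d) :
    (diff u)^[k] F = mult (diffSymbol u ^ k) ((slowGrowth_diff u).pow k) F := by
  induction k with
  | zero => exact (mult_one _ F).symm
  | succ k ih =>
    rw [Function.iterate_succ_apply', ih, diff, mult_mult]
    exact mult_congr (pow_succ' _ _).symm _ _ _

/-! ### Bounded Fourier multipliers -/

/-- The Fourier multiplier with symbol `φ` is bounded by `C` on all spaces `L_p`. -/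
def MulBound (φ : Lattice d → ℂ) (C : ℝ≥0∞) : Prop :=
  ∃ h : SlowGrowth φ, ∀ (θ : Matrix (Fin d) (Fin d) ℝ) (p : ℝ≥0∞), 1 ≤ p → ∀ F ∈ Lp θ p,
    mult φ h F ∈ Lp θ p ∧ lpNorm θ p (mult φ h F) ≤ C * lpNorm θ p F

theorem MulBound.mem {φ : Lattice d → ℂ} {C : ℝ≥0∞} (h : MulBound φ C) (h' : SlowGrowth φ)
    (hp : 1 ≤ p) (hF : F ∈ Lp θ p) : mult φ h' F ∈ Lp θ p :=
  (h.2 θ p hp F hF).1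

theorem MulBound.lpNorm_le {φ : Lattice d → ℂ} {C : ℝ≥0∞} (h : MulBound φ C) (h' : SlowGrowth φ)
    (hp : 1 ≤ p) (hF : F ∈ Lp θ p) : lpNorm θ p (mult φ h' F) ≤ C * lpNorm θ p F :=
  (h.2 θ p hp F hF).2

theorem MulBound.mono {φ : Lattice d → ℂ} {C C' : ℝ≥0∞} (h : MulBound φ C) (hC : C ≤ C') :
    MulBound φ C' :=
  ⟨h.1, fun θ p hp F hF => ⟨h.mem _ hp hF, (h.lpNorm_le _ hp hF).trans (by gcongr)⟩⟩

theorem MulBound.mul {φ ψ : Lattice d → ℂ} {C C' : ℝ≥0∞} (h : MulBound φ C) (h' : MulBound ψ C') :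
    MulBound (φ * ψ) (C * C') := by
  refine ⟨h.1.mul h'.1, fun θ p hp F hF => ?_⟩
  rw [← mult_mult h.1 h'.1]
  have h1 := h'.mem h'.1 hp hF
  refine ⟨h.mem _ hp h1, (h.lpNorm_le _ hp h1).trans ?_⟩
  rw [mul_assoc]
  gcongr
  exact h'.lpNorm_le _ hp hF

theorem MulBound.add {φ ψ : Lattice d → ℂ} {C C' : ℝ≥0∞} (h : MulBound φ C) (h' : MulBound ψ C') :
    MulBound (φ + ψ) (C + C') := by
  refine ⟨h.1.add h'.1, fun θ p hp F hF => ?_⟩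
  rw [add_mult h.1 h'.1, add_mul]
  exact ⟨add_mem_Lp hp (h.mem _ hp hF) (h'.mem _ hp hF), (lpNorm_add_le hp _ _).trans
    (add_le_add (h.lpNorm_le _ hp hF) (h'.lpNorm_le _ hp hF))⟩

theorem MulBound.const (c : ℂ) : MulBound (fun _ : Lattice d => c) ‖c‖ₑ := by
  refine ⟨SlowGrowth.const c, fun θ p hp F hF => ?_⟩
  rw [mult_const]
  exact ⟨smul_mem_Lp hp c hF, lpNorm_smul_le hp c F⟩

theorem MulBound.one : MulBound (1 : Lattice d → ℂ) 1 :=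
  (MulBound.const (d := d) 1).mono (by simp)

theorem MulBound.smul {φ : Lattice d → ℂ} {C : ℝ≥0∞} (c : ℂ) (h : MulBound φ C) :
    MulBound (c • φ) (‖c‖ₑ * C) :=
  (MulBound.const c).mul h

theorem MulBound.pow {φ : Lattice d → ℂ} {C : ℝ≥0∞} (h : MulBound φ C) (n : ℕ) :
    MulBound (φ ^ n) (C ^ n) := by
  induction n with
  | zero => simpa using MulBound.one
  | succ n ih =>
    rw [pow_succ, pow_succ]
    exact ih.mul h

theorem MulBound.sum {ι : Type*} (s : Finset ι) {φ : ι → Lattice d → ℂ} {C : ι → ℝ≥0∞}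
    (h : ∀ i ∈ s, MulBound (φ i) (C i)) : MulBound (∑ i ∈ s, φ i) (∑ i ∈ s, C i) := by
  classical
  induction s using Finset.induction_on with
  | empty => exact (MulBound.const (d := d) 0).mono (by simp)
  | insert i s hi ih =>
    rw [Finset.sum_insert hi, Finset.sum_insert hi]
    exact (h i (Finset.mem_insert_self i s)).add (ih fun j hj => h j (Finset.mem_insert_of_mem hj))

section Average

variable {Ω : Type*} [MeasurableSpace Ω] {μ : Measure Ω} {f : Ω → ℂ}
  {U : Ω → EuclideanSpace ℝ (Fin d)}

theorem slowGrowth_integral (f : Ω → ℂ) (U : Ω → EuclideanSpace ℝ (Fin d)) :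
    SlowGrowth fun m => ∫ w, f w * chr (U w) m ∂μ :=
  .of_bounded (B := ∫ w, ‖f w‖ ∂μ) fun m => (norm_integral_le_integral_norm _).trans_eq
    (by simp only [norm_mul, norm_chr, _root_.mul_one])

/-- The transposed multiplier has symbol `φ(-m)`, which on characters means replacing `U` by `-U`;
so it is again an average. -/
theorem op_mult_integral (hf : Integrable f μ) (hU : Measurable U) (a : Test d) :
    Test.op θ (Test.mult _ (slowGrowth_integral (μ := μ) f U).neg a) =
      average μ f (fun w => -U w) hf hU.neg (Test.op θ a) := by
  refine ext_vN (Test.op_mem _) (average_mem hf _ (Test.op_mem a)) ?_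
  ext m
  rw [Test.op_basisVec, average_basisVec, Test.op_basisVec]
  change (∫ w, f w * chr (U w) (-m) ∂μ) * a.1 m = _
  congr 2
  ext1 w
  congr 1
  rw [chr, chr]
  congr 5
  ext j
  simp

theorem integrable_star (hf : Integrable f μ) : Integrable (fun w => star (f w)) μ :=
  Complex.conjCLE.toContinuousLinearMap.integrable_comp hf

theorem star_average (hf : Integrable f μ) (hU : Measurable U) {x : GNS d →L[ℂ] GNS d}
    (hx : x ∈ vN θ) : star (average μ f U hf hU x) =
      average μ (fun w => star (f w)) U (integrable_star hf) hU (star x) := by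
  refine ext_vN (star_mem (average_mem hf hU hx)) (average_mem _ hU (star_mem hx)) ?_
  ext m
  rw [star_basisVec (average_mem hf hU hx), average_basisVec, average_basisVec,
    star_basisVec hx, mul_left_comm, star_mul,
    show star (∫ w, f w * chr (U w) (-m) ∂μ) = ∫ w, star (f w) * chr (U w) m ∂μ from ?_]
  · exact mul_comm _ _
  · refine (integral_conj (f := fun w => f w * chr (U w) (-m))).symm.trans ?_
    congr 1
    ext1 w
    rw [map_mul]
    congr 1
    have h2 : chr (U w) (-m) = chr (-U w) m := by
      rw [chr, chr]
      congr 5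
      ext j
      simp
    rw [h2, chr_neg]
    exact star_star _

/-- The transposed average maps `testBall` into `∫ ‖f‖` times itself, which bounds the dual norm of
the image (`key`). Applied to `F` minus the functional of an approximant `y`, the same bound shows
that the averaged `y` approximates the image, hence membership in `L_p`. -/
theorem MulBound.integral (hf : Integrable f μ) (hU : Measurable U) :
    MulBound (fun m => ∫ w, f w * chr (U w) m ∂μ) (ENNReal.ofReal (∫ w, ‖f w‖ ∂μ)) := by
  set I := ∫ w, ‖f w‖ ∂μ with hI
  have hI0 : 0 ≤ I := integral_nonneg fun w => norm_nonneg _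
  refine ⟨slowGrowth_integral f U, fun θ p hp F hF => ?_⟩
  have key : ∀ (H : Functional d) (C : ℝ), (∀ b ∈ testBall θ p, ‖H b‖ ≤ C) →
      ∀ a ∈ testBall θ p, ‖mult _ (slowGrowth_integral (μ := μ) f U) H a‖ ≤ I * C := by
    intro H C hH a ha
    have hI1 : 0 < I ∨ I = 0 := hI0.lt_or_eq.imp id Eq.symm
    -- The rescaling divides by `c`; `I` itself could be zero, so it is approached from above.
    have hs : ∀ c : ℝ, 0 < c → I ≤ c →
        ‖mult _ (slowGrowth_integral (μ := μ) f U) H a‖ ≤ c * C := by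
      intro c hc hIc
      set b := Test.mult _ (slowGrowth_integral (μ := μ) f U).neg a with hb
      have hb1 : ((c⁻¹ : ℝ) : ℂ) • b ∈ testBall θ p := by
        refine ⟨Test.op_mem _, ?_⟩
        rw [Test.op_smul, star_smul, opLpNorm_smul (one_le_conjExponent p), hb,
          op_mult_integral hf hU, star_average hf _ (Test.op_mem a), norm_star, Complex.norm_real,
          norm_inv, Real.norm_of_nonneg hc.le, inv_mul_le_iff₀ hc]
        refine (opLpNorm_average_le _ _ (star_mem (Test.op_mem a)) (one_le_conjExponent p)).trans ?_
        simp only [norm_star]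
        exact mul_le_mul hIc ha.2 (opLpNorm_nonneg _ _) hc.le
      have := hH _ hb1
      rw [map_smul, norm_smul, Complex.norm_real, norm_inv, Real.norm_of_nonneg hc.le,
        inv_mul_le_iff₀ hc] at this
      exact this
    refine le_of_forall_pos_le_add fun ε hε => ?_
    have hC : 0 ≤ C := (norm_nonneg _).trans (hH a ha)
    refine (hs (I + ε / (C + 1)) (by positivity) (by linarith [show 0 < ε / (C + 1) by positivity])).trans ?_
    rw [add_mul]
    gcongr
    rw [div_mul_eq_mul_div, div_le_iff₀ (by positivity)]
    nlinarith
  have hmem : mult _ (slowGrowth_integral (μ := μ) f U) F ∈ Lp θ p := by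
    refine (mem_Lp_iff hp).2 fun δ hδ => ?_
    obtain ⟨y, hy, hya⟩ := (mem_Lp_iff hp).1 hF (δ / (I + 1)) (by positivity)
    refine ⟨average μ f U hf hU y, average_mem hf hU hy, fun a ha => ?_⟩
    let Y : Functional d :=
      { toFun := fun a => trace (y * Test.op θ a)
        map_add' := fun a b => by rw [Test.op_add, mul_add, trace_add]
        map_smul' := fun c a => by rw [Test.op_smul, mul_smul_comm, trace_smul]; rfl }
    have h1 := key (F - Y) _ hya a ha
    have h2 : mult _ (slowGrowth_integral (μ := μ) f U) Y a =
        trace (average μ f U hf hU y * Test.op θ a) := by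
      refine ((hasSum_trace_mul hy _).unique
        ((hasSum_trace_mul (average_mem hf hU hy) (Test.op θ a)).congr_fun fun m => ?_))
      rw [Test.op_basisVec, Test.op_basisVec, average_basisVec]
      change (∫ w, f w * chr (U w) (-m) ∂μ) * a.1 m * _ = _
      ring
    rw [← h2]
    refine h1.trans ?_
    rw [mul_div_assoc', div_le_iff₀ (by positivity)]
    nlinarith
  refine ⟨hmem, lpNorm_le_of_dualNorm_le hp hmem fun a ha => ?_⟩
  have h3 := key F _ (fun b hb => norm_apply_le_lpNorm hp hF hb) a ha
  rw [← ofReal_norm, ← ENNReal.ofReal_toReal (lpNorm_lt_top hp hF).ne, ← ENNReal.ofReal_mul hI0]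
  exact ENNReal.ofReal_le_ofReal h3

/-- Minkowski's inequality for an integral of Fourier multipliers. -/
theorem norm_mult_integral_le (hF : IsDistribution θ F) (hf : Integrable f μ)
    {ψ : Ω → Lattice d → ℂ} (hψm : ∀ m, AEStronglyMeasurable (fun w => ψ w m) μ) {B : ℝ}
    (hB : ∀ w m, ‖ψ w m‖ ≤ B) {φ : Lattice d → ℂ} (hφ : SlowGrowth φ)
    (h : ∀ m, φ m = ∫ w, f w * ψ w m ∂μ) (a : Test d) {C : ℝ}
    (hC : ∀ w, f w ≠ 0 → ‖mult (ψ w) (.of_bounded (hB w)) F a‖ ≤ C) :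
    ‖mult φ hφ F a‖ ≤ (∫ w, ‖f w‖ ∂μ) * C := by
  set g : Lattice d → Ω → ℂ := fun m w => f w * (ψ w (-m) * (a.1 m * F (delta m))) with hg
  have hbd : ∀ m w, ‖g m w‖ ≤ ‖f w‖ * (B * ‖a.1 m * F (delta m)‖) := fun m w => by
    rw [hg]
    simp only
    rw [norm_mul, norm_mul]
    have := hB w (-m)
    gcongr
  have hint : ∀ m, Integrable (g m) μ := fun m => by
    refine (hf.norm.mul_const (B * ‖a.1 m * F (delta m)‖)).mono'
      (hf.aestronglyMeasurable.mul ((hψm (-m)).mul_const _)) (Eventually.of_forall (hbd m))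
  have hsum := hF.summable a
  have hs2 : Summable fun m => ∫ w, ‖g m w‖ ∂μ := by
    refine Summable.of_nonneg_of_le (fun m => integral_nonneg fun w => norm_nonneg _) (fun m => ?_)
      ((hsum.mul_left B).mul_left (∫ w, ‖f w‖ ∂μ))
    rw [← integral_mul_const]
    exact integral_mono (hint m).norm (hf.norm.mul_const _) (hbd m)
  -- Sum and integral are exchanged on the Fourier side, where only scalar functions of `w` occur.
  have h1 := hasSum_integral_of_summable_integral_norm hint hs2
  have h2 : ∀ m, ∫ w, g m w ∂μ = φ (-m) * (a.1 m * F (delta m)) := fun m => by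
    rw [h, ← integral_mul_const]
    congr 1
    ext1 w
    rw [hg]
    ring
  simp only [h2] at h1
  rw [(hF.hasSum_mult hφ a).unique h1, ← integral_mul_const]
  refine norm_integral_le_of_norm_le (hf.norm.mul_const C) (Eventually.of_forall fun w => ?_)
  rw [hg]
  simp only
  rw [tsum_mul_left, norm_mul]
  by_cases hw : f w = 0
  · simp [hw]
  · rw [(hF.hasSum_mult (.of_bounded (hB w)) a).tsum_eq]
    have := hC w hw
    gcongr

end Average

theorem MulBound.chr (u : EuclideanSpace ℝ (Fin d)) : MulBound (chr u) 1 := by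
  have h := MulBound.integral (μ := Measure.dirac (0 : ℝ)) (f := fun _ => 1) (U := fun _ => u)
    (integrable_const _) measurable_const
  simpa using h

theorem diffSymbol_eq (u : EuclideanSpace ℝ (Fin d)) : diffSymbol u = QTorus.chr u + fun _ => -1 := by
  ext m
  exact sub_eq_add_neg _ _

theorem MulBound.diffSymbol (u : EuclideanSpace ℝ (Fin d)) : MulBound (diffSymbol u) 2 := by
  rw [diffSymbol_eq]
  refine ((MulBound.chr u).add (MulBound.const (-1))).mono (le_of_eq ?_)
  rw [enorm_neg, enorm_one, one_add_one_eq_two]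

theorem MulBound.schwartz (ψ : 𝓢(EuclideanSpace ℝ (Fin d), ℂ)) (t : ℝ) :
    MulBound (fun m => ψ (t • latVec m)) (ENNReal.ofReal (∫ v, ‖(𝓕 ψ) v‖)) := by
  have h := MulBound.integral (μ := volume) (f := fun v => (𝓕 ψ) v) (U := fun v => t • v)
    (𝓕 ψ).integrable
    (by fun_prop)
  simpa only [← schwartz_eq_integral] using h

end QTorus

namespace QTorus

variable {d : ℕ} {θ : Matrix (Fin d) (Fin d) ℝ} {p : ℝ≥0∞} {F G : Functional d}

/-! ### Differences and derivatives -/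

theorem tsum_rpow_le_rpow_tsum {ι : Type*} (a : ι → ℝ≥0∞) {q : ℝ} (hq : 1 ≤ q) :
    ∑' i, a i ^ q ≤ (∑' i, a i) ^ q := by
  have h : ∀ x : ℝ≥0∞, x ^ q = x * x ^ (q - 1) := fun x => by
    conv_lhs => rw [show q = 1 + (q - 1) by ring]
    rw [ENNReal.rpow_add_of_nonneg _ _ zero_le_one (by linarith), ENNReal.rpow_one]
  calc ∑' i, a i ^ q ≤ ∑' i, a i * (∑' i, a i) ^ (q - 1) := by
        refine ENNReal.tsum_le_tsum fun i => ?_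
        rw [h]
        gcongr
        exact ENNReal.le_tsum i
    _ = (∑' i, a i) ^ q := by rw [ENNReal.tsum_mul_right, ← h]

theorem lpNorm_D_le_sobolevNorm (hp : 1 ≤ p) {k : ℕ} {α : Fin d → ℕ} (hα : α ∈ multiIdx d k)
    (F : Functional d) : lpNorm θ p (D α F) ≤ sobolevNorm θ k p F := by
  unfold sobolevNorm
  split_ifs with h
  · exact Finset.le_sup (f := fun α => lpNorm θ p (D α F)) hα
  · have hp0 := toReal_pos_of_one_le hp h
    rw [one_div, ENNReal.le_rpow_inv_iff hp0]
    exact Finset.single_le_sum (f := fun α => lpNorm θ p (D α F) ^ p.toReal)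
      (fun _ _ => zero_le) hα

theorem sobolevNorm_le_sum (hp : 1 ≤ p) (k : ℕ) (F : Functional d) :
    sobolevNorm θ k p F ≤ ∑ α ∈ multiIdx d k, lpNorm θ p (D α F) := by
  unfold sobolevNorm
  split_ifs with h
  · exact Finset.sup_le fun α hα =>
      Finset.single_le_sum (f := fun α => lpNorm θ p (D α F)) (fun _ _ => zero_le) hα
  · have hp1 : 1 ≤ p.toReal := by
      rw [← ENNReal.toReal_one]
      exact ENNReal.toReal_mono h hp
    rw [one_div, ENNReal.rpow_inv_le_iff (by linarith)]
    have := tsum_rpow_le_rpow_tsum (fun α : multiIdx d k => lpNorm θ p (D α.1 F)) hp1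
    rwa [tsum_fintype, tsum_fintype, Finset.sum_coe_sort (multiIdx d k)
      fun α => lpNorm θ p (D α F) ^ p.toReal, Finset.sum_coe_sort (multiIdx d k)
      fun α => lpNorm θ p (D α F)] at this

theorem mem_multiIdx {k : ℕ} {α : Fin d → ℕ} : α ∈ multiIdx d k ↔ ∑ j, α j ≤ k := by
  simp only [multiIdx, Finset.mem_filter, Fintype.mem_piFinset, Finset.mem_range,
    Order.lt_add_one_iff, and_iff_right_iff_imp]
  exact fun h j => (Finset.single_le_sum (fun _ _ => Nat.zero_le _) (Finset.mem_univ j)).trans h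

theorem derivSymbol_add (α β : Fin d → ℕ) (m : Lattice d) :
    derivSymbol (α + β) m = derivSymbol α m * derivSymbol β m := by
  simp only [derivSymbol, Pi.add_apply, pow_add, Finset.prod_mul_distrib]

theorem derivSymbol_single (j : Fin d) (m : Lattice d) :
    derivSymbol (Pi.single j 1) m = 2 * Real.pi * Complex.I * (m j : ℂ) := by
  unfold derivSymbol
  rw [Finset.prod_eq_single j]
  · simp
  · intro i _ hi
    simp [hi]
  · simp

theorem derivSymbol_zero : (derivSymbol 0 : Lattice d → ℂ) = 1 := by
  ext m
  simp [derivSymbol]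

theorem D_zero (F : Functional d) : D 0 F = F := by
  rw [D_eq_mult, mult_congr derivSymbol_zero _ (SlowGrowth.const 1)]
  exact mult_one _ F

theorem D_D (α β : Fin d → ℕ) (F : Functional d) : D α (D β F) = D (α + β) F := by
  rw [D_eq_mult, D_eq_mult, D_eq_mult, mult_mult]
  exact mult_congr (funext fun m => (derivSymbol_add α β m).symm) _ _ _

theorem mul_integral_exp (c : ℂ) :
    c * ∫ s in Ioc (0 : ℝ) 1, Complex.exp (c * s) = Complex.exp c - 1 := by
  by_cases hc : c = 0
  · simp [hc]
  · rw [← intervalIntegral.integral_of_le zero_le_one, integral_exp_mul_complex hc]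
    field_simp
    simp

/-- The symbol of the average of the translations by `s u`, `0 ≤ s ≤ 1`. -/
def avgSymbol (u : EuclideanSpace ℝ (Fin d)) (m : Lattice d) : ℂ :=
  ∫ s in Ioc (0 : ℝ) 1, 1 * chr (s • u) m

theorem MulBound.avgSymbol (u : EuclideanSpace ℝ (Fin d)) : MulBound (avgSymbol u) 1 := by
  have h := MulBound.integral (μ := volume.restrict (Ioc (0 : ℝ) 1)) (f := fun _ => 1)
    (U := fun s : ℝ => s • u) (integrable_const _) (by fun_prop)
  exact h.mono (by simp)

/-- The fundamental theorem of calculus along `s ↦ s u`: `e^c - 1 = c ∫_0^1 e^{cs} ds`, where `c =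
2πi u·m` is the symbol of `u·∇`. -/
theorem diffSymbol_eq_avgSymbol (u : EuclideanSpace ℝ (Fin d)) (m : Lattice d) :
    diffSymbol u m = avgSymbol u m * ∑ j, (u j : ℂ) * derivSymbol (Pi.single j 1) m := by
  set c : ℂ := ((2 * Real.pi * ∑ j, u j * (m j : ℝ) : ℝ) : ℂ) * Complex.I with hc
  have h1 : ∑ j, (u j : ℂ) * derivSymbol (Pi.single j 1) m = c := by
    rw [hc]
    push_cast
    rw [Finset.mul_sum, Finset.sum_mul]
    refine Finset.sum_congr rfl fun j _ => ?_
    rw [derivSymbol_single]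
    ring
  have h2 : avgSymbol u m = ∫ s in Ioc (0 : ℝ) 1, Complex.exp (c * s) := by
    unfold avgSymbol
    congr 1
    ext1 s
    rw [one_mul, chr, hc]
    congr 1
    simp only [PiLp.smul_apply, smul_eq_mul, mul_assoc, ← Finset.mul_sum]
    push_cast
    ring
  rw [h1, h2, mul_comm, mul_integral_exp]
  rfl

theorem prod_derivSymbol_single {k : ℕ} (f : Fin k → Fin d) (m : Lattice d) :
    ∏ i, derivSymbol (Pi.single (f i) 1) m =
      derivSymbol (fun j => (Finset.univ.filter fun i => f i = j).card) m := by
  simp only [derivSymbol_single]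
  rw [← Finset.prod_fiberwise' Finset.univ f fun j => 2 * (Real.pi : ℂ) * Complex.I * (m j : ℂ)]
  simp only [Finset.prod_const]
  rfl

theorem sum_card_fiber {k : ℕ} (f : Fin k → Fin d) :
    ∑ j, (Finset.univ.filter fun i => f i = j).card = k := by
  rw [← Finset.card_eq_sum_card_fiberwise fun _ _ => Finset.mem_univ _]
  simp

/-- `Δ_u^k = A_u^k (u·∇)^k`. -/
theorem diffSymbol_pow (u : EuclideanSpace ℝ (Fin d)) (k : ℕ) :
    diffSymbol u ^ k = avgSymbol u ^ k * ∑ f : Fin k → Fin d, (∏ i, (u (f i) : ℂ)) •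
      derivSymbol (fun j => (Finset.univ.filter fun i => f i = j).card) := by
  ext m
  rw [Pi.pow_apply, diffSymbol_eq_avgSymbol, mul_pow, Fintype.sum_pow, Pi.mul_apply, Pi.pow_apply,
    Finset.sum_apply]
  congr 1
  refine Finset.sum_congr rfl fun f _ => ?_
  rw [Finset.prod_mul_distrib, prod_derivSymbol_single]
  rfl

theorem SlowGrowth.smul {φ : Lattice d → ℂ} (c : ℂ) (h : SlowGrowth φ) : SlowGrowth (c • φ) :=
  (SlowGrowth.const c).mul h

theorem smul_mult {φ : Lattice d → ℂ} (c : ℂ) (h : SlowGrowth φ) (F : Functional d) :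
    mult (c • φ) (h.smul c) F = c • mult φ h F := by
  rw [← mult_const c, mult_mult]
  rfl

/-- The operator `(u·∇)^k` expands over the `d^k` words `f : Fin k → Fin d`; each contributes a
derivative of order `k` with coefficient at most `‖u‖^k`, and the average is contractive. -/
theorem lpNorm_mult_diffSymbol_pow_le (hp : 1 ≤ p) (k : ℕ) (u : EuclideanSpace ℝ (Fin d))
    {M : ℝ≥0∞} (hF : ∀ α : Fin d → ℕ, ∑ j, α j = k → D α F ∈ Lp θ p ∧ lpNorm θ p (D α F) ≤ M) :
    lpNorm θ p (mult (diffSymbol u ^ k) ((slowGrowth_diff u).pow k) F) ≤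
      (d * ‖u‖ₑ) ^ k * M := by
  set α : (Fin k → Fin d) → Fin d → ℕ :=
    fun f j => (Finset.univ.filter fun i => f i = j).card with hα
  have hs : SlowGrowth (∑ f : Fin k → Fin d, (∏ i, (u (f i) : ℂ)) • derivSymbol (α f)) :=
    SlowGrowth.sum _ fun f _ => (slowGrowth_deriv _).smul _
  have e2 : mult _ hs F = ∑ f : Fin k → Fin d, (∏ i, (u (f i) : ℂ)) • D (α f) F := by
    refine (sum_mult Finset.univ
      (fun f : Fin k → Fin d => (slowGrowth_deriv (α f)).smul (∏ i, (u (f i) : ℂ))) F).trans ?_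
    refine Finset.sum_congr rfl fun f _ => ?_
    rw [smul_mult, D_eq_mult]
  have hA := (MulBound.avgSymbol u).pow k
  have e1 : mult (diffSymbol u ^ k) ((slowGrowth_diff u).pow k) F =
      mult _ hA.1 (∑ f : Fin k → Fin d, (∏ i, (u (f i) : ℂ)) • D (α f) F) := by
    rw [← e2, mult_mult]
    exact mult_congr (diffSymbol_pow u k) _ _ _
  have hmem : ∑ f : Fin k → Fin d, (∏ i, (u (f i) : ℂ)) • D (α f) F ∈ Lp θ p :=
    sum_mem_Lp hp _ fun f _ => smul_mem_Lp hp _ (hF (α f) (sum_card_fiber f)).1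
  rw [e1]
  refine (hA.lpNorm_le _ hp hmem).trans ?_
  rw [one_pow, one_mul]
  refine (lpNorm_sum_le hp _ _).trans ?_
  have : ∀ f : Fin k → Fin d, lpNorm θ p ((∏ i, (u (f i) : ℂ)) • D (α f) F) ≤ ‖u‖ₑ ^ k * M := by
    intro f
    refine (lpNorm_smul_le hp _ _).trans (mul_le_mul' ?_ (hF (α f) (sum_card_fiber f)).2)
    rw [← ofReal_norm, ← ofReal_norm, ← ENNReal.ofReal_pow (norm_nonneg _)]
    refine ENNReal.ofReal_le_ofReal ?_
    rw [norm_prod]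
    refine (Finset.prod_le_prod (fun _ _ => norm_nonneg _) (g := fun _ => ‖u‖) fun i _ => ?_).trans
      (by simp)
    rw [Complex.norm_real]
    exact PiLp.norm_apply_le u _
  refine (Finset.sum_le_card_nsmul _ _ _ fun f _ => this f).trans (le_of_eq ?_)
  simp only [Finset.card_univ, Fintype.card_fin, nsmul_eq_mul, Nat.cast_pow,
    Fintype.card_fun]
  ring

/-! ### The lower bound for the K-functional -/

theorem coeff_add (F G : Functional d) (m : Lattice d) :
    coeff θ (F + G) m = coeff θ F m + coeff θ G m := rfl

/-- For each decomposition `x₀ + x₁`, differences cost `2^k` on `x₀` and `d^k ‖u‖^k` on `x₁`, and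
the mean costs `1` because `ε ≤ 1`: these are the three terms of the constant. -/
theorem modulus_le_kFunctional (hp : 1 ≤ p) (k : ℕ) (x : Functional d) {ε : ℝ} (hε : 0 < ε)
    (hε1 : ε ≤ 1) :
    ENNReal.ofReal (ε ^ k) * ‖coeff θ x 0‖ₑ + modulus θ k p x ε ≤
      (1 + 2 ^ k + d ^ k) * kFunctional (Lp θ p) (Sobolev θ k p) (lpNorm θ p) (sobolevNorm θ k p) x
        (ε ^ k) := by
  unfold kFunctional
  rw [ENNReal.mul_iInf_of_ne (by simp) (by finiteness)]
  refine le_iInf fun x₀ => ?_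
  rw [ENNReal.mul_iInf_of_ne (by simp) (by finiteness)]
  refine le_iInf fun x₁ => ?_
  rw [ENNReal.mul_iInf_of_ne (by simp) (by finiteness)]
  refine le_iInf fun ⟨h0, h1, hx⟩ => ?_
  have hεk : ENNReal.ofReal (ε ^ k) ≤ 1 := ENNReal.ofReal_le_one.2 (pow_le_one₀ hε.le hε1)
  set S := sobolevNorm θ k p x₁
  set t := ENNReal.ofReal (ε ^ k)
  have hc : t * ‖coeff θ x 0‖ₑ ≤ 1 * (lpNorm θ p x₀ + t * S) := by
    have h2 : lpNorm θ p x₁ ≤ S := by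
      have := lpNorm_D_le_sobolevNorm (θ := θ) hp (k := k) (α := 0) (mem_multiIdx.2 (by simp)) x₁
      rwa [D_zero] at this
    rw [hx, coeff_add, one_mul]
    calc t * ‖coeff θ x₀ 0 + coeff θ x₁ 0‖ₑ ≤ t * (lpNorm θ p x₀ + S) := by
          gcongr
          exact (enorm_add_le _ _).trans (add_le_add (enorm_coeff_le hp _ _)
            ((enorm_coeff_le hp _ _).trans h2))
      _ ≤ lpNorm θ p x₀ + t * S := by
          rw [mul_add]
          gcongr
          exact mul_le_of_le_one_left' hεk
  have hm : modulus θ k p x ε ≤ 2 ^ k * lpNorm θ p x₀ + d ^ k * (t * S) := by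
    refine iSup₂_le fun u hu => ?_
    rw [diff_iterate, hx, mult_add]
    refine (lpNorm_add_le hp _ _).trans (add_le_add ?_ ?_)
    · exact ((MulBound.diffSymbol u).pow k).lpNorm_le _ hp h0
    · refine (lpNorm_mult_diffSymbol_pow_le hp k u fun α hα =>
        ⟨h1.2 α (mem_multiIdx.2 hα.le), lpNorm_D_le_sobolevNorm hp (mem_multiIdx.2 hα.le) x₁⟩).trans ?_
      rw [mul_pow, mul_assoc]
      gcongr
      rw [← ofReal_norm, ← ENNReal.ofReal_pow (norm_nonneg _)]
      exact ENNReal.ofReal_le_ofReal (pow_le_pow_left₀ (norm_nonneg _) hu.2 k)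
  calc t * ‖coeff θ x 0‖ₑ + modulus θ k p x ε
      ≤ 1 * (lpNorm θ p x₀ + t * S) + (2 ^ k * lpNorm θ p x₀ + d ^ k * (t * S)) := add_le_add hc hm
    _ ≤ 1 * (lpNorm θ p x₀ + t * S) + (2 ^ k * (lpNorm θ p x₀ + t * S) +
          d ^ k * (lpNorm θ p x₀ + t * S)) := by
        gcongr
        · exact le_self_add
        · exact le_add_self
    _ = (1 + 2 ^ k + d ^ k) * (lpNorm θ p x₀ + t * S) := by ring

/-! ### Poincaré's inequality -/

theorem integral_cube_chr (m : Lattice d) :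
    ∫ w : Fin d → ℝ, (1 : ℂ) * chr (WithLp.toLp 2 w) m
      ∂(Measure.pi fun _ => volume.restrict (Ioc (0 : ℝ) 1)) = if m = 0 then 1 else 0 := by
  have h1 : ∀ w : Fin d → ℝ, 1 * chr (WithLp.toLp 2 w) m =
      ∏ j, Complex.exp ((2 * Real.pi * Complex.I * (m j : ℂ)) * (w j : ℂ)) := by
    intro w
    rw [one_mul, chr, ← Complex.exp_sum]
    congr 1
    push_cast
    rw [Finset.mul_sum, Finset.sum_mul]
    refine Finset.sum_congr rfl fun j _ => ?_
    ring
  simp only [h1]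
  rw [integral_fintype_prod_eq_prod (𝕜 := ℂ)
    (f := fun j (s : ℝ) => Complex.exp ((2 * Real.pi * Complex.I * (m j : ℂ)) * (s : ℂ)))]
  split_ifs with hm
  · subst hm
    simp
  · obtain ⟨j, hj⟩ := Function.ne_iff.1 hm
    refine Finset.prod_eq_zero (Finset.mem_univ j) ?_
    have h := mul_integral_exp (2 * Real.pi * Complex.I * (m j : ℂ))
    have h2 : Complex.exp (2 * Real.pi * Complex.I * (m j : ℂ)) = 1 := by
      rw [mul_comm]
      exact Complex.exp_int_mul_two_pi_mul_I (m j)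
    rw [h2, sub_self] at h
    refine (mul_eq_zero.1 h).resolve_left ?_
    have : (m j : ℂ) ≠ 0 := by exact_mod_cast hj
    simp [this, Real.pi_ne_zero]

theorem starMon_zero (θ : Matrix (Fin d) (Fin d) ℝ) : starMon θ 0 = delta 0 := by
  ext m
  simp [starMon, delta]

theorem coeff_zero_eq (θ : Matrix (Fin d) (Fin d) ℝ) (F : Functional d) :
    coeff θ F 0 = F (delta 0) := by
  rw [coeff, starMon_zero]

/-- Averaging the translations over a period cube projects onto the mean, so the mean minus `F` is
the average of `Δ_w F` over the cube. First order differences are bounded by `d ‖w‖ M`, and `‖w‖ ≤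
√d ≤ d` there. -/
theorem lpNorm_le_coeff_add (hp : 1 ≤ p) (hF : F ∈ Lp θ p)
    (hD : ∀ j, D (Pi.single j 1) F ∈ Lp θ p) {M : ℝ≥0∞} (hM : M ≠ ∞)
    (h : ∀ j, lpNorm θ p (D (Pi.single j 1) F) ≤ M) :
    lpNorm θ p F ≤ ‖coeff θ F 0‖ₑ + d * (d * M) := by
  set μ : Measure (Fin d → ℝ) := Measure.pi fun _ => volume.restrict (Ioc (0 : ℝ) 1) with hμ
  have hμ1 : μ.real univ = 1 := by
    rw [measureReal_def, hμ, Measure.pi_univ]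
    simp
  have hFd := isDistribution_of_mem_Lp hp hF
  set Q : Set (Fin d → ℝ) := {w | ∀ j, w j ∈ Ioc (0 : ℝ) 1} with hQ
  have hQm : MeasurableSet Q := by
    rw [hQ, ofPred_forall]
    exact MeasurableSet.iInter fun j => measurableSet_Ioc.preimage (measurable_pi_apply j)
  have hcube : ∀ᵐ w ∂μ, w ∈ Q := by
    rw [hμ, hQ]
    simp only [mem_ofPred_eq]
    rw [ae_all_iff]
    exact fun j => (Measure.quasiMeasurePreserving_eval (μ := fun _ : Fin d =>
      volume.restrict (Ioc (0 : ℝ) 1)) j).ae (ae_restrict_mem measurableSet_Ioc)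
  -- The indicator equals one almost everywhere; it serves to ask for the bound on differences only
  -- at points `w` of the cube.
  have hf : Integrable (Q.indicator fun _ => (1 : ℂ)) μ := (integrable_const _).indicator hQm
  have hfe : Q.indicator (fun _ => (1 : ℂ)) =ᵐ[μ] fun _ => 1 := by
    filter_upwards [hcube] with w hw
    exact indicator_of_mem hw _
  have hfn : ∫ w, ‖Q.indicator (fun _ => (1 : ℂ)) w‖ ∂μ = 1 := by
    rw [integral_congr_ae (g := fun _ => (1 : ℝ)) (by filter_upwards [hfe] with w hw; simp [hw])]
    simp [hμ1]
  set φ : Lattice d → ℂ := fun m => (if m = 0 then 1 else 0) - 1 with hφ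
  have hφs : SlowGrowth φ := .of_bounded (B := 1) fun m => by
    rw [hφ]
    simp only
    split_ifs <;> simp
  have hB : ∀ (w : Fin d → ℝ) (m : Lattice d), ‖diffSymbol (WithLp.toLp 2 w) m‖ ≤ 2 := fun w m => by
    refine (norm_sub_le _ _).trans ?_
    rw [Complex.norm_exp_ofReal_mul_I]
    norm_num
  have hc : ∀ m : Lattice d, Continuous fun w : Fin d → ℝ => chr (WithLp.toLp 2 w) m := fun m =>
    (continuous_chr m).comp (PiLp.continuous_toLp 2 _)
  have hint : ∀ m, φ m = ∫ w, Q.indicator (fun _ => (1 : ℂ)) w * diffSymbol (WithLp.toLp 2 w) m ∂μ := by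
    intro m
    have e1 : ∀ᵐ w ∂μ, Q.indicator (fun _ => (1 : ℂ)) w * diffSymbol (WithLp.toLp 2 w) m =
        1 * chr (WithLp.toLp 2 w) m - 1 := by
      filter_upwards [hfe] with w hw
      rw [hw, one_mul, one_mul]
      rfl
    rw [integral_congr_ae e1, integral_sub, integral_cube_chr]
    · simp [hφ, hμ1]
    · refine (integrable_const (1 : ℝ)).mono' ((hc m).const_mul _ |>.aestronglyMeasurable)
        (Eventually.of_forall fun w => ?_)
      rw [one_mul, norm_chr]
    · exact integrable_const _
  have hnorm : ∀ w ∈ Q, ‖(WithLp.toLp 2 w : EuclideanSpace ℝ (Fin d))‖ ≤ d := by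
    intro w hw
    refine abs_le_of_sq_le_sq' ?_ (Nat.cast_nonneg d) |>.2
    rw [EuclideanSpace.norm_sq_eq]
    calc ∑ i, ‖w i‖ ^ 2 ≤ ∑ _i : Fin d, (1 : ℝ) := by
          refine Finset.sum_le_sum fun i _ => ?_
          rw [Real.norm_of_nonneg (hw i).1.le]
          exact pow_le_one₀ (hw i).1.le (hw i).2
      _ = (d : ℝ) := by simp
      _ ≤ (d : ℝ) ^ 2 := by exact_mod_cast Nat.le_self_pow two_ne_zero d
  refine lpNorm_le_of_dualNorm_le hp hF fun a ha => ?_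
  have hbound := norm_mult_integral_le hFd hf
    (ψ := fun w => diffSymbol (WithLp.toLp 2 w)) (fun m => ((hc m).sub continuous_const).aestronglyMeasurable)
    hB hφs hint a (C := (d * (d * M)).toReal) fun w hw => by
      have hwQ : w ∈ Q := by
        by_contra h
        exact hw (indicator_of_notMem h _)
      have h1 : (diffSymbol (WithLp.toLp 2 w) : Lattice d → ℂ) = diffSymbol (WithLp.toLp 2 w) ^ 1 :=
        (pow_one _).symm
      rw [mult_congr h1 _ ((slowGrowth_diff _).pow 1), ← toReal_enorm]
      refine ENNReal.toReal_mono (by finiteness) ((enorm_apply_le_lpNorm hp ha).trans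
        ((lpNorm_mult_diffSymbol_pow_le hp 1 _ (M := M) fun α hα => ?_).trans ?_))
      · obtain ⟨j, rfl⟩ : ∃ j, α = Pi.single j 1 := by
          obtain ⟨j, hj⟩ : ∃ j, α j ≠ 0 := by
            by_contra! h
            simp [h] at hα
          refine ⟨j, ?_⟩
          have h2 := Finset.add_sum_erase Finset.univ α (Finset.mem_univ j)
          rw [hα] at h2
          have h3 : ∑ i ∈ Finset.univ.erase j, α i = 0 := by omega
          ext i
          by_cases hi : i = j
          · subst hi
            rw [Pi.single_eq_same]
            omega
          · rw [Pi.single_eq_of_ne hi]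
            exact Finset.sum_eq_zero_iff.1 h3 i (by simp [hi])
        exact ⟨hD j, h j⟩
      · rw [pow_one, mul_assoc]
        gcongr
        rw [← ofReal_norm, ← ENNReal.ofReal_natCast]
        exact ENNReal.ofReal_le_ofReal (hnorm w hwQ)
  rw [hfn, one_mul] at hbound
  have e : F a = scalar (coeff θ F 0) a - mult φ hφs F a := by
    have : Test.mult (fun m => φ (-m)) hφs.neg a = a.1 0 • delta 0 - a := by
      ext m
      change φ (-m) * a.1 m = a.1 0 * (delta 0).1 m - a.1 m
      rw [hφ, delta_apply]
      simp only [neg_eq_zero]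
      split_ifs with hm
      · simp [hm]
      · simp
    rw [mult_apply, this, map_sub, map_smul, scalar_apply, coeff_zero_eq, smul_eq_mul]
    ring
  rw [e]
  refine enorm_sub_le.trans (add_le_add ((enorm_apply_le_lpNorm hp ha).trans
    (lpNorm_scalar_le hp _)) ?_)
  rw [← ofReal_norm, ← ENNReal.ofReal_toReal (a := d * (d * M)) (by finiteness)]
  exact ENNReal.ofReal_le_ofReal hbound

theorem coeff_D_zero {α : Fin d → ℕ} (hα : ∑ j, α j ≠ 0) (F : Functional d) :
    coeff θ (D α F) 0 = 0 := by
  rw [D_eq_mult, coeff_mult]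
  have := derivSymbol_neg α (0 : Lattice d)
  obtain ⟨j, -, hj⟩ := Finset.exists_ne_zero_of_sum_ne_zero hα
  have h0 : derivSymbol α (0 : Lattice d) = 0 :=
    Finset.prod_eq_zero (Finset.mem_univ j) (by simp [hj])
  rw [h0, zero_mul]

/-- The Sobolev norm is controlled by the mean and the derivatives of the highest order. -/
theorem sobolevNorm_le (hp : 1 ≤ p) {k : ℕ} (hF : ∀ α : Fin d → ℕ, D α F ∈ Lp θ p) {M : ℝ≥0∞}
    (hM : M ≠ ∞) (h : ∀ α : Fin d → ℕ, ∑ j, α j = k → lpNorm θ p (D α F) ≤ M) :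
    sobolevNorm θ k p F ≤
      (multiIdx d k).card * (1 + d * d) ^ k * (‖coeff θ F 0‖ₑ + M) := by
  set X := ‖coeff θ F 0‖ₑ + M with hX
  have hXt : X ≠ ∞ := by simp [hX, hM]
  have h1 : (1 : ℝ≥0∞) ≤ 1 + d * d := le_self_add
  -- Induction on the number `n` of missing derivatives. Poincaré's inequality is applied to `D α
  -- F`, whose mean vanishes unless `α = 0`.
  have key : ∀ n, ∀ α : Fin d → ℕ, ∑ j, α j + n = k →
      lpNorm θ p (D α F) ≤ (1 + d * d) ^ n * X := by
    intro n
    induction n with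
    | zero =>
      intro α hα
      rw [pow_zero, one_mul]
      exact (h α hα).trans le_add_self
    | succ n ih =>
      intro α hα
      have h2 : ‖coeff θ (D α F) 0‖ₑ ≤ X := by
        by_cases h0 : ∑ j, α j = 0
        · have : α = 0 := by
            ext j
            exact Finset.sum_eq_zero_iff.1 h0 j (Finset.mem_univ j)
          rw [this, D_zero]
          exact le_self_add
        · rw [coeff_D_zero h0, enorm_zero]
          exact zero_le
      have h3 := lpNorm_le_coeff_add hp (hF α) (M := (1 + d * d) ^ n * X)
        (fun j => by rw [D_D]; exact hF _) (by finiteness) fun j => by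
          rw [D_D]
          refine ih _ ?_
          simp only [Pi.add_apply, Finset.sum_add_distrib, Finset.sum_pi_single', Finset.mem_univ,
            if_true]
          omega
      refine h3.trans ?_
      calc ‖coeff θ (D α F) 0‖ₑ + d * (d * ((1 + d * d) ^ n * X))
          ≤ (1 + d * d) ^ n * X + d * (d * ((1 + d * d) ^ n * X)) := by
            gcongr
            exact h2.trans (le_mul_of_one_le_left' (one_le_pow₀ h1))
        _ = (1 + d * d) ^ (n + 1) * X := by ring
  refine (sobolevNorm_le_sum hp k F).trans ?_
  rw [mul_assoc, ← nsmul_eq_mul]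
  refine Finset.sum_le_card_nsmul _ _ _ fun α hα => ?_
  have hα' := mem_multiIdx.1 hα
  refine (key (k - ∑ j, α j) α (by omega)).trans ?_
  gcongr
  exact Nat.sub_le _ _

end QTorus

namespace QTorus

open scoped FourierTransform LineDeriv

variable {d : ℕ} {θ : Matrix (Fin d) (Fin d) ℝ} {p : ℝ≥0∞} {F G : Functional d}

/-! ### Symbols given by smooth kernels -/

/-- The symbol `m ↦ ∫ g(v) e^{2πi t v·m} dv`. -/
def kernelSymbol (g : 𝓢(EuclideanSpace ℝ (Fin d), ℂ)) (t : ℝ) (m : Lattice d) : ℂ :=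
  ∫ v, g v * chr (t • v) m

theorem MulBound.kernelSymbol (g : 𝓢(EuclideanSpace ℝ (Fin d), ℂ)) (t : ℝ) :
    MulBound (kernelSymbol g t) (ENNReal.ofReal (∫ v, ‖g v‖)) :=
  MulBound.integral (μ := volume) (f := fun v => g v) (U := fun v => t • v) g.integrable
    (by fun_prop)

theorem kernelSymbol_eq (g : 𝓢(EuclideanSpace ℝ (Fin d), ℂ)) (t : ℝ) (m : Lattice d) :
    kernelSymbol g t m = (𝓕⁻ g) (t • latVec m) := by
  rw [schwartz_eq_integral, FourierTransform.fourier_fourierInv_eq g]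
  rfl

theorem multiIndex_induction {P : (Fin d → ℕ) → Prop} (h0 : P 0)
    (hs : ∀ α j, P α → P (α + Pi.single j 1)) (α : Fin d → ℕ) : P α := by
  induction h : ∑ j, α j generalizing α with
  | zero =>
    have : α = 0 := by
      ext j
      exact Finset.sum_eq_zero_iff.1 h j (Finset.mem_univ j)
    rwa [this]
  | succ n ih =>
    obtain ⟨j, hj⟩ : ∃ j, α j ≠ 0 := by
      by_contra! h'
      simp [h'] at h
    have hα : α = (α - Pi.single j 1) + Pi.single j 1 := by
      ext i
      by_cases hi : i = j
      · subst hi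
        simp only [Pi.add_apply, Pi.sub_apply, Pi.single_eq_same]
        omega
      · simp [hi]
    rw [hα]
    refine hs _ j (ih _ ?_)
    rw [hα] at h
    simp only [Pi.add_apply, Finset.sum_add_distrib, Finset.sum_pi_single', Finset.mem_univ,
      if_true] at h
    simp only [Pi.sub_apply] at h ⊢
    omega

theorem kernelSymbol_lineDeriv (g : 𝓢(EuclideanSpace ℝ (Fin d), ℂ)) (j : Fin d) (t : ℝ)
    (m : Lattice d) : kernelSymbol (∂_{EuclideanSpace.single j (1 : ℝ)} g) t m =
      -t * derivSymbol (Pi.single j 1) m * kernelSymbol g t m := by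
  rw [kernelSymbol_eq, kernelSymbol_eq, SchwartzMap.fourierInv_lineDerivOp_eq, derivSymbol_single,
    _root_.smul_apply, SchwartzMap.smulLeftCLM_apply_apply (by fun_prop)]
  rw [real_inner_comm, EuclideanSpace.inner_single_left, PiLp.smul_apply, latVec_apply]
  simp
  ring

/-- Integration by parts: `h` is the iterated derivative of `g`. The support must not grow, since it
determines which translations enter the modulus. -/
theorem exists_kernel_deriv (g : 𝓢(EuclideanSpace ℝ (Fin d), ℂ)) (α : Fin d → ℕ) :
    ∃ h : 𝓢(EuclideanSpace ℝ (Fin d), ℂ), tsupport h ⊆ tsupport g ∧ ∀ (t : ℝ) (m : Lattice d),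
      kernelSymbol h t m = (-t) ^ (∑ j, α j) * derivSymbol α m * kernelSymbol g t m := by
  induction α using multiIndex_induction with
  | h0 => exact ⟨g, subset_rfl, fun t m => by simp [derivSymbol_zero]⟩
  | hs α j ih =>
    obtain ⟨h, hs, hh⟩ := ih
    refine ⟨∂_{EuclideanSpace.single j (1 : ℝ)} h,
      (SchwartzMap.tsupport_lineDerivOp_subset _ h).trans hs, fun t m => ?_⟩
    rw [kernelSymbol_lineDeriv, hh, derivSymbol_add]
    simp only [Pi.add_apply, Finset.sum_add_distrib, Finset.sum_pi_single', Finset.mem_univ,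
      if_true, pow_succ]
    ring

/-! ### Binomial identities -/

/-- The coefficients of `(z - 1)^k`. -/
def binomCoeff (k l : ℕ) : ℂ := (-1) ^ (k - l) * (k.choose l : ℂ)

theorem sub_one_pow_eq (z : ℂ) (k : ℕ) :
    (z - 1) ^ k = ∑ l ∈ Finset.range (k + 1), binomCoeff k l * z ^ l := by
  rw [sub_eq_add_neg, add_pow]
  refine Finset.sum_congr rfl fun l _ => ?_
  rw [binomCoeff]
  ring

/-- The left side is the `k`-th forward difference of `x ↦ x^k` at zero. -/
theorem sum_binomCoeff_mul_pow (k : ℕ) :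
    ∑ l ∈ Finset.range (k + 1), binomCoeff k l * (l : ℂ) ^ k = (k.factorial : ℂ) := by
  have h := congrFun (fwdDiff_iter_eq_factorial (R := ℂ) (n := k)) 0
  rw [fwdDiff_iter_eq_sum_shift] at h
  simp only [Pi.natCast_apply, nsmul_eq_mul, mul_one, zero_add, zsmul_eq_mul] at h
  rw [← h]
  refine Finset.sum_congr rfl fun l _ => ?_
  rw [binomCoeff]
  push_cast
  ring

theorem chr_smul_pow (u : EuclideanSpace ℝ (Fin d)) (m : Lattice d) (l : ℕ) :
    chr u m ^ l = chr ((l : ℝ) • u) m := by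
  induction l with
  | zero => simp [chr_zero]
  | succ l ih => rw [pow_succ, ih, ← chr_add, Nat.cast_succ, add_smul, one_smul]

/-! ### Averages of differences -/

/-- The symbol `m ↦ ∫ g(v) (e^{2πi t v·m} - 1)^k dv`. -/
def diffKernel (g : 𝓢(EuclideanSpace ℝ (Fin d), ℂ)) (k : ℕ) (t : ℝ) (m : Lattice d) : ℂ :=
  ∫ v, g v * (diffSymbol (t • v) ^ k) m

theorem diffKernel_eq (g : 𝓢(EuclideanSpace ℝ (Fin d), ℂ)) (k : ℕ) (t : ℝ) (m : Lattice d) :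
    diffKernel g k t m =
      ∑ l ∈ Finset.range (k + 1), binomCoeff k l * kernelSymbol g (l * t) m := by
  have h : ∀ v, g v * (diffSymbol (t • v) ^ k) m = ∑ l ∈ Finset.range (k + 1),
      binomCoeff k l * (g v * chr (((l : ℝ) * t) • v) m) := by
    intro v
    change g v * (chr (t • v) m - 1) ^ k = _
    rw [sub_one_pow_eq, Finset.mul_sum]
    refine Finset.sum_congr rfl fun l _ => ?_
    rw [chr_smul_pow, smul_smul]
    ring
  have hint : ∀ s : ℝ, Integrable fun v => g v * chr (s • v) m := fun s =>
    g.integrable.norm.mono' (g.continuous.mul ((continuous_chr m).comp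
      (continuous_const_smul s))).aestronglyMeasurable
      (Eventually.of_forall fun v => by rw [norm_mul, norm_chr, mul_one])
  unfold diffKernel
  simp only [h]
  rw [integral_finsetSum _ fun l _ => (hint _).const_mul _]
  refine Finset.sum_congr rfl fun l _ => ?_
  rw [integral_const_mul]
  rfl

theorem exists_mulBound_diffKernel (g : 𝓢(EuclideanSpace ℝ (Fin d), ℂ)) (k : ℕ) (t : ℝ) :
    ∃ C, MulBound (diffKernel g k t) C := by
  refine ⟨∑ l ∈ Finset.range (k + 1), ‖binomCoeff k l‖ₑ * ENNReal.ofReal (∫ v, ‖g v‖), ?_⟩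
  have : diffKernel g k t = ∑ l ∈ Finset.range (k + 1), binomCoeff k l • kernelSymbol g (l * t) := by
    ext m
    rw [diffKernel_eq, Finset.sum_apply]
    rfl
  rw [this]
  exact MulBound.sum _ fun l _ => (MulBound.kernelSymbol g _).smul _

theorem norm_diffSymbol_le (u : EuclideanSpace ℝ (Fin d)) (m : Lattice d) : ‖diffSymbol u m‖ ≤ 2 := by
  refine (norm_sub_le _ _).trans ?_
  rw [Complex.norm_exp_ofReal_mul_I]
  norm_num

theorem modulus_lt_top (hp : 1 ≤ p) (k : ℕ) (hF : F ∈ Lp θ p) (ε : ℝ) :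
    modulus θ k p F ε < ∞ := by
  have h := lpNorm_lt_top hp hF
  refine lt_of_le_of_lt (iSup₂_le fun u hu => ?_) (show 2 ^ k * lpNorm θ p F < ∞ by finiteness)
  rw [diff_iterate]
  exact ((MulBound.diffSymbol u).pow k).lpNorm_le _ hp hF

/-- The multiplier averages `Δ_{tv}^k F` over `v` in the support of `g`, where `‖tv‖ ≤ ε`. -/
theorem lpNorm_diffKernel_le (hp : 1 ≤ p) {k : ℕ} (hk : 1 ≤ k)
    {g : 𝓢(EuclideanSpace ℝ (Fin d), ℂ)} {r : ℝ} (hg : tsupport g ⊆ Metric.closedBall 0 r) {t ε : ℝ}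
    (ht : |t| * r ≤ ε) (hF : F ∈ Lp θ p) (hs : SlowGrowth (diffKernel g k t)) :
    mult _ hs F ∈ Lp θ p ∧
    lpNorm θ p (mult _ hs F) ≤ ENNReal.ofReal (∫ v, ‖g v‖) * modulus θ k p F ε := by
  obtain ⟨C, hC⟩ := exists_mulBound_diffKernel g k t
  have hmem := hC.mem hs hp hF
  have hm := modulus_lt_top hp k hF ε
  refine ⟨hmem, lpNorm_le_of_dualNorm_le hp hmem fun a ha => ?_⟩
  have hB : ∀ v (m : Lattice d), ‖(diffSymbol (t • v) ^ k) m‖ ≤ 2 ^ k := fun v m => by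
    rw [Pi.pow_apply, norm_pow]
    exact pow_le_pow_left₀ (norm_nonneg _) (norm_diffSymbol_le _ _) k
  have hcont : ∀ m : Lattice d, Continuous
      fun v : EuclideanSpace ℝ (Fin d) => (diffSymbol (t • v) ^ k) m := fun m =>
    (((continuous_chr m).comp (continuous_const_smul t)).sub continuous_const).pow k
  have h := norm_mult_integral_le (isDistribution_of_mem_Lp hp hF) g.integrable
    (fun m => (hcont m).aestronglyMeasurable) hB hs (fun m => rfl) a
    (C := (modulus θ k p F ε).toReal) fun v hv => by
      have hv' : ‖v‖ ≤ r := by simpa using hg (subset_tsupport _ hv)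
      -- The modulus runs over nonzero steps; at step zero the difference itself vanishes because `k
      -- ≥ 1`.
      by_cases h0 : t • v = 0
      · have : diffSymbol (t • v) ^ k = fun _ : Lattice d => (0 : ℂ) := by
          ext m
          rw [h0]
          change (chr 0 m - 1) ^ k = 0
          rw [chr_zero, sub_self, zero_pow (by omega)]
        rw [mult_congr this _ (SlowGrowth.const 0), mult_const, zero_smul]
        simp
      · rw [← toReal_enorm]
        refine ENNReal.toReal_mono hm.ne ((enorm_apply_le_lpNorm hp ha).trans ?_)
        have := le_iSup₂ (f := fun (u : EuclideanSpace ℝ (Fin d)) (_ : 0 < ‖u‖ ∧ ‖u‖ ≤ ε) =>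
          lpNorm θ p ((diff u)^[k] F)) (t • v) ⟨norm_pos_iff.2 h0, ?_⟩
        · rwa [diff_iterate] at this
        · rw [norm_smul, Real.norm_eq_abs]
          exact (mul_le_mul_of_nonneg_left hv' (abs_nonneg t)).trans ht
  rw [← ofReal_norm, ← ENNReal.ofReal_toReal hm.ne,
    ← ENNReal.ofReal_mul (integral_nonneg fun v => norm_nonneg _)]
  exact ENNReal.ofReal_le_ofReal h

theorem slowGrowth_sum_mul {ι : Type*} (s : Finset ι) (c : ι → ℂ) {ψ : ι → Lattice d → ℂ}
    (h : ∀ i, SlowGrowth (ψ i)) : SlowGrowth fun m => ∑ i ∈ s, c i * ψ i m := by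
  have := SlowGrowth.sum s fun i _ => (h i).smul (c i)
  convert this using 1
  ext m
  rw [Finset.sum_apply]
  rfl

theorem mult_eq_sum {ι : Type*} (s : Finset ι) {φ : Lattice d → ℂ} {ψ : ι → Lattice d → ℂ}
    {c : ι → ℂ} (hφ : SlowGrowth φ) (hψ : ∀ i, SlowGrowth (ψ i))
    (h : ∀ m, φ m = ∑ i ∈ s, c i * ψ i m) (F : Functional d) :
    mult φ hφ F = ∑ i ∈ s, c i • mult (ψ i) (hψ i) F := by
  have e : φ = ∑ i ∈ s, c i • ψ i := by
    ext m
    rw [h, Finset.sum_apply]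
    rfl
  rw [mult_congr e hφ (SlowGrowth.sum s fun i _ => (hψ i).smul (c i)),
    sum_mult s fun i => (hψ i).smul (c i)]
  exact Finset.sum_congr rfl fun i _ => smul_mult _ _ _

theorem kFunctional_le {X₀ X₁ : Set (Functional d)} {N₀ N₁ : Functional d → ℝ≥0∞}
    {x x₀ x₁ : Functional d} (h0 : x₀ ∈ X₀) (h1 : x₁ ∈ X₁) (h : x = x₀ + x₁) (t : ℝ) :
    kFunctional X₀ X₁ N₀ N₁ x t ≤ N₀ x₀ + ENNReal.ofReal t * N₁ x₁ :=
  iInf_le_of_le x₀ (iInf_le_of_le x₁ (iInf_le _ ⟨h0, h1, h⟩))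

/-! ### The upper bound for the K-functional -/

/-- The symbol of the smooth part in the decomposition realizing the K-functional. -/
def smoothSymbol (g : 𝓢(EuclideanSpace ℝ (Fin d), ℂ)) (k : ℕ) (t : ℝ) (m : Lattice d) : ℂ :=
  ∑ l ∈ Finset.range (k + 1), (binomCoeff k l * (l : ℂ) ^ k) * kernelSymbol g (l * t) m

theorem smoothSymbol_zero {g : 𝓢(EuclideanSpace ℝ (Fin d), ℂ)} (hg : ∫ v, g v = 1) (k : ℕ)
    (m : Lattice d) : smoothSymbol g k 0 m = k.factorial := by
  have h : kernelSymbol g 0 m = 1 := by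
    simp [kernelSymbol, chr_zero, hg]
  simp only [smoothSymbol, mul_zero, h, mul_one]
  exact sum_binomCoeff_mul_pow k

/-- Both sides are sums over pairs `(l, i)` of kernel symbols at the dilation `l i t`, and
interchanging the indices identifies them. On the right the term `l = 0` is a constant symbol, which
is how the identity operator enters. -/
theorem sum_diffKernel_eq (g : 𝓢(EuclideanSpace ℝ (Fin d), ℂ)) (k : ℕ) (t : ℝ) (m : Lattice d) :
    ∑ l ∈ Finset.range (k + 1), (binomCoeff k l * (l : ℂ) ^ k) * diffKernel g k (l * t) m =
      ∑ l ∈ Finset.range (k + 1), binomCoeff k l * smoothSymbol g k (l * t) m := by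
  simp only [diffKernel_eq, smoothSymbol, Finset.mul_sum]
  rw [Finset.sum_comm]
  refine Finset.sum_congr rfl fun l _ => Finset.sum_congr rfl fun i _ => ?_
  rw [show (l : ℝ) * ((i : ℝ) * t) = (i : ℝ) * ((l : ℝ) * t) by ring]
  ring

/-- This is the reason for the weight `l^k` in `smoothSymbol`: it absorbs the factor `(l t)^k` that
`k` derivatives produce at dilation `l t`, so the binomial sum of a `k`-th difference reappears with
kernel `h`. -/
theorem derivSymbol_mul_smoothSymbol {g h : 𝓢(EuclideanSpace ℝ (Fin d), ℂ)} {k : ℕ}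
    {α : Fin d → ℕ} (hα : ∑ j, α j = k)
    (hh : ∀ (t : ℝ) (m : Lattice d),
      kernelSymbol h t m = (-t) ^ (∑ j, α j) * derivSymbol α m * kernelSymbol g t m)
    (t : ℝ) (m : Lattice d) :
    (-t : ℂ) ^ k * (derivSymbol α m * smoothSymbol g k t m) = diffKernel h k t m := by
  rw [diffKernel_eq, smoothSymbol, Finset.mul_sum, Finset.mul_sum]
  refine Finset.sum_congr rfl fun l _ => ?_
  rw [hh, hα]
  push_cast
  rw [neg_pow, neg_pow ((l : ℂ) * t), mul_pow]
  ring

theorem exists_mulBound_deriv_kernelSymbol (g : 𝓢(EuclideanSpace ℝ (Fin d), ℂ)) (α : Fin d → ℕ)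
    {t : ℝ} (ht : t ≠ 0) : ∃ C, MulBound (derivSymbol α * kernelSymbol g t) C := by
  obtain ⟨h, -, hh⟩ := exists_kernel_deriv g α
  suffices e : derivSymbol α * kernelSymbol g t =
      ((-t : ℂ) ^ (∑ j, α j))⁻¹ • kernelSymbol h t by
    rw [e]
    exact ⟨_, (MulBound.kernelSymbol h t).smul _⟩
  ext m
  have : (-t : ℂ) ^ (∑ j, α j) ≠ 0 := pow_ne_zero _ (by simpa using ht)
  simp only [Pi.mul_apply, Pi.smul_apply, smul_eq_mul, hh]
  field_simp

/-- A qualitative bound only, for arbitrary orders: it places every derivative of the smooth part in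
`L_p`. The quantitative estimate is needed for order `k` alone. -/
theorem exists_mulBound_deriv_smoothSymbol (g : 𝓢(EuclideanSpace ℝ (Fin d), ℂ)) {k : ℕ}
    (hk : 1 ≤ k) (α : Fin d → ℕ) {t : ℝ} (ht : t ≠ 0) :
    ∃ C, MulBound (derivSymbol α * smoothSymbol g k t) C := by
  have h : ∀ l ∈ Finset.range (k + 1), ∃ C, MulBound ((binomCoeff k l * (l : ℂ) ^ k) •
      (derivSymbol α * kernelSymbol g (l * t))) C := by
    intro l _
    -- At `l = 0` the dilation degenerates and the derivative symbol is unbounded in general, but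
    -- the weight `0^k` removes the term.
    by_cases hl : l = 0
    · subst hl
      rw [Nat.cast_zero, zero_pow (by omega), mul_zero, zero_smul]
      exact ⟨_, MulBound.const 0⟩
    · obtain ⟨C, hC⟩ := exists_mulBound_deriv_kernelSymbol g α (t := l * t) (by simp [hl, ht])
      exact ⟨_, hC.smul _⟩
  choose! C hC using h
  suffices e : derivSymbol α * smoothSymbol g k t = ∑ l ∈ Finset.range (k + 1),
      (binomCoeff k l * (l : ℂ) ^ k) • (derivSymbol α * kernelSymbol g (l * t)) by
    rw [e]
    exact ⟨_, MulBound.sum _ hC⟩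
  ext m
  rw [Finset.sum_apply, Pi.mul_apply, smoothSymbol, Finset.mul_sum]
  refine Finset.sum_congr rfl fun l _ => ?_
  simp only [Pi.smul_apply, Pi.mul_apply, smul_eq_mul]
  ring

theorem kFunctional_le_modulus (d : ℕ) {k : ℕ} (hk : 1 ≤ k) :
    ∃ C : ℝ≥0∞, C ≠ ∞ ∧ ∀ (θ : Matrix (Fin d) (Fin d) ℝ) (p : ℝ≥0∞), 1 ≤ p → ∀ x ∈ Lp θ p,
      ∀ ε : ℝ, 0 < ε →
        kFunctional (Lp θ p) (Sobolev θ k p) (lpNorm θ p) (sobolevNorm θ k p) x (ε ^ k) ≤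
          C * (ENNReal.ofReal (ε ^ k) * ‖coeff θ x 0‖ₑ + modulus θ k p x ε) := by
  have hk0 : (0 : ℝ) < k := by exact_mod_cast hk
  -- Dilations up to `k ε` occur, so radius `1/k` keeps all steps below `ε`.
  obtain ⟨g, hg, hg1, hg2⟩ := exists_bump d (show (0 : ℝ) < 1 / k by positivity)
  choose h hs hh using exists_kernel_deriv g
  -- `f` is the inverse of the constant term `binomCoeff k 0 * k!` of the exchanged sum.
  set f : ℂ := ((k.factorial : ℂ))⁻¹ * (-1) ^ k with hf
  have hfac : (k.factorial : ℂ) ≠ 0 := by exact_mod_cast k.factorial_ne_zero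
  set C₀ : ℝ≥0∞ := ∑ l ∈ Finset.range (k + 1), ‖f * (binomCoeff k l * (l : ℂ) ^ k)‖ₑ with hC₀
  set C₁ : ℝ≥0∞ := ∑ α ∈ multiIdx d k, ∑ l ∈ Finset.range (k + 1),
    ‖f * binomCoeff k l‖ₑ * ENNReal.ofReal (∫ v, ‖h α v‖) with hC₁
  set B : ℝ≥0∞ := (multiIdx d k).card * (1 + d * d) ^ k with hB
  have hC₀t : C₀ ≠ ∞ := ENNReal.sum_ne_top.2 fun _ _ => enorm_ne_top
  have hC₁t : C₁ ≠ ∞ := ENNReal.sum_ne_top.2 fun _ _ => ENNReal.sum_ne_top.2 fun _ _ => by finiteness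
  have hBt : B ≠ ∞ := by finiteness
  refine ⟨C₀ + B * (1 + C₁), by finiteness, fun θ p hp x hx ε hε => ?_⟩
  set ω := modulus θ k p x ε with hω
  have hωt : ω ≠ ∞ := (modulus_lt_top hp k hx ε).ne
  choose Cd hCd using fun t : ℝ => exists_mulBound_diffKernel (d := d) g k t
  have hdiff : ∀ (i : 𝓢(EuclideanSpace ℝ (Fin d), ℂ)), tsupport i ⊆ tsupport g →
      ∀ l ∈ Finset.range (k + 1), ∀ hi : SlowGrowth (diffKernel i k (l * ε)),
      mult _ hi x ∈ Lp θ p ∧ lpNorm θ p (mult _ hi x) ≤ ENNReal.ofReal (∫ v, ‖i v‖) * ω := by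
    intro i hi l hl hsl
    refine lpNorm_diffKernel_le hp hk (hi.trans hg) ?_ hx hsl
    have hl' : (l : ℝ) ≤ k := by exact_mod_cast Nat.lt_succ_iff.1 (Finset.mem_range.1 hl)
    rw [abs_of_nonneg (by positivity), mul_one_div, div_le_iff₀ hk0]
    nlinarith
  -- the rough part
  set x₀ : Functional d := ∑ l ∈ Finset.range (k + 1), (f * (binomCoeff k l * (l : ℂ) ^ k)) •
    mult (diffKernel g k (l * ε)) (hCd (l * ε)).1 x with hx₀
  have hx₀m : x₀ ∈ Lp θ p := sum_mem_Lp hp _ fun l hl =>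
    smul_mem_Lp hp _ (hdiff g subset_rfl l hl _).1
  have hx₀n : lpNorm θ p x₀ ≤ C₀ * ω := by
    refine (lpNorm_sum_le hp _ _).trans ?_
    rw [hC₀, Finset.sum_mul]
    refine Finset.sum_le_sum fun l hl => (lpNorm_smul_le hp _ _).trans ?_
    gcongr
    refine (hdiff g subset_rfl l hl _).2.trans ?_
    rw [hg2, ENNReal.ofReal_one, one_mul]
  -- the smooth part
  set I := (Finset.range (k + 1)).erase 0 with hI
  have hsm : ∀ l : ℕ, SlowGrowth (smoothSymbol (d := d) g k (l * ε)) := fun l =>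
    slowGrowth_sum_mul _ _ fun i : ℕ => (MulBound.kernelSymbol g (i * (l * ε))).1
  set x₁ : Functional d := ∑ l ∈ I, (-(f * binomCoeff k l)) •
    mult (smoothSymbol g k (l * ε)) (hsm l) x with hx₁
  have hsum : x = x₀ + x₁ := by
    have g0 : SlowGrowth fun m : Lattice d => ∑ l ∈ Finset.range (k + 1),
        (f * (binomCoeff k l * (l : ℂ) ^ k)) * diffKernel g k (l * ε) m :=
      slowGrowth_sum_mul _ _ fun l => (hCd (l * ε)).1
    have g1 : SlowGrowth fun m : Lattice d => ∑ l ∈ I,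
        (-(f * binomCoeff k l)) * smoothSymbol g k (l * ε) m :=
      slowGrowth_sum_mul _ _ hsm
    have e0 : x₀ = mult _ g0 x :=
      (mult_eq_sum _ g0 (fun l : ℕ => (hCd (l * ε)).1) (fun m => rfl) x).symm
    have e1 : x₁ = mult _ g1 x := (mult_eq_sum _ g1 hsm (fun m => rfl) x).symm
    rw [e0, e1, ← add_mult]
    refine (mult_one (SlowGrowth.const 1) x).symm.trans (mult_congr ?_ _ _ x)
    ext m
    have h1 := sum_diffKernel_eq g k ε m
    rw [← Finset.add_sum_erase _ _ (Finset.mem_range.2 (Nat.succ_pos k) :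
      0 ∈ Finset.range (k + 1)), ← hI] at h1
    rw [← Finset.add_sum_erase _ (fun l => binomCoeff k l * smoothSymbol g k (l * ε) m)
      (Finset.mem_range.2 (Nat.succ_pos k) : 0 ∈ Finset.range (k + 1)), ← hI] at h1
    simp only [Nat.cast_zero, zero_mul, smoothSymbol_zero hg1] at h1
    have h2 : ∑ l ∈ Finset.range (k + 1), (f * (binomCoeff k l * (l : ℂ) ^ k)) *
        diffKernel g k (l * ε) m + ∑ l ∈ I, (-(f * binomCoeff k l)) * smoothSymbol g k (l * ε) m
          = f * (binomCoeff k 0 * k.factorial) := by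
      rw [← Finset.add_sum_erase _ _ (Finset.mem_range.2 (Nat.succ_pos k) :
        0 ∈ Finset.range (k + 1)), ← hI]
      have h3 := congrArg (f * ·) h1
      simp only [mul_add, Finset.mul_sum] at h3
      simp only [Nat.cast_zero, zero_mul, neg_mul, Finset.sum_neg_distrib, mul_assoc] at h3 ⊢
      linear_combination h3
    rw [Pi.add_apply, h2, hf, binomCoeff]
    have : ((-1 : ℂ) ^ k) * (-1) ^ k = 1 := by rw [← mul_pow]; simp
    simp only [Nat.sub_zero, Nat.choose_zero_right, Nat.cast_one, mul_one]
    calc (1 : ℂ) = ((-1) ^ k * (-1) ^ k) * ((k.factorial : ℂ)⁻¹ * k.factorial) := by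
          rw [this, inv_mul_cancel₀ hfac, one_mul]
      _ = _ := by ring
  have hDx₁ : ∀ α, D α x₁ = ∑ l ∈ I, (-(f * binomCoeff k l)) •
      mult (derivSymbol α * smoothSymbol g k (l * ε)) ((slowGrowth_deriv α).mul (hsm l)) x := by
    intro α
    rw [D_eq_mult, hx₁, mult_sum]
    simp only [mult_smul, mult_mult]
  have hI0 : ∀ l ∈ I, (1 : ℝ) ≤ l := fun l hl => by
    exact_mod_cast Nat.one_le_iff_ne_zero.2 (Finset.ne_of_mem_erase hl)
  have hDmem : ∀ α, D α x₁ ∈ Lp θ p := by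
    intro α
    rw [hDx₁]
    refine sum_mem_Lp hp _ fun l hl => smul_mem_Lp hp _ ?_
    obtain ⟨C, hC⟩ := exists_mulBound_deriv_smoothSymbol g hk α (t := l * ε)
      (by have := hI0 l hl; positivity)
    exact hC.mem _ hp hx
  have hx₁m : x₁ ∈ Lp θ p := by simpa only [D_zero] using hDmem 0
  -- Here each term is again an average of `k`-th differences of `x`, with kernel `h α`; the factor
  -- `(l ε)^{-k}` is at most `ε^{-k}` since `l ≥ 1`.
  have hDn : ∀ α : Fin d → ℕ, ∑ j, α j = k →
      lpNorm θ p (D α x₁) ≤ ENNReal.ofReal ((ε ^ k)⁻¹) * (C₁ * ω) := by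
    intro α hα
    rw [hDx₁]
    refine (lpNorm_sum_le hp _ _).trans ?_
    have hterm : ∀ l ∈ I, lpNorm θ p ((-(f * binomCoeff k l)) •
        mult (derivSymbol α * smoothSymbol g k (l * ε)) ((slowGrowth_deriv α).mul (hsm l)) x) ≤
        ENNReal.ofReal ((ε ^ k)⁻¹) *
          (‖f * binomCoeff k l‖ₑ * ENNReal.ofReal (∫ v, ‖h α v‖) * ω) := by
      intro l hl
      have hlε : (0 : ℝ) < l * ε := by have := hI0 l hl; positivity
      obtain ⟨C, hC⟩ := exists_mulBound_diffKernel (h α) k (l * ε)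
      have hne : (-((l * ε : ℝ) : ℂ)) ^ k ≠ 0 :=
        pow_ne_zero _ (neg_ne_zero.2 (Complex.ofReal_ne_zero.2 hlε.ne'))
      have e : derivSymbol α * smoothSymbol g k (l * ε) =
          ((-((l * ε : ℝ) : ℂ)) ^ k)⁻¹ • diffKernel (h α) k (l * ε) := by
        ext m
        rw [Pi.smul_apply, ← derivSymbol_mul_smoothSymbol hα (hh α), smul_eq_mul, ← mul_assoc,
          inv_mul_cancel₀ hne, one_mul]
        rfl
      rw [mult_congr e _ (hC.1.smul _), smul_mult _ hC.1]
      refine (lpNorm_smul_le hp _ _).trans ?_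
      rw [enorm_neg]
      calc ‖f * binomCoeff k l‖ₑ * lpNorm θ p
            (((-((l * ε : ℝ) : ℂ)) ^ k)⁻¹ • mult (diffKernel (h α) k (l * ε)) hC.1 x)
          ≤ ‖f * binomCoeff k l‖ₑ * (ENNReal.ofReal ((ε ^ k)⁻¹) *
              (ENNReal.ofReal (∫ v, ‖h α v‖) * ω)) := by
            gcongr
            refine (lpNorm_smul_le hp _ _).trans (mul_le_mul' ?_
              (hdiff (h α) (hs α) l (Finset.mem_of_mem_erase hl) _).2)
            rw [← ofReal_norm, norm_inv, norm_pow, norm_neg, Complex.norm_real,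
              Real.norm_of_nonneg hlε.le]
            refine ENNReal.ofReal_le_ofReal (inv_anti₀ (by positivity) ?_)
            exact pow_le_pow_left₀ hε.le (le_mul_of_one_le_left hε.le (hI0 l hl)) k
        _ = _ := by ring
    refine (Finset.sum_le_sum hterm).trans ?_
    rw [← Finset.mul_sum, ← Finset.sum_mul]
    gcongr
    refine (Finset.sum_le_sum_of_subset (Finset.erase_subset _ _)).trans ?_
    exact Finset.single_le_sum (f := fun α => ∑ l ∈ Finset.range (k + 1),
      ‖f * binomCoeff k l‖ₑ * ENNReal.ofReal (∫ v, ‖h α v‖)) (fun _ _ => zero_le)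
      (mem_multiIdx.2 hα.le)
  -- Differences annihilate constants, so the whole mean of `x` is carried by the smooth part.
  have hc₁ : coeff θ x₁ 0 = coeff θ x 0 := by
    have h0 : coeff θ x₀ 0 = 0 := by
      rw [hx₀, coeff, LinearMap.sum_apply]
      refine Finset.sum_eq_zero fun l _ => ?_
      rw [LinearMap.smul_apply]
      change _ • coeff θ (mult _ _ x) 0 = 0
      rw [coeff_mult]
      have : diffKernel g k (l * ε) (0 : Lattice d) = 0 := by
        unfold diffKernel
        have : ∀ v, (diffSymbol (((l : ℝ) * ε) • v) ^ k) (0 : Lattice d) = 0 := fun v => by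
          change (chr _ 0 - 1) ^ k = 0
          rw [chr_zero_right, sub_self, zero_pow (by omega)]
        simp [this]
      rw [this, zero_mul, smul_zero]
    rw [hsum, coeff_add, h0, zero_add]
  have hx₁s : x₁ ∈ Sobolev θ k p := ⟨isDistribution_of_mem_Lp hp hx₁m, fun α _ => hDmem α⟩
  refine (kFunctional_le hx₀m hx₁s hsum _).trans ?_
  have hsob := sobolevNorm_le hp hDmem (M := ENNReal.ofReal ((ε ^ k)⁻¹) * (C₁ * ω))
    (by finiteness) hDn
  rw [hc₁, ← hB] at hsob
  have hcancel : ENNReal.ofReal (ε ^ k) * ENNReal.ofReal ((ε ^ k)⁻¹) = 1 := by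
    rw [← ENNReal.ofReal_mul (by positivity), mul_inv_cancel₀ (by positivity), ENNReal.ofReal_one]
  set t := ENNReal.ofReal (ε ^ k)
  set c := ‖coeff θ x 0‖ₑ
  calc lpNorm θ p x₀ + t * sobolevNorm θ k p x₁
      ≤ C₀ * ω + t * (B * (c + ENNReal.ofReal ((ε ^ k)⁻¹) * (C₁ * ω))) := by gcongr
    _ = C₀ * ω + B * (t * c + t * ENNReal.ofReal ((ε ^ k)⁻¹) * (C₁ * ω)) := by ring
    _ = C₀ * ω + B * (t * c + C₁ * ω) := by rw [hcancel, one_mul]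
    _ ≤ C₀ * (t * c + ω) + B * ((t * c + ω) + C₁ * (t * c + ω)) := by
        gcongr
        · exact le_add_self
        · exact le_self_add
        · exact le_add_self
    _ = (C₀ + B * (1 + C₁)) * (t * c + ω) := by ring

end QTorus

namespace QTorus

open scoped FourierTransform

variable {d : ℕ} {θ : Matrix (Fin d) (Fin d) ℝ} {p : ℝ≥0∞} {F G : Functional d}

/-! ### Littlewood-Paley blocks -/

/-- One constant serves all dilations: rescaling the symbol rescales the translations and leaves the
`L¹` norm of the averaging density unchanged. -/
theorem exists_mulBound_of_hasCompactSupport {f : EuclideanSpace ℝ (Fin d) → ℂ}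
    (hf : ContDiff ℝ ((⊤ : ℕ∞) : WithTop ℕ∞) f) (hc : HasCompactSupport f) :
    ∃ C : ℝ≥0∞, C ≠ ∞ ∧ ∀ t : ℝ, MulBound (fun m => f (t • latVec m)) C :=
  ⟨_, ENNReal.ofReal_ne_top, fun t => MulBound.schwartz (hc.toSchwartzMap hf) t⟩

variable {φ : 𝓢(EuclideanSpace ℝ (Fin d), ℝ)}

/-- Nonvanishing is an open condition, so `ξ` may be moved slightly along its ray in both directions
within the support, which makes the inequalities strict. Positivity on the open annulus then gives
`φ ≥ 0` everywhere. -/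
theorem IsLittlewoodPaley.norm_mem_Ioo (hφ : IsLittlewoodPaley φ) {ξ : EuclideanSpace ℝ (Fin d)}
    (h : φ ξ ≠ 0) : 2⁻¹ < ‖ξ‖ ∧ ‖ξ‖ < 2 := by
  have hmem : ∀ ζ, φ ζ ≠ 0 → 2⁻¹ ≤ ‖ζ‖ ∧ ‖ζ‖ ≤ 2 := fun ζ hζ =>
    hφ.tsupport_subset (subset_tsupport _ hζ)
  have hξ : 0 < ‖ξ‖ := lt_of_lt_of_le (by norm_num) (hmem ξ h).1
  have hev : ∀ᶠ s : ℝ in 𝓝 1, φ (s • ξ) ≠ 0 := by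
    have hc : Continuous fun s : ℝ => φ (s • ξ) := φ.continuous.comp (by fun_prop)
    exact hc.continuousAt.eventually_ne (by simpa using h)
  have hn : ∀ s : ℝ, 0 < s → ‖s • ξ‖ = s * ‖ξ‖ := fun s hs => by
    rw [norm_smul, Real.norm_of_nonneg hs.le]
  constructor
  · obtain ⟨s, hs, hs1, hs0⟩ := ((hev.filter_mono (nhdsWithin_le_nhds (s := Iio 1))).and
      (eventually_mem_nhdsWithin.and ((eventually_gt_nhds (show (0 : ℝ) < 1 by norm_num)).filter_mono
        nhdsWithin_le_nhds))).exists
    have := (hmem _ hs).1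
    rw [hn s hs0] at this
    exact this.trans_lt (mul_lt_of_lt_one_left hξ hs1)
  · obtain ⟨s, hs, hs1⟩ := ((hev.filter_mono (nhdsWithin_le_nhds (s := Ioi 1))).and
      eventually_mem_nhdsWithin).exists
    have hs1' : (1 : ℝ) < s := hs1
    have := (hmem _ hs).2
    rw [hn s (by linarith)] at this
    exact (lt_mul_of_one_lt_left hξ hs1').trans_le this

theorem IsLittlewoodPaley.nonneg (hφ : IsLittlewoodPaley φ) (ξ : EuclideanSpace ℝ (Fin d)) :
    0 ≤ φ ξ := by
  by_cases h : φ ξ = 0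
  · exact h.ge
  · exact (hφ.pos ξ (hφ.norm_mem_Ioo h).1 (hφ.norm_mem_Ioo h).2).le

theorem IsLittlewoodPaley.apply_eq_zero_of_le (hφ : IsLittlewoodPaley φ)
    {ξ : EuclideanSpace ℝ (Fin d)} (h : ‖ξ‖ ≤ 2⁻¹) : φ ξ = 0 :=
  not_not.1 fun h' => absurd (hφ.norm_mem_Ioo h').1 (not_lt.2 h)

theorem IsLittlewoodPaley.apply_eq_zero_of_ge (hφ : IsLittlewoodPaley φ)
    {ξ : EuclideanSpace ℝ (Fin d)} (h : 2 ≤ ‖ξ‖) : φ ξ = 0 :=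
  not_not.1 fun h' => absurd (hφ.norm_mem_Ioo h').2 (not_lt.2 h)

theorem IsLittlewoodPaley.hasCompactSupport (hφ : IsLittlewoodPaley φ) : HasCompactSupport φ :=
  (isCompact_closedBall (0 : EuclideanSpace ℝ (Fin d)) 2).of_isClosed_subset (isClosed_tsupport _)
    fun ξ hξ => by simpa using (hφ.tsupport_subset hξ).2

theorem contDiff_coord (i : Fin d) :
    ContDiff ℝ ((⊤ : ℕ∞) : WithTop ℕ∞) fun ξ : EuclideanSpace ℝ (Fin d) => ξ i :=
  (EuclideanSpace.proj i : EuclideanSpace ℝ (Fin d) →L[ℝ] ℝ).contDiff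

theorem contDiff_coord_complex (i : Fin d) (c : ℂ) :
    ContDiff ℝ ((⊤ : ℕ∞) : WithTop ℕ∞) fun ξ : EuclideanSpace ℝ (Fin d) => c * (ξ i : ℂ) :=
  contDiff_const.mul (Complex.ofRealCLM.contDiff.comp (contDiff_coord i))

theorem blockSymbol_eq (φ : 𝓢(EuclideanSpace ℝ (Fin d), ℝ)) (j : ℕ) (m : Lattice d) :
    blockSymbol φ j m = (φ (((2 : ℝ) ^ j)⁻¹ • latVec m) : ℂ) := by
  rw [blockSymbol, zpow_neg, zpow_natCast]
  rfl

theorem IsLittlewoodPaley.exists_mulBound_blockSymbol (hφ : IsLittlewoodPaley φ) :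
    ∃ C : ℝ≥0∞, C ≠ ∞ ∧ ∀ j, MulBound (blockSymbol φ j) C := by
  obtain ⟨C, hC, h⟩ := exists_mulBound_of_hasCompactSupport (f := fun ξ => (φ ξ : ℂ))
    (Complex.ofRealCLM.contDiff.comp (φ.smooth _))
    (hφ.hasCompactSupport.comp_left Complex.ofReal_zero)
  refine ⟨C, hC, fun j => ?_⟩
  have := h (((2 : ℝ) ^ j)⁻¹)
  simpa only [← blockSymbol_eq] using this

theorem sum_sq_pow_pos (k : ℕ) {ξ : EuclideanSpace ℝ (Fin d)} (hξ : ξ ≠ 0) :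
    0 < ∑ i, ((2 * Real.pi * ξ i) ^ 2) ^ k := by
  obtain ⟨i, hi⟩ : ∃ i, ξ i ≠ 0 := by
    by_contra! h
    exact hξ (by ext i; exact h i)
  refine Finset.sum_pos' (fun _ _ => by positivity) ⟨i, Finset.mem_univ i, ?_⟩
  have := Real.pi_pos
  positivity

/-- `φ(ξ) = ∑_i ψ_i(ξ) (2πi ξ_i)^k` with test functions `ψ_i`. -/
theorem IsLittlewoodPaley.exists_eq_sum (hφ : IsLittlewoodPaley φ) (k : ℕ) :
    ∃ ψ : Fin d → EuclideanSpace ℝ (Fin d) → ℂ,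
      (∀ i, ContDiff ℝ ((⊤ : ℕ∞) : WithTop ℕ∞) (ψ i) ∧ HasCompactSupport (ψ i)) ∧
      ∀ ξ, (φ ξ : ℂ) = ∑ i, ψ i ξ * (2 * Real.pi * Complex.I * (ξ i : ℂ)) ^ k := by
  -- `P` vanishes at most at the origin, near which `φ` is zero, so `φ / P` is smooth. Multiplying
  -- it by `(-2πi ξ_i)^k` gives `ψ_i`, since `(-2πi ξ_i)^k (2πi ξ_i)^k = (2π ξ_i)^{2k}`.
  set P : EuclideanSpace ℝ (Fin d) → ℝ := fun ξ => ∑ i, ((2 * Real.pi * ξ i) ^ 2) ^ k with hP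
  have hPc : ContDiff ℝ ((⊤ : ℕ∞) : WithTop ℕ∞) P :=
    ContDiff.sum fun i _ => ((contDiff_const.mul (contDiff_coord i)).pow 2).pow k
  set h : EuclideanSpace ℝ (Fin d) → ℝ := fun ξ => φ ξ * (P ξ)⁻¹ with hh
  have hc : ContDiff ℝ ((⊤ : ℕ∞) : WithTop ℕ∞) h := by
    refine contDiff_iff_contDiffAt.2 fun ξ => ?_
    by_cases hξ : ξ = 0
    · have h0 : h =ᶠ[𝓝 ξ] fun _ => 0 := by
        filter_upwards [Metric.ball_mem_nhds ξ (show (0 : ℝ) < 2⁻¹ by norm_num)] with ζ hζ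
        rw [hξ, mem_ball_zero_iff] at hζ
        rw [hh]
        simp only [hφ.apply_eq_zero_of_le hζ.le, zero_mul]
      exact contDiffAt_const.congr_of_eventuallyEq h0
    · exact (φ.smooth _).contDiffAt.mul (hPc.contDiffAt.inv (sum_sq_pow_pos k hξ).ne')
  have hs : HasCompactSupport h := hφ.hasCompactSupport.mul_right
  refine ⟨fun i ξ => (h ξ : ℂ) * (-(2 * Real.pi * Complex.I) * (ξ i : ℂ)) ^ k, fun i => ⟨?_, ?_⟩,
    fun ξ => ?_⟩
  · exact (Complex.ofRealCLM.contDiff.comp hc).mul ((contDiff_coord_complex i _).pow k)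
  · exact (hs.comp_left Complex.ofReal_zero).mul_right
  · have e : ∀ i, (h ξ : ℂ) * (-(2 * Real.pi * Complex.I) * (ξ i : ℂ)) ^ k *
        (2 * Real.pi * Complex.I * (ξ i : ℂ)) ^ k =
        ((h ξ * ((2 * Real.pi * ξ i) ^ 2) ^ k : ℝ) : ℂ) := by
      intro i
      rw [mul_assoc, ← mul_pow]
      push_cast
      congr 2
      linear_combination (-(2 * (Real.pi : ℂ) * ξ i) ^ 2) * Complex.I_sq
    simp only [e]
    rw [← Complex.ofReal_sum, ← Finset.mul_sum]
    congr 1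
    by_cases hξ : ξ = 0
    · have : φ ξ = 0 := hφ.apply_eq_zero_of_le (by rw [hξ, norm_zero]; norm_num)
      rw [hh]
      simp only [this, zero_mul]
    · exact (inv_mul_cancel_right₀ (sum_sq_pow_pos k hξ).ne' (φ ξ)).symm

theorem derivSymbol_single_pow (i : Fin d) (k : ℕ) (m : Lattice d) :
    derivSymbol (Pi.single i k) m = (2 * Real.pi * Complex.I * (m i : ℂ)) ^ k := by
  unfold derivSymbol
  rw [Finset.prod_eq_single i]
  · simp
  · intro l _ hl
    simp [hl]
  · simp

/-- The Jackson-type estimate for the blocks of a Sobolev element. -/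
theorem IsLittlewoodPaley.exists_lpNorm_block_le (hφ : IsLittlewoodPaley φ) (k : ℕ) :
    ∃ C : ℝ≥0∞, C ≠ ∞ ∧ ∀ (θ : Matrix (Fin d) (Fin d) ℝ) (p : ℝ≥0∞), 1 ≤ p →
      ∀ x ∈ Sobolev θ k p, ∀ j : ℕ, lpNorm θ p (block φ j x) ≤
        C * (ENNReal.ofReal ((((2 : ℝ) ^ j)⁻¹) ^ k) * sobolevNorm θ k p x) := by
  obtain ⟨ψ, hψ, hsum⟩ := hφ.exists_eq_sum k
  choose C hC hb using fun i => exists_mulBound_of_hasCompactSupport (hψ i).1 (hψ i).2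
  refine ⟨∑ i, C i, ENNReal.sum_ne_top.2 fun i _ => hC i, fun θ p hp x hx j => ?_⟩
  set t : ℝ := ((2 : ℝ) ^ j)⁻¹ with ht
  have ht0 : 0 < t := by positivity
  have hsl : ∀ i, SlowGrowth ((fun m => ψ i (t • latVec m)) * derivSymbol (Pi.single i k)) :=
    fun i => (hb i t).1.mul (slowGrowth_deriv _)
  have hi : ∀ i : Fin d, Pi.single i k ∈ multiIdx d k := fun i => mem_multiIdx.2 (by simp)
  have e : block φ j x = ∑ i, ((t : ℂ) ^ k) •
      mult _ (hb i t).1 (D (Pi.single i k) x) := by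
    unfold block
    rw [mult_eq_sum Finset.univ (slowGrowth_block φ j) hsl (c := fun _ => (t : ℂ) ^ k) fun m => ?_]
    · simp only [D_eq_mult, mult_mult]
    · rw [blockSymbol_eq, ← ht, hsum]
      refine Finset.sum_congr rfl fun i _ => ?_
      rw [Pi.mul_apply, derivSymbol_single_pow, PiLp.smul_apply, latVec_apply, smul_eq_mul,
        Complex.ofReal_mul, Complex.ofReal_intCast, mul_left_comm _ (t : ℂ), mul_pow (t : ℂ)]
      ring
  rw [e, Finset.sum_mul]
  refine (lpNorm_sum_le hp _ _).trans (Finset.sum_le_sum fun i _ => ?_)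
  refine (lpNorm_smul_le hp _ _).trans ?_
  rw [← ofReal_norm, norm_pow, Complex.norm_real, Real.norm_of_nonneg ht0.le, mul_left_comm]
  gcongr
  refine ((hb i t).lpNorm_le _ hp (hx.2 _ (hi i))).trans ?_
  gcongr
  exact lpNorm_D_le_sobolevNorm hp (hi i) x

/-- Bernstein's inequality for the blocks. -/
theorem IsLittlewoodPaley.exists_lpNorm_D_block_le (hφ : IsLittlewoodPaley φ) (α : Fin d → ℕ) :
    ∃ C : ℝ≥0∞, C ≠ ∞ ∧ ∀ (θ : Matrix (Fin d) (Fin d) ℝ) (p : ℝ≥0∞), 1 ≤ p →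
      ∀ (x : Functional d) (j : ℕ), block φ j x ∈ Lp θ p → D α (block φ j x) ∈ Lp θ p ∧
        lpNorm θ p (D α (block φ j x)) ≤
          C * (ENNReal.ofReal (((2 : ℝ) ^ j) ^ (∑ i, α i)) * lpNorm θ p (block φ j x)) := by
  -- `b` equals one on the ball of radius `2`, which contains the support of `φ`; on a block the
  -- unbounded derivative symbol may be cut off by it.
  let b : ContDiffBump (0 : EuclideanSpace ℝ (Fin d)) := ⟨2, 3, by norm_num, by norm_num⟩
  set f : EuclideanSpace ℝ (Fin d) → ℂ := fun ξ =>
    (b ξ : ℂ) * ∏ i, (2 * Real.pi * Complex.I * (ξ i : ℂ)) ^ α i with hf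
  obtain ⟨C, hC, hb⟩ := exists_mulBound_of_hasCompactSupport (f := f)
    ((Complex.ofRealCLM.contDiff.comp b.contDiff).mul
      (contDiff_prod fun i _ => (contDiff_coord_complex i _).pow _))
    ((b.hasCompactSupport.comp_left Complex.ofReal_zero).mul_right)
  refine ⟨C, hC, fun θ p hp x j hx => ?_⟩
  set s : ℝ := (2 : ℝ) ^ j with hs
  have hs0 : 0 < s := by positivity
  have e : D α (block φ j x) = ((s : ℂ) ^ (∑ i, α i)) • mult _ (hb s⁻¹).1 (block φ j x) := by
    rw [D_eq_mult, block, mult_mult, mult_mult, ← smul_mult]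
    refine mult_congr ?_ _ _ _
    ext m
    simp only [Pi.smul_apply, Pi.mul_apply, smul_eq_mul]
    rw [blockSymbol_eq, ← hs]
    by_cases h0 : φ (s⁻¹ • latVec m) = 0
    · simp [h0]
    · have hb1 : b (s⁻¹ • latVec m) = 1 :=
        b.one_of_mem_closedBall (by simpa using (hφ.norm_mem_Ioo h0).2.le)
      rw [hf]
      simp only [hb1, Complex.ofReal_one, one_mul, derivSymbol]
      rw [← mul_assoc, ← Finset.prod_pow_eq_pow_sum, ← Finset.prod_mul_distrib]
      congr 1
      refine Finset.prod_congr rfl fun i _ => ?_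
      rw [← mul_pow, PiLp.smul_apply, latVec_apply, smul_eq_mul]
      congr 1
      push_cast
      have : (s : ℂ) ≠ 0 := Complex.ofReal_ne_zero.2 hs0.ne'
      field_simp
  rw [e]
  refine ⟨smul_mem_Lp hp _ ((hb s⁻¹).mem _ hp hx), (lpNorm_smul_le hp _ _).trans ?_⟩
  rw [← ofReal_norm, norm_pow, Complex.norm_real, Real.norm_of_nonneg hs0.le, mul_left_comm]
  gcongr
  exact (hb s⁻¹).lpNorm_le _ hp hx

theorem IsLittlewoodPaley.exists_sobolevNorm_block_le (hφ : IsLittlewoodPaley φ) (k : ℕ) :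
    ∃ C : ℝ≥0∞, C ≠ ∞ ∧ ∀ (θ : Matrix (Fin d) (Fin d) ℝ) (p : ℝ≥0∞), 1 ≤ p →
      ∀ (x : Functional d) (j : ℕ), block φ j x ∈ Lp θ p → block φ j x ∈ Sobolev θ k p ∧
        sobolevNorm θ k p (block φ j x) ≤
          C * (ENNReal.ofReal (((2 : ℝ) ^ j) ^ k) * lpNorm θ p (block φ j x)) := by
  choose C hC hb using hφ.exists_lpNorm_D_block_le
  refine ⟨∑ α ∈ multiIdx d k, C α, ENNReal.sum_ne_top.2 fun α _ => hC α, fun θ p hp x j hx =>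
    ⟨⟨isDistribution_of_mem_Lp hp hx, fun α _ => (hb α θ p hp x j hx).1⟩, ?_⟩⟩
  refine (sobolevNorm_le_sum hp k _).trans ?_
  rw [Finset.sum_mul]
  refine Finset.sum_le_sum fun α hα => (hb α θ p hp x j hx).2.trans ?_
  gcongr
  · exact one_le_pow₀ (by norm_num)
  · exact mem_multiIdx.1 hα

theorem D_scalar (α : Fin d → ℕ) (c : ℂ) :
    D α (scalar c : Functional d) = scalar (derivSymbol α (0 : Lattice d) * c) := by
  rw [D_eq_mult]
  ext a
  rw [mult_apply, scalar_apply, scalar_apply]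
  change c * (derivSymbol α (-0) * a.1 0) = _
  rw [neg_zero]
  ring

theorem norm_derivSymbol_zero_le (α : Fin d → ℕ) : ‖derivSymbol α (0 : Lattice d)‖ ≤ 1 := by
  unfold derivSymbol
  rw [norm_prod]
  refine Finset.prod_le_one (fun _ _ => norm_nonneg _) fun j _ => ?_
  rw [norm_pow]
  exact pow_le_one₀ (norm_nonneg _) (by simp)

theorem scalar_mem_Sobolev (hp : 1 ≤ p) (k : ℕ) (c : ℂ) :
    (scalar c : Functional d) ∈ Sobolev θ k p := by
  refine ⟨isDistribution_of_mem_Lp hp (scalar_mem_Lp hp c), fun α _ => ?_⟩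
  rw [D_scalar]
  exact scalar_mem_Lp hp _

theorem sobolevNorm_scalar_le (hp : 1 ≤ p) (k : ℕ) (c : ℂ) :
    sobolevNorm θ k p (scalar c : Functional d) ≤ (multiIdx d k).card * ‖c‖ₑ := by
  refine (sobolevNorm_le_sum hp k _).trans ?_
  rw [← nsmul_eq_mul]
  refine Finset.sum_le_card_nsmul _ _ _ fun α _ => ?_
  rw [D_scalar]
  refine (lpNorm_scalar_le hp _).trans ?_
  rw [enorm_mul]
  refine mul_le_of_le_one_left' ?_
  rw [← ofReal_norm]
  exact ENNReal.ofReal_le_one.2 (norm_derivSymbol_zero_le α)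

theorem one_le_norm_latVec {m : Lattice d} (hm : m ≠ 0) : 1 ≤ ‖latVec m‖ := by
  obtain ⟨i, hi⟩ := Function.ne_iff.1 hm
  refine le_trans ?_ (PiLp.norm_apply_le (latVec m) i)
  rw [latVec_apply, Real.norm_eq_abs, ← Int.cast_abs]
  exact_mod_cast Int.one_le_abs hi

/-- Nonzero lattice points have norm at least one, so the blocks with negative index vanish there;
at the origin every block vanishes. -/
theorem IsLittlewoodPaley.hasSum_blocks (hφ : IsLittlewoodPaley φ) (m : Lattice d) :
    HasSum (fun j : ℕ => φ (((2 : ℝ) ^ j)⁻¹ • latVec m)) (if m = 0 then 0 else 1) := by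
  split_ifs with hm
  · have : ∀ j : ℕ, φ (((2 : ℝ) ^ j)⁻¹ • latVec m) = 0 := fun j => by
      refine hφ.apply_eq_zero_of_le ?_
      have : latVec m = 0 := by
        ext i
        rw [latVec_apply, hm]
        simp
      rw [this, smul_zero, norm_zero]
      norm_num
    simp only [this]
    exact hasSum_zero
  · have h1 := one_le_norm_latVec hm
    have h := hφ.hasSum (latVec m) fun h0 => by
      rw [h0, norm_zero] at h1
      linarith
    rw [← (Nat.cast_injective (R := ℤ)).hasSum_iff] at h
    · refine h.congr_fun fun j => ?_
      simp only [Function.comp_apply, zpow_neg, zpow_natCast]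
    · intro j hj
      have hj0 : j < 0 := by
        by_contra! h0
        exact hj ⟨j.toNat, Int.toNat_of_nonneg h0⟩
      refine hφ.apply_eq_zero_of_ge ?_
      rw [norm_smul, Real.norm_of_nonneg (by positivity)]
      have h2 : (2 : ℝ) ^ (1 : ℤ) ≤ (2 : ℝ) ^ (-j) := zpow_le_zpow_right₀ (by norm_num) (by omega)
      rw [zpow_one] at h2
      nlinarith

/-- The Littlewood-Paley decomposition of a distribution. -/
theorem IsLittlewoodPaley.hasSum_block (hφ : IsLittlewoodPaley φ) (hF : IsDistribution θ F)
    (a : Test d) :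
    HasSum (fun j => block φ j F a) (F a - scalar (coeff θ F 0) a) := by
  set b : Lattice d → ℂ := fun m => a.1 m * F (delta m) with hb
  have hbs : Summable fun m => ‖b m‖ := hF.summable a
  set g : Lattice d × ℕ → ℂ := fun z => (φ (((2 : ℝ) ^ z.2)⁻¹ • latVec (-z.1)) : ℂ) * b z.1 with hg
  have hφm : ∀ m : Lattice d, HasSum (fun j : ℕ => φ (((2 : ℝ) ^ j)⁻¹ • latVec (-m)))
      (if m = 0 then 0 else 1) := fun m => by
    simpa only [neg_eq_zero] using hφ.hasSum_blocks (-m)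
  have hgn : ∀ z, ‖g z‖ = φ (((2 : ℝ) ^ z.2)⁻¹ • latVec (-z.1)) * ‖b z.1‖ := fun z => by
    rw [hg, norm_mul, Complex.norm_real, Real.norm_of_nonneg (hφ.nonneg _)]
  -- Since `φ ≥ 0` and its dilates sum to at most one, the double series is dominated by the Fourier
  -- series and may be summed in either order.
  have hgs : Summable g := by
    refine Summable.of_norm ?_
    rw [summable_prod_of_nonneg fun z => norm_nonneg _]
    simp only [hgn]
    refine ⟨fun m => (hφm m).summable.mul_right _, ?_⟩
    refine hbs.of_nonneg_of_le (fun m => tsum_nonneg fun j => mul_nonneg (hφ.nonneg _) (norm_nonneg _))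
      fun m => ?_
    rw [tsum_mul_right, (hφm m).tsum_eq]
    split_ifs <;> simp
  have h1 : HasSum (fun m => ((if m = 0 then 0 else 1 : ℝ) : ℂ) * b m) (∑' z, g z) :=
    hgs.hasSum.prod_fiberwise fun m => (Complex.hasSum_ofReal.2 (hφm m)).mul_right (b m)
  have h2 : HasSum (fun m => ((if m = 0 then 0 else 1 : ℝ) : ℂ) * b m) (F a - b 0) := by
    refine ((hF.hasSum a).sub (hasSum_ite_eq 0 (b 0))).congr_fun fun m => ?_
    by_cases hm : m = 0 <;> simp [hm, hb]
  have h3 : HasSum (fun j => block φ j F a) (∑' z, g z) := by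
    refine ((Equiv.prodComm ℕ (Lattice d)).hasSum_iff.2 hgs.hasSum).prod_fiberwise fun j => ?_
    refine (hF.hasSum_mult (slowGrowth_block φ j) a).congr_fun fun m => ?_
    rw [blockSymbol_eq]
    rfl
  rw [h1.unique h2] at h3
  rwa [scalar_apply, coeff_zero_eq, mul_comm]

end QTorus

namespace QTorus

/-! ### Weighted sequences -/

/-- The norm of `ℓ^q`. -/
def lqNorm (q : ℝ≥0∞) (b : ℕ → ℝ≥0∞) : ℝ≥0∞ :=
  if q = ∞ then ⨆ j, b j else (∑' j, b j ^ q.toReal) ^ (1 / q.toReal)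

theorem one_le_toReal {q : ℝ≥0∞} (hq : 1 ≤ q) (h : q ≠ ∞) : 1 ≤ q.toReal := by
  rw [← ENNReal.toReal_one]
  exact ENNReal.toReal_mono h hq

theorem le_lqNorm {q : ℝ≥0∞} (hq : 1 ≤ q) (b : ℕ → ℝ≥0∞) (j : ℕ) : b j ≤ lqNorm q b := by
  unfold lqNorm
  split_ifs with h
  · exact le_iSup b j
  · rw [one_div, ENNReal.le_rpow_inv_iff (by linarith [one_le_toReal hq h])]
    exact ENNReal.le_tsum (f := fun j => b j ^ q.toReal) j

theorem lqNorm_mono (q : ℝ≥0∞) {b c : ℕ → ℝ≥0∞} (h : ∀ j, b j ≤ c j) : lqNorm q b ≤ lqNorm q c := by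
  unfold lqNorm
  split_ifs
  · exact iSup_mono h
  · gcongr with j
    exact h j

theorem lqNorm_const_mul {q : ℝ≥0∞} (hq : 1 ≤ q) (C : ℝ≥0∞) (b : ℕ → ℝ≥0∞) :
    lqNorm q (fun j => C * b j) = C * lqNorm q b := by
  unfold lqNorm
  split_ifs with h
  · rw [ENNReal.mul_iSup]
  · have hq0 : 0 < q.toReal := by linarith [one_le_toReal hq h]
    simp only [ENNReal.mul_rpow_of_nonneg _ _ hq0.le]
    rw [ENNReal.tsum_mul_left, ENNReal.mul_rpow_of_nonneg _ _ (by positivity), ← ENNReal.rpow_mul,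
      mul_one_div_cancel hq0.ne', ENNReal.rpow_one]

/-- With truncated subtraction the exponent is `|n - j|`; cutting at `n` leaves two geometric
series. For `r ≥ 1` the right side is `∞`. -/
theorem tsum_pow_dist_le (r : ℝ≥0∞) (n : ℕ) :
    ∑' j, r ^ ((n - j) + (j - n)) ≤ 2 * (1 - r)⁻¹ := by
  rw [← ENNReal.summable.sum_add_tsum_nat_add' (k := n), two_mul, ← ENNReal.tsum_geometric]
  refine add_le_add ?_ (le_of_eq ?_)
  · refine le_trans (le_of_eq ?_) (ENNReal.sum_le_tsum ((Finset.range n).map (addRightEmbedding 1)))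
    rw [Finset.sum_map, ← Finset.sum_range_reflect]
    refine Finset.sum_congr rfl fun j hj => ?_
    have := Finset.mem_range.1 hj
    congr 1
    simp only [addRightEmbedding_apply]
    omega
  · refine tsum_congr fun i => ?_
    congr 1
    omega

/-- Weighted Hölder inequality with total weight at most `S`: the convexity step in the Young
inequality. -/
theorem tsum_mul_rpow_le {ι : Type*} {q : ℝ} (hq : 1 ≤ q) (w b : ι → ℝ≥0∞) {S : ℝ≥0∞}
    (hw : ∑' j, w j ≤ S) : (∑' j, w j * b j) ^ q ≤ S ^ (q - 1) * ∑' j, w j * b j ^ q := by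
  have hq0 : 0 < q := by linarith
  have hq1 : 0 ≤ 1 - q⁻¹ := by
    rw [sub_nonneg]
    exact inv_le_one_of_one_le₀ hq
  have h1 : ∑' j, w j * b j ≤ S ^ (1 - q⁻¹) * (∑' j, w j * b j ^ q) ^ q⁻¹ := by
    rw [ENNReal.tsum_eq_iSup_sum]
    refine iSup_le fun s => (ENNReal.inner_le_weight_mul_Lp_of_nonneg s hq w b).trans ?_
    gcongr
    · exact (ENNReal.sum_le_tsum s).trans hw
    · exact ENNReal.sum_le_tsum s
  refine (ENNReal.rpow_le_rpow h1 hq0.le).trans (le_of_eq ?_)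
  rw [ENNReal.mul_rpow_of_nonneg _ _ hq0.le, ← ENNReal.rpow_mul, ← ENNReal.rpow_mul,
    inv_mul_cancel₀ hq0.ne', ENNReal.rpow_one, sub_mul, one_mul, inv_mul_cancel₀ hq0.ne']

/-- A discrete Young inequality. -/
theorem lqNorm_conv_le {q : ℝ≥0∞} (hq : 1 ≤ q) (r : ℝ≥0∞) (b : ℕ → ℝ≥0∞) :
    lqNorm q (fun n => ∑' j, r ^ ((n - j) + (j - n)) * b j) ≤ 2 * (1 - r)⁻¹ * lqNorm q b := by
  set S := 2 * (1 - r)⁻¹ with hS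
  unfold lqNorm
  split_ifs with h
  · refine iSup_le fun n => ?_
    calc ∑' j, r ^ ((n - j) + (j - n)) * b j
        ≤ ∑' j, r ^ ((n - j) + (j - n)) * ⨆ j, b j := by
          gcongr with j
          exact le_iSup b j
      _ ≤ S * ⨆ j, b j := by
          rw [ENNReal.tsum_mul_right]
          gcongr
          exact tsum_pow_dist_le r n
  · have hq1 := one_le_toReal hq h
    set Q := q.toReal
    have hQ : 0 < Q := by linarith
    have key : ∑' n, (∑' j, r ^ ((n - j) + (j - n)) * b j) ^ Q ≤ S ^ Q * ∑' j, b j ^ Q := by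
      calc ∑' n, (∑' j, r ^ ((n - j) + (j - n)) * b j) ^ Q
          ≤ ∑' n, S ^ (Q - 1) * ∑' j, r ^ ((n - j) + (j - n)) * b j ^ Q :=
            ENNReal.tsum_le_tsum fun n => tsum_mul_rpow_le hq1 _ _ (tsum_pow_dist_le r n)
        _ = S ^ (Q - 1) * ∑' j, (∑' n, r ^ ((n - j) + (j - n))) * b j ^ Q := by
            rw [ENNReal.tsum_mul_left, ENNReal.tsum_comm]
            simp only [ENNReal.tsum_mul_right]
        _ ≤ S ^ (Q - 1) * ∑' j, S * b j ^ Q := by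
            gcongr with j
            refine le_trans (le_of_eq ?_) (tsum_pow_dist_le r j)
            refine tsum_congr fun n => ?_
            rw [add_comm]
        _ = S ^ Q * ∑' j, b j ^ Q := by
            rw [ENNReal.tsum_mul_left, ← mul_assoc]
            congr 1
            conv_rhs => rw [show Q = (Q - 1) + 1 by ring]
            rw [ENNReal.rpow_add_of_nonneg _ _ (by linarith) zero_le_one, ENNReal.rpow_one]
    refine (ENNReal.rpow_le_rpow key (by positivity)).trans (le_of_eq ?_)
    rw [ENNReal.mul_rpow_of_nonneg _ _ (by positivity), ← ENNReal.rpow_mul,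
      mul_one_div_cancel hQ.ne', ENNReal.rpow_one]

theorem lqNorm_le_of_le_conv {q : ℝ≥0∞} (hq : 1 ≤ q) {r C : ℝ≥0∞} {b v : ℕ → ℝ≥0∞}
    (h : ∀ n, v n ≤ C * ∑' j, r ^ ((n - j) + (j - n)) * b j) :
    lqNorm q v ≤ C * (2 * (1 - r)⁻¹) * lqNorm q b := by
  refine (lqNorm_mono q h).trans ?_
  rw [lqNorm_const_mul hq, mul_assoc]
  gcongr
  exact lqNorm_conv_le hq r b

/-! ### Discretization of the interpolation norm -/

/-- The norm `(∫_0^∞ (t^{-η} κ(t))^q dt/t)^{1/q}`, a supremum for `q = ∞`. -/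
def scaleNorm (η : ℝ) (q : ℝ≥0∞) (κ : ℝ → ℝ≥0∞) : ℝ≥0∞ :=
  if q = ∞ then ⨆ (t : ℝ) (_ : 0 < t), ENNReal.ofReal (t ^ (-η)) * κ t
  else (∫⁻ t in Ioi (0 : ℝ),
    (ENNReal.ofReal (t ^ (-η)) * κ t) ^ q.toReal * ENNReal.ofReal (1 / t)) ^ (1 / q.toReal)

/-- The values of `t^{-η} κ(t)` along a geometric sequence. -/
def dyadic (η T : ℝ) (κ : ℝ → ℝ≥0∞) (n : ℕ) : ℝ≥0∞ :=
  ENNReal.ofReal ((T ^ n) ^ η) * κ ((T ^ n)⁻¹)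

theorem inv_rpow_neg_eq {x : ℝ} (hx : 0 < x) (η : ℝ) : (x⁻¹) ^ (-η) = x ^ η := by
  rw [Real.inv_rpow hx.le, Real.rpow_neg hx.le, inv_inv]

/-- By monotonicity `κ(T^{-n})` is at most `κ` on `(T^{-n}, T^{1-n}]`. There `t^{-η}` loses at most
`T^η`, and the bound `1/t ≥ T^{n-1}` gives mass at least `1 - 1/T ≥ 1/2`, whence the factor `2`. -/
theorem lqNorm_dyadic_le {q : ℝ≥0∞} (hq : 1 ≤ q) {η T : ℝ} (hη : 0 < η) (hT : 2 ≤ T)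
    {κ : ℝ → ℝ≥0∞} (hκ : ∀ s t, 0 < s → s ≤ t → κ s ≤ κ t) :
    lqNorm q (dyadic η T κ) ≤ ENNReal.ofReal (2 * T ^ η) * scaleNorm η q κ := by
  have hT0 : 0 < T := by linarith
  have hTη : 1 ≤ T ^ η := Real.one_le_rpow (by linarith) hη.le
  unfold lqNorm scaleNorm
  split_ifs with h
  · refine iSup_le fun n => ?_
    refine le_trans ?_ (le_mul_of_one_le_left' (ENNReal.one_le_ofReal.2 (by linarith)))
    refine le_trans (le_of_eq ?_) (le_iSup₂ (f := fun (t : ℝ) (_ : 0 < t) =>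
      ENNReal.ofReal (t ^ (-η)) * κ t) ((T ^ n)⁻¹) (by positivity))
    rw [inv_rpow_neg_eq (by positivity)]
    rfl
  · have hq1 := one_le_toReal hq h
    set Q := q.toReal
    have hQ : 0 < Q := by linarith
    set I := ∫⁻ t in Ioi (0 : ℝ), (ENNReal.ofReal (t ^ (-η)) * κ t) ^ Q * ENNReal.ofReal (1 / t)
    set f : ℕ → ℝ := fun n => T * (T ^ n)⁻¹ with hf
    have hf1 : ∀ n, f (n + 1) = (T ^ n)⁻¹ := fun n => by
      rw [hf]
      simp only [pow_succ]
      field_simp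
    have hanti : Antitone f := antitone_nat_of_succ_le fun n => by
      rw [hf1]
      exact le_mul_of_one_le_left (by positivity) (by linarith)
    have hdisj : Pairwise (Function.onFun Disjoint fun n => Ioc (f (n + 1)) (f n)) :=
      hanti.pairwise_disjoint_on_Ioc_succ
    have hterm : ∀ n, dyadic η T κ n ^ Q ≤ (ENNReal.ofReal (T ^ η) ^ Q * 2) *
        ∫⁻ t in Ioc (f (n + 1)) (f n),
          (ENNReal.ofReal (t ^ (-η)) * κ t) ^ Q * ENNReal.ofReal (1 / t) := by
      intro n
      set a : ℝ := (T ^ n)⁻¹ with ha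
      have ha0 : 0 < a := by positivity
      have h1 : ∀ t ∈ Ioc (f (n + 1)) (f n),
          (ENNReal.ofReal ((T * a) ^ (-η)) * κ a) ^ Q * ENNReal.ofReal (1 / (T * a)) ≤
          (ENNReal.ofReal (t ^ (-η)) * κ t) ^ Q * ENNReal.ofReal (1 / t) := by
        intro t ht
        rw [hf1] at ht
        have ht0 : 0 < t := ha0.trans ht.1
        have ht2 : t ≤ T * a := ht.2
        exact mul_le_mul' (ENNReal.rpow_le_rpow (mul_le_mul' (ENNReal.ofReal_le_ofReal
          (Real.rpow_le_rpow_of_nonpos ht0 ht2 (by linarith))) (hκ _ _ ha0 ht.1.le)) hQ.le)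
          (ENNReal.ofReal_le_ofReal (one_div_le_one_div_of_le ht0 ht2))
      have h2 := setLIntegral_mono' (μ := volume) measurableSet_Ioc h1
      rw [setLIntegral_const, Real.volume_Ioc, hf1] at h2
      calc dyadic η T κ n ^ Q
          = ENNReal.ofReal (T ^ η) ^ Q * (ENNReal.ofReal ((T * a) ^ (-η)) * κ a) ^ Q := by
            rw [← ENNReal.mul_rpow_of_nonneg _ _ hQ.le, ← mul_assoc,
              ← ENNReal.ofReal_mul (by positivity), Real.mul_rpow hT0.le ha0.le, ← mul_assoc,
              ← Real.rpow_add hT0, add_neg_cancel, Real.rpow_zero, one_mul, ha,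
              inv_rpow_neg_eq (by positivity)]
            rfl
        _ ≤ ENNReal.ofReal (T ^ η) ^ Q * (2 * ((ENNReal.ofReal ((T * a) ^ (-η)) * κ a) ^ Q *
              ENNReal.ofReal (1 / (T * a)) * ENNReal.ofReal (f n - a))) := by
            gcongr
            rw [mul_assoc, mul_left_comm]
            refine le_mul_of_one_le_right' ?_
            rw [← ENNReal.ofReal_mul (by positivity), ← ENNReal.ofReal_ofNat,
              ← ENNReal.ofReal_mul (by norm_num)]
            refine ENNReal.one_le_ofReal.2 ?_
            change 1 ≤ 2 * (1 / (T * a) * (T * a - a))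
            rw [mul_comm (1 / (T * a)), mul_one_div, mul_div_assoc', le_div_iff₀ (by positivity)]
            nlinarith
        _ ≤ _ := by
            rw [← mul_assoc, hf1]
            exact mul_le_mul' le_rfl h2
    have hsum : ∑' n, dyadic η T κ n ^ Q ≤ (ENNReal.ofReal (T ^ η) ^ Q * 2) * I := by
      refine (ENNReal.tsum_le_tsum hterm).trans ?_
      rw [ENNReal.tsum_mul_left, ← lintegral_iUnion (fun n => measurableSet_Ioc) hdisj]
      gcongr
      refine lintegral_mono_set (iUnion_subset fun n t ht => ?_)
      have h1 : f (n + 1) < t := ht.1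
      rw [hf1] at h1
      exact lt_trans (by positivity) h1
    refine (ENNReal.rpow_le_rpow hsum (by positivity)).trans ?_
    rw [ENNReal.mul_rpow_of_nonneg _ _ (by positivity), ENNReal.mul_rpow_of_nonneg _ _ (by positivity),
      ← ENNReal.rpow_mul, mul_one_div_cancel hQ.ne', ENNReal.rpow_one, mul_comm 2,
      ENNReal.ofReal_mul (by positivity), ENNReal.ofReal_ofNat]
    gcongr
    calc (2 : ℝ≥0∞) ^ (1 / Q) ≤ 2 ^ (1 : ℝ) := by
          refine ENNReal.rpow_le_rpow_of_exponent_le (by norm_num) ?_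
          rw [div_le_one hQ]
          exact hq1
      _ = 2 := ENNReal.rpow_one _

theorem setLIntegral_rpow_ne_top {η Q : ℝ} (hη : 0 < η) (hQ : 0 < Q) :
    ∫⁻ t in Ioi (1 : ℝ), ENNReal.ofReal (t ^ (-η)) ^ Q * ENNReal.ofReal (1 / t) ≠ ∞ := by
  have h := (integrableOn_Ioi_rpow_of_lt (a := -η * Q - 1) (by nlinarith) one_pos).lintegral_lt_top
  refine ne_of_eq_of_ne (setLIntegral_congr_fun measurableSet_Ioi fun t ht => ?_) h.ne
  have ht0 : (0 : ℝ) < t := one_pos.trans ht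
  rw [ENNReal.ofReal_rpow_of_nonneg (by positivity) hQ.le, ← ENNReal.ofReal_mul (by positivity),
    ← Real.rpow_mul ht0.le, Real.rpow_sub_one ht0.ne', mul_one_div]

/-- On `(0, 1]` the comparison with the geometric sequence is reversed. For `t > 1` the sequence
says nothing; the uniform bound `L` is used, and `t^{-η}` is integrable to the power `q` against
`dt/t` since `η > 0`. -/
theorem exists_scaleNorm_le {q : ℝ≥0∞} (hq : 1 ≤ q) {η T : ℝ} (hη : 0 < η) (hT : 2 ≤ T) :
    ∃ C : ℝ≥0∞, C ≠ ∞ ∧ ∀ (κ : ℝ → ℝ≥0∞), (∀ s t, 0 < s → s ≤ t → κ s ≤ κ t) → ∀ L : ℝ≥0∞,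
      (∀ t, 0 < t → κ t ≤ L) → scaleNorm η q κ ≤ C * (lqNorm q (dyadic η T κ) + L) := by
  have hT0 : 0 < T := by linarith
  have hT1 : T⁻¹ < 1 := inv_lt_one_of_one_lt₀ (by linarith)
  have hTη : 1 ≤ T ^ η := Real.one_le_rpow (by linarith) hη.le
  have hpt : ∀ (κ : ℝ → ℝ≥0∞), (∀ s t, 0 < s → s ≤ t → κ s ≤ κ t) → ∀ (n : ℕ) (t : ℝ),
      (T ^ (n + 1))⁻¹ < t → t ≤ (T ^ n)⁻¹ →
      ENNReal.ofReal (t ^ (-η)) * κ t ≤ ENNReal.ofReal (T ^ η) * dyadic η T κ n := by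
    intro κ hκ n t h1 h2
    have ht0 : 0 < t := lt_trans (by positivity) h1
    rw [dyadic, ← mul_assoc, ← ENNReal.ofReal_mul (by positivity)]
    refine mul_le_mul' (ENNReal.ofReal_le_ofReal ?_) (hκ _ _ ht0 h2)
    refine (Real.rpow_le_rpow_of_nonpos (by positivity) h1.le (by linarith)).trans (le_of_eq ?_)
    rw [inv_rpow_neg_eq (by positivity), pow_succ', Real.mul_rpow hT0.le (by positivity)]
  have hnear : ∀ t : ℝ, 0 < t → t ≤ 1 → ∃ n : ℕ, (T ^ (n + 1))⁻¹ < t ∧ t ≤ (T ^ n)⁻¹ := by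
    intro t h0 h1
    simpa only [inv_pow] using exists_nat_pow_near_of_lt_one h0 h1 (inv_pos.2 hT0) hT1
  have hone : ∀ t : ℝ, 1 ≤ t → t ^ (-η) ≤ 1 := fun t ht =>
    Real.rpow_le_one_of_one_le_of_nonpos ht (by linarith)
  by_cases h : q = ∞
  · refine ⟨ENNReal.ofReal (T ^ η), ENNReal.ofReal_ne_top, fun κ hκ L hL => ?_⟩
    have hC : 1 ≤ ENNReal.ofReal (T ^ η) := ENNReal.one_le_ofReal.2 hTη
    rw [scaleNorm, if_pos h]
    refine iSup₂_le fun t ht => ?_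
    rcases le_total t 1 with h1 | h1
    · obtain ⟨n, hn1, hn2⟩ := hnear t ht h1
      refine (hpt κ hκ n t hn1 hn2).trans ?_
      gcongr
      exact (le_lqNorm hq _ n).trans le_self_add
    · refine mul_le_mul' ((ENNReal.ofReal_le_one.2 (hone t h1)).trans hC) ((hL t ht).trans le_add_self)
  · have hq1 := one_le_toReal hq h
    set Q := q.toReal with hQdef
    have hQ : 0 < Q := by linarith
    have hQ1 : 1 / Q ≤ 1 := by rw [div_le_one hQ]; exact hq1
    set c₀ := ∫⁻ t in Ioi (1 : ℝ), ENNReal.ofReal (t ^ (-η)) ^ Q * ENNReal.ofReal (1 / t) with hc₀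
    have hc₀t : c₀ ≠ ∞ := setLIntegral_rpow_ne_top hη hQ
    -- The second factor `T` bounds crudely the length of `(T^{-n-1}, T^{-n}]` times the supremum of
    -- `1/t` on it.
    set c₁ : ℝ≥0∞ := ENNReal.ofReal (T ^ η) ^ Q * ENNReal.ofReal T with hc₁
    have hc₁t : c₁ ≠ ∞ := by finiteness
    refine ⟨c₁ ^ (1 / Q) + c₀ ^ (1 / Q), by finiteness, fun κ hκ L hL => ?_⟩
    rw [scaleNorm, if_neg h, lqNorm, if_neg h, ← hQdef]
    set V := ∑' n, dyadic η T κ n ^ Q with hV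
    have hterm : ∀ n : ℕ, ∫⁻ t in Ioc ((T ^ (n + 1))⁻¹) ((T ^ n)⁻¹),
        (ENNReal.ofReal (t ^ (-η)) * κ t) ^ Q * ENNReal.ofReal (1 / t) ≤
        c₁ * dyadic η T κ n ^ Q := by
      intro n
      have h1 : ∀ t ∈ Ioc ((T ^ (n + 1))⁻¹) ((T ^ n)⁻¹),
          (ENNReal.ofReal (t ^ (-η)) * κ t) ^ Q * ENNReal.ofReal (1 / t) ≤
          (ENNReal.ofReal (T ^ η) * dyadic η T κ n) ^ Q * ENNReal.ofReal (T ^ (n + 1)) := by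
        intro t ht
        gcongr ?_ ^ Q * ENNReal.ofReal ?_
        · exact hpt κ hκ n t ht.1 ht.2
        · rw [one_div]
          exact inv_le_of_inv_le₀ (by positivity) ht.1.le
      refine (setLIntegral_mono' measurableSet_Ioc h1).trans ?_
      rw [setLIntegral_const, Real.volume_Ioc, ENNReal.mul_rpow_of_nonneg _ _ hQ.le, mul_assoc,
        hc₁, ← ENNReal.ofReal_mul (by positivity)]
      refine (mul_le_mul' le_rfl (ENNReal.ofReal_le_ofReal ?_)).trans
        (le_of_eq (mul_right_comm _ _ (ENNReal.ofReal T)))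
      calc T ^ (n + 1) * ((T ^ n)⁻¹ - (T ^ (n + 1))⁻¹) ≤ T ^ (n + 1) * (T ^ n)⁻¹ := by
            gcongr
            exact sub_le_self _ (by positivity)
        _ = T := by rw [pow_succ']; field_simp
    have hI : ∫⁻ t in Ioi (0 : ℝ), (ENNReal.ofReal (t ^ (-η)) * κ t) ^ Q * ENNReal.ofReal (1 / t) ≤
        c₁ * V + c₀ * L ^ Q := by
      have hsub : Ioi (0 : ℝ) ⊆ (⋃ n : ℕ, Ioc ((T ^ (n + 1))⁻¹) ((T ^ n)⁻¹)) ∪ Ioi 1 := by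
        intro t ht
        rcases le_or_gt t 1 with h1 | h1
        · obtain ⟨n, hn⟩ := hnear t ht h1
          exact Or.inl (mem_iUnion.2 ⟨n, hn⟩)
        · exact Or.inr h1
      refine (lintegral_mono_set hsub).trans ((lintegral_union_le _ _ _).trans (add_le_add ?_ ?_))
      · refine (lintegral_iUnion_le _ _).trans ?_
        rw [hV, ← ENNReal.tsum_mul_left]
        exact ENNReal.tsum_le_tsum hterm
      · rw [hc₀, ← lintegral_mul_const _ (by fun_prop)]
        refine setLIntegral_mono' measurableSet_Ioi fun t ht => ?_
        rw [ENNReal.mul_rpow_of_nonneg _ _ hQ.le, mul_right_comm]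
        gcongr
        exact hL t (one_pos.trans ht)
    clear_value c₁
    refine (ENNReal.rpow_le_rpow hI (by positivity)).trans ?_
    refine (ENNReal.rpow_add_le_add_rpow _ _ (by positivity) hQ1).trans ?_
    rw [ENNReal.mul_rpow_of_nonneg _ _ (by positivity), ENNReal.mul_rpow_of_nonneg _ _ (by positivity),
      ← ENNReal.rpow_mul L, mul_one_div_cancel hQ.ne', ENNReal.rpow_one, add_mul]
    gcongr
    · exact le_self_add
    · exact le_add_self

end QTorus

namespace QTorus

variable {d : ℕ} {θ : Matrix (Fin d) (Fin d) ℝ} {p : ℝ≥0∞} {F G : Functional d}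
  {φ : 𝓢(EuclideanSpace ℝ (Fin d), ℝ)}

/-! ### Besov spaces as interpolation spaces -/

theorem kFunctional_mono {E : Type*} [Add E] (X₀ X₁ : Set E) (N₀ N₁ : E → ℝ≥0∞) (x : E) {s t : ℝ}
    (h : s ≤ t) : kFunctional X₀ X₁ N₀ N₁ x s ≤ kFunctional X₀ X₁ N₀ N₁ x t := by
  unfold kFunctional
  gcongr

/-- The K-functional of the couple `(L_p, W^k_p)`. -/
def kLpSobolev (θ : Matrix (Fin d) (Fin d) ℝ) (k : ℕ) (p : ℝ≥0∞) (x : Functional d) (t : ℝ) :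
    ℝ≥0∞ :=
  kFunctional (Lp θ p) (Sobolev θ k p) (lpNorm θ p) (sobolevNorm θ k p) x t

/-- The sequence whose `ℓ^q` norm is the Besov norm. -/
def besovSeq (θ : Matrix (Fin d) (Fin d) ℝ) (φ : 𝓢(EuclideanSpace ℝ (Fin d), ℝ)) (α : ℝ)
    (p : ℝ≥0∞) (F : Functional d) : ℕ → ℝ≥0∞
  | 0 => ‖coeff θ F 0‖ₑ
  | j + 1 => ENNReal.ofReal ((2 : ℝ) ^ ((j : ℝ) * α)) * lpNorm θ p (block φ j F)

theorem besovNorm_eq (α : ℝ) (q : ℝ≥0∞) (F : Functional d) :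
    besovNorm θ φ α p q F = lqNorm q (besovSeq θ φ α p F) := by
  unfold besovNorm lqNorm
  split_ifs
  · exact sup_iSup_nat_succ (besovSeq θ φ α p F)
  · rw [tsum_eq_zero_add' (f := fun j => besovSeq θ φ α p F j ^ q.toReal) ENNReal.summable]
    rfl

theorem two_rpow_mul (η : ℝ) (k j : ℕ) :
    (2 : ℝ) ^ ((j : ℝ) * (η * k)) = (((2 : ℝ) ^ k) ^ j) ^ η := by
  rw [← pow_mul, ← Real.rpow_natCast, ← Real.rpow_mul (by norm_num)]
  congr 1
  push_cast
  ring

/-- In any decomposition `x₀ + x₁`, block `j` is bounded on the `L_p` part and gains `2^{-jk}` on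
the Sobolev part, so it is controlled by `K(2^{-jk})`. The mean is controlled by `K(1)`. -/
theorem IsLittlewoodPaley.exists_besovNorm_le (hφ : IsLittlewoodPaley φ) {k : ℕ} (hk : 1 ≤ k)
    {η : ℝ} (hη : 0 < η) {q : ℝ≥0∞} (hq : 1 ≤ q) :
    ∃ C : ℝ≥0∞, C ≠ ∞ ∧ ∀ (θ : Matrix (Fin d) (Fin d) ℝ) (p : ℝ≥0∞), 1 ≤ p → ∀ x : Functional d,
      besovNorm θ φ (η * k) p q x ≤ C * scaleNorm η q (kLpSobolev θ k p x) := by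
  obtain ⟨C₀, hC₀, h0⟩ := hφ.exists_mulBound_blockSymbol
  obtain ⟨C₁, hC₁, h1⟩ := hφ.exists_lpNorm_block_le k
  set T : ℝ := 2 ^ k with hT
  have hT2 : 2 ≤ T := by
    calc (2 : ℝ) = 2 ^ 1 := (pow_one 2).symm
      _ ≤ T := pow_le_pow_right₀ (by norm_num) hk
  set B : ℝ≥0∞ := (1 + 2 ^ k + d ^ k) + (1 + (C₀ + C₁)) with hB
  have hBt : B ≠ ∞ := by finiteness
  have hhalf : (1 - (2 : ℝ≥0∞)⁻¹)⁻¹ ≠ ∞ := by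
    rw [ENNReal.one_sub_inv_two, inv_inv]
    exact ENNReal.ofNat_ne_top
  refine ⟨(B * 2) * (2 * (1 - 2⁻¹)⁻¹) * ENNReal.ofReal (2 * T ^ η), by finiteness,
    fun θ p hp x => ?_⟩
  set κ := kLpSobolev θ k p x with hκ
  have hblock : ∀ j : ℕ, lpNorm θ p (block φ j x) ≤ (1 + (C₀ + C₁)) * κ ((T ^ j)⁻¹) := by
    intro j
    rw [hκ]
    unfold kLpSobolev kFunctional
    have hne : 1 + (C₀ + C₁) ≠ 0 := (one_pos.trans_le le_self_add).ne'
    have ht : 1 + (C₀ + C₁) ≠ ∞ := by finiteness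
    rw [ENNReal.mul_iInf_of_ne hne ht]
    refine le_iInf fun x₀ => ?_
    rw [ENNReal.mul_iInf_of_ne hne ht]
    refine le_iInf fun x₁ => ?_
    rw [ENNReal.mul_iInf_of_ne hne ht]
    refine le_iInf fun ⟨hx₀, hx₁, hx⟩ => ?_
    have hj : (((2 : ℝ) ^ j)⁻¹) ^ k = (T ^ j)⁻¹ := by
      rw [hT, inv_pow, ← pow_mul, ← pow_mul, mul_comm]
    have h2 := h1 θ p hp x₁ hx₁ j
    rw [hj] at h2
    rw [hx, block, mult_add, mul_add]
    exact (lpNorm_add_le hp _ _).trans (add_le_add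
      (((h0 j).lpNorm_le _ hp hx₀).trans (mul_le_mul' (le_self_add.trans le_add_self) le_rfl))
      (h2.trans (mul_le_mul' (le_add_self.trans le_add_self) le_rfl)))
  -- Block `n` has index `n + 1` in `besovSeq`. The shift is hidden in a convolution with ratio
  -- `1/2`, whose loss at distance one is repaid by the factor `2`.
  have hseq : ∀ n, besovSeq θ φ (η * k) p x n ≤
      (B * 2) * ∑' j, (2⁻¹ : ℝ≥0∞) ^ ((n - j) + (j - n)) * dyadic η T κ j := by
    intro n
    cases n with
    | zero =>
      have h := modulus_le_kFunctional (θ := θ) hp k x one_pos le_rfl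
      rw [one_pow, ENNReal.ofReal_one, one_mul] at h
      have h2 : ‖coeff θ x 0‖ₑ ≤ B * dyadic η T κ 0 := by
        refine (le_self_add.trans h).trans ?_
        rw [dyadic, pow_zero, Real.one_rpow, inv_one, ENNReal.ofReal_one, one_mul]
        exact mul_le_mul' le_self_add le_rfl
      refine h2.trans (mul_le_mul' (le_mul_of_one_le_right' one_le_two) ?_)
      simpa using ENNReal.le_tsum (f := fun j : ℕ => (2⁻¹ : ℝ≥0∞) ^ ((0 - j) + (j - 0)) * dyadic η T κ j) 0
    | succ n =>
      have h2 : besovSeq θ φ (η * k) p x (n + 1) ≤ B * dyadic η T κ n := by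
        change ENNReal.ofReal _ * _ ≤ _
        rw [two_rpow_mul, dyadic, mul_left_comm]
        gcongr
        exact (hblock n).trans (mul_le_mul' le_add_self le_rfl)
      refine h2.trans ?_
      rw [mul_assoc]
      gcongr
      have h3 := ENNReal.le_tsum (f := fun j : ℕ =>
        (2⁻¹ : ℝ≥0∞) ^ ((n + 1 - j) + (j - (n + 1))) * dyadic η T κ j) n
      have e : (n + 1 - n) + (n - (n + 1)) = 1 := by omega
      simp only [e, pow_one] at h3
      calc dyadic η T κ n = 2 * (2⁻¹ * dyadic η T κ n) := by
            rw [← mul_assoc, ENNReal.mul_inv_cancel (by norm_num) (by norm_num), one_mul]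
        _ ≤ _ := by gcongr
  rw [besovNorm_eq]
  refine (lqNorm_le_of_le_conv hq hseq).trans ?_
  rw [mul_assoc _ (ENNReal.ofReal _)]
  gcongr
  exact lqNorm_dyadic_le hq hη hT2 fun s t _ hst => kFunctional_mono _ _ _ _ x hst

theorem scalar_zero : (scalar 0 : Functional d) = 0 := by
  ext a
  simp [scalar_apply]

/-- The mean and the Littlewood-Paley blocks. -/
def piece (θ : Matrix (Fin d) (Fin d) ℝ) (φ : 𝓢(EuclideanSpace ℝ (Fin d), ℝ)) (F : Functional d) :
    ℕ → Functional d
  | 0 => scalar (coeff θ F 0)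
  | j + 1 => block φ j F

/-- Bounds for the norms of the pieces. -/
def pieceBound (θ : Matrix (Fin d) (Fin d) ℝ) (φ : 𝓢(EuclideanSpace ℝ (Fin d), ℝ)) (p : ℝ≥0∞)
    (F : Functional d) : ℕ → ℝ≥0∞
  | 0 => ‖coeff θ F 0‖ₑ
  | j + 1 => lpNorm θ p (block φ j F)

theorem lpNorm_piece_le (hp : 1 ≤ p) (F : Functional d) (j : ℕ) :
    lpNorm θ p (piece θ φ F j) ≤ pieceBound θ φ p F j := by
  cases j with
  | zero => exact lpNorm_scalar_le hp _
  | succ j => exact le_rfl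

theorem IsLittlewoodPaley.hasSum_piece (hφ : IsLittlewoodPaley φ) (hF : IsDistribution θ F)
    (a : Test d) : HasSum (fun j => piece θ φ F j a) (F a) := by
  have h := (hasSum_nat_add_iff' (f := fun j => piece θ φ F j a) (g := F a) 1).1
  refine h ?_
  rw [Finset.sum_range_one]
  exact hφ.hasSum_block hF a

/-- The first `n` pieces form the smooth part, estimated by Bernstein's inequality; the remaining
series converges absolutely in `L_p` and forms the rough part. -/
theorem IsLittlewoodPaley.exists_kFunctional_le (hφ : IsLittlewoodPaley φ) {k : ℕ} :
    ∃ C : ℝ≥0∞, C ≠ ∞ ∧ ∀ (θ : Matrix (Fin d) (Fin d) ℝ) (p : ℝ≥0∞), 1 ≤ p → ∀ x : Functional d,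
      IsDistribution θ x → ∑' j, pieceBound θ φ p x j ≠ ∞ → ∀ (n : ℕ) (t : ℝ),
      kLpSobolev θ k p x t ≤ ∑' i, pieceBound θ φ p x (i + n) + ENNReal.ofReal t *
        ∑ j ∈ Finset.range n, C * (ENNReal.ofReal (((2 : ℝ) ^ k) ^ j) * pieceBound θ φ p x j) := by
  obtain ⟨C, hC, h⟩ := hφ.exists_sobolevNorm_block_le k
  refine ⟨(multiIdx d k).card * ((multiIdx d k).card + C), by finiteness, fun θ p hp x hx he n t => ?_⟩
  set e := pieceBound θ φ p x with he_def
  have hmem : ∀ j, piece θ φ x j ∈ Lp θ p := fun j => mem_Lp_of_lpNorm_ne_top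
    (ne_top_of_le_ne_top (ENNReal.ne_top_of_tsum_ne_top he j) (lpNorm_piece_le hp x j))
  have hsob : ∀ j, piece θ φ x j ∈ Sobolev θ k p ∧ sobolevNorm θ k p (piece θ φ x j) ≤
      ((multiIdx d k).card + C) * (ENNReal.ofReal (((2 : ℝ) ^ k) ^ j) * e j) := by
    intro j
    cases j with
    | zero =>
      refine ⟨scalar_mem_Sobolev hp k _, (sobolevNorm_scalar_le hp k _).trans ?_⟩
      rw [pow_zero, ENNReal.ofReal_one, one_mul]
      exact mul_le_mul' le_self_add le_rfl
    | succ j =>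
      obtain ⟨h1, h2⟩ := h θ p hp x j (hmem (j + 1))
      -- Piece `j + 1` is block `j`, so the weight has a factor `2^k` to spare.
      refine ⟨h1, h2.trans (mul_le_mul' le_add_self (mul_le_mul' (ENNReal.ofReal_le_ofReal ?_) le_rfl))⟩
      rw [← pow_mul, mul_comm, pow_mul]
      exact pow_le_pow_right₀ (one_le_pow₀ (by norm_num)) (Nat.le_succ j)
  set x₁ : Functional d := ∑ j ∈ Finset.range n, piece θ φ x j with hx₁
  have hx₁m : x₁ ∈ Lp θ p := sum_mem_Lp hp _ fun j _ => hmem j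
  have hD : ∀ α, D α x₁ = ∑ j ∈ Finset.range n, D α (piece θ φ x j) := fun α => by
    simp only [D_eq_mult]
    exact mult_sum _ _ _
  have hx₁s : x₁ ∈ Sobolev θ k p := by
    refine ⟨isDistribution_of_mem_Lp hp hx₁m, fun α hα => ?_⟩
    rw [hD]
    exact sum_mem_Lp hp _ fun j _ => (hsob j).1.2 α hα
  have hx₀ := lpNorm_le_tsum hp (F := x - x₁) (G := fun i => piece θ φ x (i + n))
    (ne_top_of_le_ne_top he ((ENNReal.tsum_le_tsum fun i => lpNorm_piece_le hp x (i + n)).trans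
      (ENNReal.tsum_comp_le_tsum_of_injective (add_left_injective n) e))) fun a => by
      have := (hasSum_nat_add_iff' n).2 (hφ.hasSum_piece hx a)
      rwa [LinearMap.sub_apply, hx₁, LinearMap.sum_apply]
  refine (kFunctional_le hx₀.1 hx₁s (sub_add_cancel x x₁).symm t).trans ?_
  gcongr
  · exact hx₀.2.trans (ENNReal.tsum_le_tsum fun i => lpNorm_piece_le hp x (i + n))
  · calc sobolevNorm θ k p x₁ ≤ ∑ α ∈ multiIdx d k, lpNorm θ p (D α x₁) :=
          sobolevNorm_le_sum hp k _
      _ ≤ ∑ α ∈ multiIdx d k, ∑ j ∈ Finset.range n, sobolevNorm θ k p (piece θ φ x j) := by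
          gcongr with α hα
          rw [hD]
          exact (lpNorm_sum_le hp _ _).trans
            (Finset.sum_le_sum fun j _ => lpNorm_D_le_sobolevNorm hp hα _)
      _ = ∑ j ∈ Finset.range n, (multiIdx d k).card * sobolevNorm θ k p (piece θ φ x j) := by
          rw [Finset.sum_const, nsmul_eq_mul, Finset.mul_sum]
      _ ≤ _ := by
          refine Finset.sum_le_sum fun j _ => ?_
          rw [mul_assoc]
          exact mul_le_mul' le_rfl (hsob j).2

end QTorus

namespace QTorus

/-! ### The Besov norm controls the interpolation norm, and the conclusion. -/

variable {d : ℕ} {θ : Matrix (Fin d) (Fin d) ℝ} {p : ℝ≥0∞} {F G : Functional d}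
  {φ : 𝓢(EuclideanSpace ℝ (Fin d), ℝ)}

/-- The factor `2^{kη}` pays for the index shift between blocks and sequence. -/
theorem pieceBound_le {η : ℝ} (hη : 0 < η) (k : ℕ) (x : Functional d) (j : ℕ) :
    pieceBound θ φ p x j ≤ ENNReal.ofReal (((2 : ℝ) ^ k) ^ η) *
      (ENNReal.ofReal ((((2 : ℝ) ^ k) ^ j) ^ (-η)) * besovSeq θ φ (η * k) p x j) := by
  set T : ℝ := 2 ^ k with hT
  have hT0 : 0 < T := by positivity
  have hT1 : 1 ≤ T := one_le_pow₀ (by norm_num)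
  rw [← mul_assoc, ← ENNReal.ofReal_mul (by positivity)]
  cases j with
  | zero =>
    rw [pow_zero, Real.one_rpow, mul_one]
    exact le_mul_of_one_le_left' (ENNReal.one_le_ofReal.2 (Real.one_le_rpow hT1 hη.le))
  | succ j =>
    change _ ≤ _ * (_ * lpNorm θ p (block φ j x))
    rw [two_rpow_mul, ← mul_assoc, ← ENNReal.ofReal_mul (by positivity), pow_succ,
      Real.mul_rpow (by positivity) hT0.le, mul_comm ((T ^ j) ^ (-η)), ← mul_assoc,
      ← Real.rpow_add hT0, add_neg_cancel, Real.rpow_zero, one_mul,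
      ← Real.rpow_add (by positivity), neg_add_cancel, Real.rpow_zero, ENNReal.ofReal_one, one_mul]
    exact le_rfl

/-- The ratio of the geometric sequences that control the norm of a sum of Littlewood-Paley
blocks. -/
def decay (T η : ℝ) : ℝ≥0∞ :=
  ENNReal.ofReal (max (T ^ (-η)) (T ^ (η - 1)))

theorem decay_lt_one {T η : ℝ} (hT : 1 < T) (h0 : 0 < η) (h1 : η < 1) : decay T η < 1 := by
  rw [decay, ENNReal.ofReal_lt_one]
  exact max_lt (Real.rpow_lt_one_of_one_lt_of_neg hT (by linarith))
    (Real.rpow_lt_one_of_one_lt_of_neg hT (by linarith))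

theorem ofReal_rpow_le_decay_pow {T η s : ℝ} (hT : 0 < T) (hs : s = -η ∨ s = η - 1) (i : ℕ) :
    ENNReal.ofReal ((T ^ i) ^ s) ≤ decay T η ^ i := by
  rw [decay, ← ENNReal.ofReal_pow (by positivity), ← Real.rpow_natCast T i, ← Real.rpow_mul hT.le,
    mul_comm, Real.rpow_mul hT.le, Real.rpow_natCast]
  refine ENNReal.ofReal_le_ofReal (pow_le_pow_left₀ (by positivity) ?_ i)
  rcases hs with rfl | rfl
  · exact le_max_left _ _
  · exact le_max_right _ _

/-- The sum of the norms of the pieces is bounded by the entry at `0` of the convolution used below,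
so one Young inequality also yields the embedding of the Besov space in `L_p`. -/
theorem tsum_pieceBound_le {η : ℝ} (hη : 0 < η) (k : ℕ) (x : Functional d) :
    ∑' j, pieceBound θ φ p x j ≤ ENNReal.ofReal (((2 : ℝ) ^ k) ^ η) *
      ∑' j, decay ((2 : ℝ) ^ k) η ^ ((0 - j) + (j - 0)) * besovSeq θ φ (η * k) p x j := by
  rw [← ENNReal.tsum_mul_left]
  refine ENNReal.tsum_le_tsum fun j => (pieceBound_le hη k x j).trans ?_
  rw [Nat.zero_sub, Nat.sub_zero, zero_add]
  gcongr
  exact ofReal_rpow_le_decay_pow (by positivity) (Or.inl rfl) j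

/-- With `T = 2^k` and `t = T^{-n}`, pieces `j ≥ n` enter through the rough part with weight
`T^{-η(j-n)}`, pieces `j < n` through the smooth part with weight `T^{(η-1)(n-j)}`. Both ratios are
below one when `0 < η < 1`, and `decay` is the larger. -/
theorem IsLittlewoodPaley.exists_dyadic_le (hφ : IsLittlewoodPaley φ) {k : ℕ} {η : ℝ}
    (hη : 0 < η) :
    ∃ C : ℝ≥0∞, C ≠ ∞ ∧ ∀ (θ : Matrix (Fin d) (Fin d) ℝ) (p : ℝ≥0∞), 1 ≤ p → ∀ x : Functional d,
      IsDistribution θ x → ∑' j, pieceBound θ φ p x j ≠ ∞ → ∀ n : ℕ,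
      dyadic η ((2 : ℝ) ^ k) (kLpSobolev θ k p x) n ≤ C *
        ∑' j, decay ((2 : ℝ) ^ k) η ^ ((n - j) + (j - n)) * besovSeq θ φ (η * k) p x j := by
  obtain ⟨C, hC, h⟩ := hφ.exists_kFunctional_le (k := k)
  set T : ℝ := 2 ^ k with hT
  have hT0 : 0 < T := by positivity
  refine ⟨(1 + C) * ENNReal.ofReal (T ^ η), by finiteness, fun θ p hp x hx he n => ?_⟩
  set b := besovSeq θ φ (η * k) p x with hb
  set e := pieceBound θ φ p x with hedef
  set A := ENNReal.ofReal (T ^ η) with hA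
  set w : ℕ → ℝ≥0∞ := fun j => decay T η ^ ((n - j) + (j - n)) * b j with hw
  set g := ENNReal.ofReal ((T ^ n) ^ η) with hg
  have hfar : ∀ i, g * e (i + n) ≤ A * w (i + n) := fun i => by
    have h1 : (n - (i + n)) + (i + n - n) = i := by omega
    calc g * e (i + n) ≤ g * (A * (ENNReal.ofReal ((T ^ (i + n)) ^ (-η)) * b (i + n))) := by
          gcongr
          exact pieceBound_le hη k x _
      _ = A * (ENNReal.ofReal ((T ^ i) ^ (-η)) * b (i + n)) := by
          rw [mul_left_comm, ← mul_assoc g, hg, ← ENNReal.ofReal_mul (by positivity), pow_add,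
            Real.mul_rpow (by positivity) (by positivity), mul_left_comm ((T ^ n) ^ η),
            ← Real.rpow_add (by positivity), add_neg_cancel, Real.rpow_zero, mul_one]
      _ ≤ A * w (i + n) := by
          simp only [hw, h1]
          gcongr
          exact ofReal_rpow_le_decay_pow hT0 (Or.inl rfl) i
  have hnear : ∀ j ∈ Finset.range n, g * (ENNReal.ofReal (T ^ n)⁻¹ * (ENNReal.ofReal (T ^ j) * e j)) ≤
      A * w j := fun j hj => by
    have hjn : j < n := Finset.mem_range.1 hj
    obtain ⟨i, rfl⟩ := Nat.exists_eq_add_of_le hjn.le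
    have h1 : (j + i - j) + (j - (j + i)) = i := by omega
    have h2 : (T ^ (j + i)) ^ η * ((T ^ (j + i))⁻¹ * (T ^ j * (T ^ j) ^ (-η))) = (T ^ i) ^ (η - 1) := by
      rw [pow_add, Real.mul_rpow (by positivity) (by positivity), Real.rpow_sub_one (by positivity),
        Real.rpow_neg (by positivity)]
      have : (T ^ j) ^ η ≠ 0 := by positivity
      field_simp
    calc g * (ENNReal.ofReal (T ^ (j + i))⁻¹ * (ENNReal.ofReal (T ^ j) * e j))
        ≤ g * (ENNReal.ofReal (T ^ (j + i))⁻¹ * (ENNReal.ofReal (T ^ j) *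
            (A * (ENNReal.ofReal ((T ^ j) ^ (-η)) * b j)))) := by
          gcongr
          exact pieceBound_le hη k x j
      _ = A * (ENNReal.ofReal ((T ^ i) ^ (η - 1)) * b j) := by
          rw [← h2, ENNReal.ofReal_mul (by positivity), ENNReal.ofReal_mul (by positivity),
            ENNReal.ofReal_mul (by positivity)]
          ring
      _ ≤ A * w j := by
          simp only [hw, h1]
          gcongr
          exact ofReal_rpow_le_decay_pow hT0 (Or.inr rfl) i
  calc dyadic η T (kLpSobolev θ k p x) n
      ≤ g * (∑' i, e (i + n) + ENNReal.ofReal (T ^ n)⁻¹ *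
          ∑ j ∈ Finset.range n, C * (ENNReal.ofReal (T ^ j) * e j)) :=
        mul_le_mul' le_rfl (h θ p hp x hx he n _)
    _ = ∑' i, g * e (i + n) + C * ∑ j ∈ Finset.range n,
          g * (ENNReal.ofReal (T ^ n)⁻¹ * (ENNReal.ofReal (T ^ j) * e j)) := by
        rw [mul_add, ENNReal.tsum_mul_left, ← Finset.mul_sum, ← Finset.mul_sum, ← Finset.mul_sum]
        ring
    _ ≤ ∑' i, A * w (i + n) + C * ∑ j ∈ Finset.range n, A * w j :=
        add_le_add (ENNReal.tsum_le_tsum hfar) (mul_le_mul' le_rfl (Finset.sum_le_sum hnear))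
    _ ≤ A * ∑' j, w j + C * (A * ∑' j, w j) := by
        rw [ENNReal.tsum_mul_left, ← Finset.mul_sum]
        exact add_le_add (mul_le_mul' le_rfl
          (ENNReal.tsum_comp_le_tsum_of_injective (add_left_injective n) w))
          (mul_le_mul' le_rfl (mul_le_mul' le_rfl (ENNReal.sum_le_tsum _)))
    _ = _ := by ring

theorem sobolevNorm_zero (hp : 1 ≤ p) (k : ℕ) : sobolevNorm θ k p (0 : Functional d) = 0 := by
  have h := sobolevNorm_scalar_le (θ := θ) hp k 0
  rw [scalar_zero, enorm_zero, mul_zero] at h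
  exact nonpos_iff_eq_zero.1 h

theorem zero_mem_Sobolev (hp : 1 ≤ p) (k : ℕ) : (0 : Functional d) ∈ Sobolev θ k p := by
  have h := scalar_mem_Sobolev (θ := θ) hp k 0
  rwa [scalar_zero] at h

theorem kLpSobolev_le_lpNorm (hp : 1 ≤ p) (k : ℕ) {x : Functional d} (hx : x ∈ Lp θ p) (t : ℝ) :
    kLpSobolev θ k p x t ≤ lpNorm θ p x := by
  refine (kFunctional_le hx (zero_mem_Sobolev hp k) (add_zero x).symm t).trans (le_of_eq ?_)
  rw [sobolevNorm_zero hp, mul_zero, add_zero]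

theorem IsLittlewoodPaley.mem_Lp_of_tsum_pieceBound (hφ : IsLittlewoodPaley φ) (hp : 1 ≤ p)
    {x : Functional d} (hx : IsDistribution θ x) (he : ∑' j, pieceBound θ φ p x j ≠ ∞) :
    x ∈ Lp θ p ∧ lpNorm θ p x ≤ ∑' j, pieceBound θ φ p x j := by
  have h := ENNReal.tsum_le_tsum fun j => lpNorm_piece_le (φ := φ) (θ := θ) hp x j
  obtain ⟨h1, h2⟩ := lpNorm_le_tsum hp (ne_top_of_le_ne_top he h) (hφ.hasSum_piece hx)
  exact ⟨h1, h2.trans h⟩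

/-- Young's inequality bounds the sampled K-functional; for large `t` the decomposition `x + 0`
gives `K ≤ ‖x‖_p`, which the embedding in `L_p` bounds by the Besov norm. -/
theorem IsLittlewoodPaley.exists_scaleNorm_le (hφ : IsLittlewoodPaley φ) {k : ℕ} (hk : 1 ≤ k)
    {η : ℝ} (h0 : 0 < η) (h1 : η < 1) {q : ℝ≥0∞} (hq : 1 ≤ q) :
    ∃ C : ℝ≥0∞, C ≠ ∞ ∧ ∀ (θ : Matrix (Fin d) (Fin d) ℝ) (p : ℝ≥0∞), 1 ≤ p →
      ∀ x ∈ Besov θ φ (η * k) p q, x ∈ Lp θ p ∧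
        scaleNorm η q (kLpSobolev θ k p x) ≤ C * besovNorm θ φ (η * k) p q x := by
  set T : ℝ := 2 ^ k with hT
  have hT2 : 2 ≤ T := by
    calc (2 : ℝ) = 2 ^ 1 := (pow_one 2).symm
      _ ≤ T := pow_le_pow_right₀ (by norm_num) hk
  obtain ⟨C₁, hC₁, hb₁⟩ := hφ.exists_dyadic_le (k := k) h0
  obtain ⟨C₂, hC₂, hb₂⟩ := QTorus.exists_scaleNorm_le hq h0 hT2
  set r := decay T η with hr
  have hr1 : (1 - r)⁻¹ ≠ ∞ :=
    ENNReal.inv_ne_top.2 (tsub_pos_of_lt (decay_lt_one (by linarith) h0 h1)).ne'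
  refine ⟨C₂ * (C₁ * (2 * (1 - r)⁻¹) + ENNReal.ofReal (T ^ η) * (2 * (1 - r)⁻¹)), by finiteness,
    fun θ p hp x hx => ?_⟩
  have hB := besovNorm_eq (θ := θ) (φ := φ) (p := p) (η * k) q x
  have he : ∑' j, pieceBound θ φ p x j ≤
      ENNReal.ofReal (T ^ η) * (2 * (1 - r)⁻¹) * besovNorm θ φ (η * k) p q x := by
    refine (tsum_pieceBound_le h0 k x).trans ?_
    rw [mul_assoc, hB]
    gcongr
    exact (le_lqNorm hq (fun n => ∑' j, r ^ ((n - j) + (j - n)) * besovSeq θ φ (η * k) p x j) 0).trans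
      (lqNorm_conv_le hq r _)
  have het : ∑' j, pieceBound θ φ p x j ≠ ∞ :=
    ne_top_of_le_ne_top (ENNReal.mul_ne_top (by finiteness) hx.2.ne) he
  obtain ⟨hxL, hxn⟩ := hφ.mem_Lp_of_tsum_pieceBound hp hx.1 het
  refine ⟨hxL, (hb₂ _ (fun s t _ hst => kFunctional_mono _ _ _ _ x hst) _
    fun t _ => kLpSobolev_le_lpNorm hp k hxL t).trans ?_⟩
  rw [mul_assoc, add_mul]
  gcongr
  · rw [hB]
    exact lqNorm_le_of_le_conv hq (hb₁ θ p hp x hx.1 het)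
  · exact hxn.trans he

theorem Sobolev_subset_Lp (k : ℕ) : Sobolev θ k p ⊆ Lp θ p := fun x hx => by
  have h := hx.2 0 (mem_multiIdx.2 (by simp))
  rwa [D_zero] at h

theorem exists_modulus_equiv (d : ℕ) {k : ℕ} (hk : 1 ≤ k) :
    ∃ C : ℝ≥0, 0 < C ∧ ∀ (θ : Matrix (Fin d) (Fin d) ℝ) (p : ℝ≥0∞), 1 ≤ p → ∀ x ∈ Lp θ p,
      ∀ ε : ℝ, 0 < ε → ε ≤ 1 →
        kFunctional (Lp θ p) (Sobolev θ k p) (lpNorm θ p) (sobolevNorm θ k p) x (ε ^ k)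
          ≤ C * (ENNReal.ofReal (ε ^ k) * ‖coeff θ x 0‖ₑ + modulus θ k p x ε) ∧
        ENNReal.ofReal (ε ^ k) * ‖coeff θ x 0‖ₑ + modulus θ k p x ε
          ≤ C * kFunctional (Lp θ p) (Sobolev θ k p) (lpNorm θ p) (sobolevNorm θ k p) x
            (ε ^ k) := by
  obtain ⟨C, hC, h⟩ := kFunctional_le_modulus d hk
  set B : ℝ≥0∞ := 1 + 2 ^ k + d ^ k with hB
  have ht : C + B ≠ ∞ := by finiteness
  refine ⟨(C + B).toNNReal, ENNReal.toNNReal_pos ?_ ht, fun θ p hp x hx ε hε hε1 => ?_⟩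
  · simp [hB]
  · rw [ENNReal.coe_toNNReal ht]
    exact ⟨(h θ p hp x hx ε hε).trans (mul_le_mul' le_self_add le_rfl),
      (modulus_le_kFunctional hp k x hε hε1).trans (mul_le_mul' le_add_self le_rfl)⟩

theorem IsLittlewoodPaley.interpSpace_eq_Besov (hφ : IsLittlewoodPaley φ) {k : ℕ} (hk : 1 ≤ k)
    {η : ℝ} (h0 : 0 < η) (h1 : η < 1) {q : ℝ≥0∞} (hp : 1 ≤ p) (hq : 1 ≤ q) :
    interpSpace (Lp θ p) (Sobolev θ k p) (lpNorm θ p) (sobolevNorm θ k p) η q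
      = Besov θ φ (η * k) p q ∧
    ∃ C : ℝ≥0, 0 < C ∧ ∀ x ∈ Besov θ φ (η * k) p q,
      interpNorm (Lp θ p) (Sobolev θ k p) (lpNorm θ p) (sobolevNorm θ k p) η q x
        ≤ C * besovNorm θ φ (η * k) p q x ∧
      besovNorm θ φ (η * k) p q x
        ≤ C * interpNorm (Lp θ p) (Sobolev θ k p) (lpNorm θ p) (sobolevNorm θ k p) η q x := by
  obtain ⟨C₁, hC₁, hb₁⟩ := hφ.exists_scaleNorm_le hk h0 h1 hq
  obtain ⟨C₂, hC₂, hb₂⟩ := hφ.exists_besovNorm_le hk h0 hq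
  refine ⟨Subset.antisymm ?_ ?_, ?_⟩
  · rintro x ⟨⟨x₀, hx₀, x₁, hx₁, rfl⟩, hx⟩
    exact ⟨isDistribution_of_mem_Lp hp (add_mem_Lp hp hx₀ (Sobolev_subset_Lp k hx₁)),
      (hb₂ θ p hp _).trans_lt (ENNReal.mul_lt_top hC₂.lt_top hx)⟩
  · intro x hx
    obtain ⟨hxL, hxn⟩ := hb₁ θ p hp x hx
    exact ⟨⟨x, hxL, 0, zero_mem_Sobolev hp k, (add_zero x).symm⟩,
      hxn.trans_lt (ENNReal.mul_lt_top hC₁.lt_top hx.2)⟩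
  · have ht : C₁ + C₂ + 1 ≠ ∞ := by finiteness
    refine ⟨(C₁ + C₂ + 1).toNNReal, ENNReal.toNNReal_pos (by simp) ht, fun x hx => ?_⟩
    rw [ENNReal.coe_toNNReal ht]
    exact ⟨(hb₁ θ p hp x hx).2.trans (mul_le_mul' (le_self_add.trans le_self_add) le_rfl),
      (hb₂ θ p hp x).trans (mul_le_mul' (le_add_self.trans le_self_add) le_rfl)⟩

end QTorus

end

theorem mainTheorem10 (d : ℕ) (hd : 2 ≤ d) (k : ℕ) (hk : 1 ≤ k) :
    (∃ C : ℝ≥0, 0 < C ∧ ∀ θ : Matrix (Fin d) (Fin d) ℝ, θ.transpose = -θ →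
      ∀ p : ℝ≥0∞, 1 ≤ p → ∀ x ∈ QTorus.Lp θ p, ∀ ε : ℝ, 0 < ε → ε ≤ 1 →
        QTorus.kFunctional (QTorus.Lp θ p) (QTorus.Sobolev θ k p)
            (QTorus.lpNorm θ p) (QTorus.sobolevNorm θ k p) x (ε ^ k)
          ≤ C * (ENNReal.ofReal (ε ^ k) * ‖QTorus.coeff θ x 0‖ₑ + QTorus.modulus θ k p x ε) ∧
        ENNReal.ofReal (ε ^ k) * ‖QTorus.coeff θ x 0‖ₑ + QTorus.modulus θ k p x ε
          ≤ C * QTorus.kFunctional (QTorus.Lp θ p) (QTorus.Sobolev θ k p)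
            (QTorus.lpNorm θ p) (QTorus.sobolevNorm θ k p) x (ε ^ k)) ∧
    (∀ θ : Matrix (Fin d) (Fin d) ℝ, θ.transpose = -θ →
      ∀ p q : ℝ≥0∞, 1 ≤ p → 1 ≤ q → ∀ η : ℝ, 0 < η → η < 1 →
      ∀ φ : 𝓢(EuclideanSpace ℝ (Fin d), ℝ), QTorus.IsLittlewoodPaley φ →
        QTorus.interpSpace (QTorus.Lp θ p) (QTorus.Sobolev θ k p)
            (QTorus.lpNorm θ p) (QTorus.sobolevNorm θ k p) η q
          = QTorus.Besov θ φ (η * k) p q ∧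
        ∃ C : ℝ≥0, 0 < C ∧ ∀ x ∈ QTorus.Besov θ φ (η * k) p q,
          QTorus.interpNorm (QTorus.Lp θ p) (QTorus.Sobolev θ k p)
              (QTorus.lpNorm θ p) (QTorus.sobolevNorm θ k p) η q x
            ≤ C * QTorus.besovNorm θ φ (η * k) p q x ∧
          QTorus.besovNorm θ φ (η * k) p q x
            ≤ C * QTorus.interpNorm (QTorus.Lp θ p) (QTorus.Sobolev θ k p)
              (QTorus.lpNorm θ p) (QTorus.sobolevNorm θ k p) η q x) := by
  obtain ⟨C, hC, h⟩ := QTorus.exists_modulus_equiv d hk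
  exact ⟨⟨C, hC, fun θ _ => h θ⟩, fun θ _ p q hp hq η h0 h1 φ hφ =>
    hφ.interpSpace_eq_Besov hk h0 h1 hp hq⟩
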